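/- Let $L>0$, $N\in\{1,2,\dots\}$, $\ell\in\{0,1\}$. Write $(\cdot,\cdot)_2$ for the inner product of $L^2(0,L)$, $\lambda_j=(j\pi/L)^2$, $e_j(x)=\sqrt{2/L}\,\sin(j\pi x/L)$, and $P_j\varphi=\sum_{i=1}^j (e_i,\varphi)_2\,e_i$. For $\nu,\mu>0$ define the kernel $$k(x,y)=-\frac{\mu y}{2\nu}\sum_{m=0}^\infty\Big(-\frac{\mu}{4\nu}\Big)^m\frac{(x^2-y^2)^m}{m!\,(m+1)!},\qquad (\Upsilon_k\psi)(x)=\int_0^x k(x,y)\psi(y)\,dy,$$ and, recursively, $\Phi_0=0$ and $$\Phi_j\varphi=(I-\Phi_{j-1})[\Upsilon_kP_j\varphi]-\frac{\big((I-\Phi_{j-1})[\Upsilon_kP_j\varphi],e_j\big)_2}{1+\big((I-\Phi_{j-1})[\Upsilon_ke_j],e_j\big)_2}\,(I-\Phi_{j-1})[\Upsilon_ke_j].$$ The pair $(\mu,N)$ is admissible if $\big((I-\Phi_{j-1})[\Upsilon_ke_j],e_j\big)_2\ne-1$ for $1\le j\le N$. The feedback is $g(P_N\varphi)=\int_0^L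 k(L,y)\,\Gamma[P_N\varphi](y)\,dy$ with $\Gamma=I-P_N\Phi_N$. Consider the closed-loop problem $$u_t-\nu u_{xx}-\alpha u=0\ \ (0<x<L,\ t>0),\qquad u(0,t)=0,\quad u(L,t)=g(P_Nu(t)),\quad u(x,0)=u_0(x).\tag{1}$$ A weak solution of (1) is a $u\in L^2_{loc}([0,\infty);L^2(0,L))$ such that $$\int_0^\infty\!\!\int_0^L u\,(\varphi_t+\nu\varphi_{xx}+\alpha\varphi)\,dx\,dt+\int_0^L u_0\,\varphi(\cdot,0)\,dx-\nu\int_0^\infty g(P_Nu(t))\,\varphi_x(L,t)\,dt=0$$ for all smooth $\varphi$ that vanish for large $t$ and at $x=0$ and $x=L$. Let $X_T^\ell=L^\infty(0,T;H^\ell(0,L))\cap L^2(0,T;H^{1+\ell}(0,L))$. Theorem. Let $\nu,\alpha>0$, $\mu>\alpha-\nu\lambda_1\ge0$, let $(\mu,N)$ be admissible, and let $u_0\in H^\ell(0,L)$; if $\ell=1$, let $u_0$ also satisfy the compatibility conditions $u_0(0)=0$ and $u_0(L)=g(P_Nu_0)$. Then (1) has exactly one weak solution $u$; it belongs to $X_T^\ell$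 for every $T>0$, and for a.e. $t>0$ it satisfies $u(0,t)=0$ and the feedback law $u(L,t)=g(P_Nu(t))$ in the sense of traces. Moreover, if $$N>\max\Big\{\frac{\mu}{2\nu\lambda_1}-1,\ \frac{\mu}{\mu+\nu\lambda_1-\alpha}-1\Big\},$$ then $$\|u(t)\|_{H^\ell(0,L)}\le c_k\,e^{-\gamma t}\,\|u_0\|_{H^\ell(0,L)}\quad\text{for a.e. }t\ge0,\qquad \gamma=\nu\lambda_1-\alpha+\mu\Big(1-\frac1{N+1}\Big),$$ where $c_k\ge0$ depends only on the kernel $k$ and on $L,N,\ell$; in particular it does not depend on $u_0$. -/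

import Mathlib

open MeasureTheory Set
open scoped ContDiff ENNReal

namespace FiniteBackstepping

noncomputable section

/-- Lebesgue measure on the interval `(0, L)`. -/
abbrev intervalMeasure (L : ℝ) : Measure ℝ := volume.restrict (Ioo 0 L)

/-- The Hilbert space `L²(0, L)`. -/
abbrev L2 (L : ℝ) : Type := Lp ℝ 2 (intervalMeasure L)

/-! ### Sobolev spaces on `(0, L)` -/

/-- `g` is the weak derivative of `f` on `(0, L)`:
`∫ f φ' = - ∫ g φ` for all `φ ∈ C_c^∞(0, L)`. -/
def IsWeakDeriv (L : ℝ) (f g : L2 L) : Prop :=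
  ∀ φ : ℝ → ℝ, ContDiff ℝ ∞ φ → HasCompactSupport φ → tsupport φ ⊆ Ioo 0 L →
    ∫ x in Ioo 0 L, f x * deriv φ x = - ∫ x in Ioo 0 L, g x * φ x

theorem integrable_mul_test {L : ℝ} (f : L2 L) {ψ : ℝ → ℝ} (hψ : Continuous ψ)
    (hc : HasCompactSupport ψ) :
    Integrable (fun x => f x * ψ x) (intervalMeasure L) :=
  MemLp.integrable_mul (p := 2) (q := 2) (Lp.memLp f)
    (hψ.memLp_of_hasCompactSupport hc)

theorem IsWeakDeriv.add {L : ℝ} {f₁ g₁ f₂ g₂ : L2 L} (h₁ : IsWeakDeriv L f₁ g₁)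
    (h₂ : IsWeakDeriv L f₂ g₂) : IsWeakDeriv L (f₁ + f₂) (g₁ + g₂) := by
  intro φ hφ hc hs
  have hd : Continuous (deriv φ) := hφ.continuous_deriv (by simp)
  have e₁ : ∫ x in Ioo 0 L, (f₁ + f₂) x * deriv φ x
      = (∫ x in Ioo 0 L, f₁ x * deriv φ x) + ∫ x in Ioo 0 L, f₂ x * deriv φ x := by
    rw [← integral_add (integrable_mul_test f₁ hd hc.deriv)
      (integrable_mul_test f₂ hd hc.deriv)]
    refine integral_congr_ae ?_
    filter_upwards [Lp.coeFn_add f₁ f₂] with x hx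
    rw [hx, Pi.add_apply, add_mul]
  have e₂ : ∫ x in Ioo 0 L, (g₁ + g₂) x * φ x
      = (∫ x in Ioo 0 L, g₁ x * φ x) + ∫ x in Ioo 0 L, g₂ x * φ x := by
    rw [← integral_add (integrable_mul_test g₁ hφ.continuous hc)
      (integrable_mul_test g₂ hφ.continuous hc)]
    refine integral_congr_ae ?_
    filter_upwards [Lp.coeFn_add g₁ g₂] with x hx
    rw [hx, Pi.add_apply, add_mul]
  rw [e₁, e₂, h₁ φ hφ hc hs, h₂ φ hφ hc hs]
  ring

theorem IsWeakDeriv.smul {L : ℝ} {f g : L2 L} (c : ℝ) (h : IsWeakDeriv L f g) :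
    IsWeakDeriv L (c • f) (c • g) := by
  intro φ hφ hc hs
  have e₁ : ∫ x in Ioo 0 L, (c • f) x * deriv φ x = c * ∫ x in Ioo 0 L, f x * deriv φ x := by
    rw [← integral_const_mul]
    refine integral_congr_ae ?_
    filter_upwards [Lp.coeFn_smul c f] with x hx
    rw [hx, Pi.smul_apply, smul_eq_mul, mul_assoc]
  have e₂ : ∫ x in Ioo 0 L, (c • g) x * φ x = c * ∫ x in Ioo 0 L, g x * φ x := by
    rw [← integral_const_mul]
    refine integral_congr_ae ?_
    filter_upwards [Lp.coeFn_smul c g] with x hx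
    rw [hx, Pi.smul_apply, smul_eq_mul, mul_assoc]
  rw [e₁, e₂, h φ hφ hc hs]
  ring

theorem IsWeakDeriv.zero {L : ℝ} : IsWeakDeriv L 0 0 := by
  intro φ hφ hc hs
  have e : ∀ ψ : ℝ → ℝ, ∫ x in Ioo 0 L, (0 : L2 L) x * ψ x = 0 := by
    intro ψ
    rw [integral_eq_zero_of_ae]
    filter_upwards [Lp.coeFn_zero ℝ 2 (intervalMeasure L)] with x hx
    rw [hx]
    simp
  rw [e, e, neg_zero]

/-- `H^m(0, L)`, realised as the space of tuples `(f, f', …, f^{(m)})` of a function in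
`L²(0, L)` and its weak derivatives, with norm `(∑ i ≤ m, ‖f^{(i)}‖²)^{1/2}`. -/
def sobolevSubmodule (L : ℝ) (m : ℕ) : Submodule ℝ (PiLp 2 (fun _ : Fin (m + 1) => L2 L)) where
  carrier := {F | ∀ i : Fin m, IsWeakDeriv L (F i.castSucc) (F i.succ)}
  add_mem' h₁ h₂ i := (h₁ i).add (h₂ i)
  zero_mem' _ := IsWeakDeriv.zero
  smul_mem' c _ h i := (h i).smul c

/-- The normed space `H^m(0, L)`. -/
abbrev Sobolev (L : ℝ) (m : ℕ) : Type := sobolevSubmodule L m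

/-- The inclusion `H^m(0, L) → L²(0, L)`. -/
def Sobolev.toL2 {L : ℝ} {m : ℕ} (v : Sobolev L m) : L2 L := v.1 0

/-- `f` has the boundary values `a` at `0` and `b` at `L`: it has a representative that is
continuous on `[0, L]` and takes these values. For `f ∈ H¹(0, L)` this is the trace. -/
def HasBoundaryValues (L : ℝ) (f : L2 L) (a b : ℝ) : Prop :=
  ∃ F : ℝ → ℝ, ContinuousOn F (Icc 0 L) ∧ f =ᵐ[intervalMeasure L] F ∧ F 0 = a ∧ F L = b

/-- `u ∈ X_T^ℓ = L^∞(0, T; H^ℓ(0, L)) ∩ L²(0, T; H^{1+ℓ}(0, L))`. -/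
def MemX (L : ℝ) (ℓ : ℕ) (T : ℝ) (u : ℝ → L2 L) : Prop :=
  (∃ v : ℝ → Sobolev L ℓ, MemLp v ∞ (volume.restrict (Ioo 0 T)) ∧
    ∀ᵐ t ∂volume.restrict (Ioo 0 T), (v t).toL2 = u t) ∧
  (∃ v : ℝ → Sobolev L (1 + ℓ), MemLp v 2 (volume.restrict (Ioo 0 T)) ∧
    ∀ᵐ t ∂volume.restrict (Ioo 0 T), (v t).toL2 = u t)

/-! ### The controller -/

/-- `λ_j = (jπ/L)²`. -/
def eigenvalue (L : ℝ) (j : ℕ) : ℝ := (j * Real.pi / L) ^ 2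

/-- `e_j(x) = √(2/L) sin(jπx/L)`. -/
def sineMode (L : ℝ) (j : ℕ) (x : ℝ) : ℝ := √(2 / L) * Real.sin (j * Real.pi * x / L)

/-- The `L²(0, L)` inner product `(φ, ψ)₂`. -/
def pairing (L : ℝ) (φ ψ : ℝ → ℝ) : ℝ := ∫ x in Ioo 0 L, φ x * ψ x

/-- `P_N φ = ∑_{j=1}^N (e_j, φ)₂ e_j`. -/
def proj (L : ℝ) (N : ℕ) (φ : ℝ → ℝ) (x : ℝ) : ℝ :=
  ∑ j ∈ Finset.Icc 1 N, sineMode L j x * pairing L (sineMode L j) φ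

/-- The backstepping kernel `k(x, y)`. -/
def kernel (ν μ : ℝ) (x y : ℝ) : ℝ :=
  -(μ * y / (2 * ν)) *
    ∑' m : ℕ, (-(μ / (4 * ν))) ^ m * ((x ^ 2 - y ^ 2) ^ m / (m.factorial * (m + 1).factorial))

/-- `(Υ_k ψ)(x) = ∫_0^x k(x, y) ψ(y) dy`. -/
def volterra (k : ℝ → ℝ → ℝ) (ψ : ℝ → ℝ) (x : ℝ) : ℝ := ∫ y in (0 : ℝ)..x, k x y * ψ y

/-- The operators `Φ_j`, defined by `Φ_0 = 0` and
`Φ_j φ = (I - Φ_{j-1})[Υ_k P_j φ]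
  - ((I - Φ_{j-1})[Υ_k P_j φ], e_j)₂ / (1 + ((I - Φ_{j-1})[Υ_k e_j], e_j)₂)
    * (I - Φ_{j-1})[Υ_k e_j]`. -/
def invOp (L : ℝ) (k : ℝ → ℝ → ℝ) : ℕ → (ℝ → ℝ) → (ℝ → ℝ)
  | 0, _ => 0
  | j + 1, φ =>
    let A : (ℝ → ℝ) → (ℝ → ℝ) := fun ψ => ψ - invOp L k j ψ
    let a : ℝ → ℝ := A (volterra k (proj L (j + 1) φ))
    let b : ℝ → ℝ := A (volterra k (sineMode L (j + 1)))
    a - (pairing L a (sineMode L (j + 1)) / (1 + pairing L b (sineMode L (j + 1)))) • b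

/-- Admissibility: `((I - Φ_{j-1})[Υ_k e_j], e_j)₂ ≠ -1` for `1 ≤ j ≤ N`. It depends on the
decay rate `μ` through the kernel `k`. -/
def Admissible (L : ℝ) (k : ℝ → ℝ → ℝ) (N : ℕ) : Prop :=
  ∀ j ∈ Finset.Icc 1 N,
    pairing L (volterra k (sineMode L j) - invOp L k (j - 1) (volterra k (sineMode L j)))
      (sineMode L j) ≠ -1

/-- `Γ = I - P_N Φ_N`. -/
def gammaOp (L : ℝ) (k : ℝ → ℝ → ℝ) (N : ℕ) (φ : ℝ → ℝ) : ℝ → ℝ :=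
  φ - proj L N (invOp L k N φ)

/-- The feedback `g(P_N φ) = ∫_0^L k(L, y) Γ[P_N φ](y) dy`. -/
def feedback (L : ℝ) (k : ℝ → ℝ → ℝ) (N : ℕ) (φ : ℝ → ℝ) : ℝ :=
  ∫ y in Ioo 0 L, k L y * gammaOp L k N (proj L N φ) y

/-! ### The closed-loop plant -/

/-- `u` is a (global) weak solution of
`u_t - ν u_xx - α u = 0`, `u(0, t) = 0`, `u(L, t) = g(P_N u(t))`, `u(x, 0) = u₀(x)`,
in the sense of testing with smooth `φ` that vanish for large times and at `x = 0` and `x = L`.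
No more than `u ∈ L²_loc([0, ∞); L²(0, L))` is asked of `u`; the boundary and initial conditions
are contained in the integral identity. Note that `u` and `φ` take the time as first argument. -/
structure IsWeakSolution (L ν α : ℝ) (k : ℝ → ℝ → ℝ) (N : ℕ) (u₀ : L2 L) (u : ℝ → L2 L) :
    Prop where
  memLp : ∀ T : ℝ, 0 < T → MemLp u 2 (volume.restrict (Ioo 0 T))
  weak : ∀ φ : ℝ → ℝ → ℝ, ContDiff ℝ ∞ (Function.uncurry φ) →
    (∃ R : ℝ, ∀ t x : ℝ, R ≤ t → φ t x = 0) → (∀ t : ℝ, φ t 0 = 0 ∧ φ t L = 0) →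
    (∫ t in Ioi (0 : ℝ), ∫ x in Ioo 0 L,
        u t x * (deriv (fun s => φ s x) t + ν * iteratedDeriv 2 (φ t) x + α * φ t x))
      + (∫ x in Ioo 0 L, u₀ x * φ 0 x)
      - ν * (∫ t in Ioi (0 : ℝ), feedback L k N (u t) * deriv (φ t) L) = 0

end

end FiniteBackstepping

namespace FiniteBackstepping

noncomputable section

/-! ### The kernel maps sines to sines -/

/-! Put β = μ/ν. The transform I + Υ_k acts explicitly on sines: it sends sin(θx) to (θ/√(θ²+β))
sin(√(θ²+β) x) (`integral_kernel_mul_sin`). Hence E_j = (I + Υ_k)e_j satisfies -E_j'' = (λ_j + β)E_j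
and E_j(0) = 0. Admissibility makes I - Φ_N a right inverse of I + Υ_k P_N
(`sub_invOp_add_volterra`), so the matrix M = ((e_i, E_j)₂) with i, j ≤ N is invertible. With c(φ) =
M⁻¹((e_i, φ)₂)_i, the feedback becomes g(P_N φ) = Σ_j c_j(φ) E_j(L) (`feedback_eq`).

The closed loop is therefore diagonal in the system E_1, …, E_N, e_{N+1}, e_{N+2}, …. Every member
is an eigenfunction of the second derivative, vanishes at 0 and obeys the feedback law at L
(`feedbackCLM_modeL2`). The solution is the series of these modes with factors exp(-κ_j t), where
κ_j = ν(λ_j + β) - α for j ≤ N and κ_j = νλ_j - α for j > N (`mode_weak`, `solution_weak`). The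
system differs from the orthonormal sine basis by finitely many smooth corrections, so every
estimate reduces to one for sine series. To expand u₀, the corrections Σ c_j(u₀)(E_j - e_j) are
subtracted and the remainder is developed in sines. For ℓ = 1 the compatibility conditions say
exactly that this remainder vanishes at both ends, which gives its sine coefficients the decay
needed in H¹ (`summable_modeCoef`).

The factors exp(-κ_j t) gain one derivative in L² of time (`memLp_two_tsum_evol`) and make the
series converge uniformly in x for t > 0, so the traces can be read off term by term
(`hasBoundaryValues_synth`).

For uniqueness, the difference of two solutions is tested with χ(t)e_j. The first N equations form a
closed system which M⁻¹ diagonalises by Green's identity (`coefCLM_diagonalizes`), so the c_j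
vanish. The feedback then vanishes too, and each sine coefficient solves a homogeneous scalar
equation with zero initial value. Completeness of the sines concludes (`IsWeakSolution.ae_eq`).

Decay at rate γ is the inequality γ ≤ κ_j for all j (`decayRate_le_modeRate`): the controlled modes
are shifted by μ, and the others decay fast enough once N is large. -/

/-- A Beta integral. Splitting off one factor x² - y² relates the case (m + 1, p) to (m, p) and (m,
p + 1), so the induction on m must carry all p at once. -/
theorem integral_sq_sub_sq_pow_mul_pow (x : ℝ) (m : ℕ) : ∀ p : ℕ,
    ∫ y in (0 : ℝ)..x, (x ^ 2 - y ^ 2) ^ m * y ^ (2 * p)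
      = 4 ^ m * m.factorial * (2 * p).factorial * (m + p).factorial /
          (p.factorial * (2 * m + 2 * p + 1).factorial) * x ^ (2 * m + 2 * p + 1) := by
  induction m with
  | zero =>
    intro p
    have h1 : ((2 * p).factorial : ℝ) ≠ 0 := by positivity
    have h2 : (p.factorial : ℝ) ≠ 0 := by positivity
    have h3 : (2 * (p : ℝ) + 1) ≠ 0 := by positivity
    simp only [pow_zero, one_mul, integral_pow, mul_zero, zero_add, Nat.factorial_succ]
    push_cast
    simp
    field_simp
  | succ m ih =>
    intro p
    have e : ∀ y : ℝ, (x ^ 2 - y ^ 2) ^ (m + 1) * y ^ (2 * p)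
        = x ^ 2 * ((x ^ 2 - y ^ 2) ^ m * y ^ (2 * p))
          - (x ^ 2 - y ^ 2) ^ m * y ^ (2 * (p + 1)) := by intro y; ring
    simp only [e]
    rw [intervalIntegral.integral_sub, intervalIntegral.integral_const_mul, ih p, ih (p + 1)]
    · have a1 : 2 * (p + 1) = 2 * p + 1 + 1 := by ring
      have a2 : m + (p + 1) = m + p + 1 := by ring
      have a3 : 2 * m + (2 * p + 1 + 1) + 1 = (2 * m + 2 * p + 1) + 1 + 1 := by ring
      have a4 : 2 * (m + 1) + 2 * p + 1 = (2 * m + 2 * p + 1) + 1 + 1 := by ring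
      have a5 : m + 1 + p = m + p + 1 := by ring
      rw [a1, a2, a3, a4, a5]
      simp only [Nat.factorial_succ (2 * m + 2 * p + 1 + 1), Nat.factorial_succ (2 * m + 2 * p + 1),
        Nat.factorial_succ (2 * p + 1), Nat.factorial_succ (2 * p), Nat.factorial_succ m,
        Nat.factorial_succ p, Nat.factorial_succ (m + p)]
      have h1 : ((2 * p).factorial : ℝ) ≠ 0 := by positivity
      have h2 : (p.factorial : ℝ) ≠ 0 := by positivity
      have h3 : (m.factorial : ℝ) ≠ 0 := by positivity
      have h4 : ((m + p).factorial : ℝ) ≠ 0 := by positivity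
      have h5 : ((2 * m + 2 * p + 1).factorial : ℝ) ≠ 0 := by positivity
      have h6 : (2 * (m : ℝ) + 2 * p + 1 + 1) ≠ 0 := by positivity
      have h7 : (2 * (m : ℝ) + 2 * p + 1 + 1 + 1) ≠ 0 := by positivity
      have h8 : ((p : ℝ) + 1) ≠ 0 := by positivity
      push_cast
      field_simp
      ring
    · exact Continuous.intervalIntegrable (by fun_prop) _ _
    · exact Continuous.intervalIntegrable (by fun_prop) _ _

/-- The terms of the power series of `k(x, y) sin(θ y)`. -/
def kernelSineTerm (β θ x : ℝ) (q : ℕ × ℕ) (y : ℝ) : ℝ :=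
  (-(β * y / 2) * ((-(β / 4)) ^ q.1 *
    ((x ^ 2 - y ^ 2) ^ q.1 / (q.1.factorial * (q.1 + 1).factorial)))) *
  ((-1) ^ q.2 * (θ * y) ^ (2 * q.2 + 1) / (2 * q.2 + 1).factorial)

theorem abs_sq_sub_sq_le {x y : ℝ} (h : |y| ≤ |x|) : |x ^ 2 - y ^ 2| ≤ x ^ 2 := by
  have := sq_le_sq.2 h
  rw [abs_of_nonneg (by linarith)]
  nlinarith [sq_nonneg y]

theorem abs_le_of_mem_uIcc {x y : ℝ} (h : y ∈ uIcc 0 x) : |y| ≤ |x| := by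
  rcases mem_uIcc.1 h with ⟨h1, h2⟩ | ⟨h1, h2⟩
  · rw [abs_of_nonneg h1, abs_of_nonneg (h1.trans h2)]; exact h2
  · rw [abs_of_nonpos h2, abs_of_nonpos (h1.trans h2)]; linarith

/-- Discarding (m + 1)! leaves the terms of an exponential series that do not depend on y. This
majorant serves both continuity in y and termwise integration. -/
theorem kernel_term_bound {β x y : ℝ} (hβ : 0 < β) (h : |y| ≤ |x|) (m : ℕ) :
    ‖(-(β / 4)) ^ m * ((x ^ 2 - y ^ 2) ^ m / (m.factorial * (m + 1).factorial))‖
      ≤ (β / 4 * x ^ 2) ^ m / m.factorial := by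
  rw [norm_mul, norm_div, norm_pow, norm_pow, Real.norm_eq_abs, Real.norm_eq_abs, abs_neg,
    abs_of_pos (by positivity : 0 < β / 4), mul_pow, mul_div_assoc]
  have h1 : ‖((m.factorial : ℝ) * (m + 1).factorial)‖ = m.factorial * (m + 1).factorial := by
    rw [Real.norm_eq_abs, abs_of_pos (by positivity)]
  rw [h1]
  have h2 : (1 : ℝ) ≤ (m + 1).factorial := by exact_mod_cast Nat.factorial_pos _
  have h3 : (0 : ℝ) < m.factorial := by positivity
  gcongr
  · exact abs_sq_sub_sq_le h
  · exact le_mul_of_one_le_right h3.le h2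

theorem hasSum_kernel {β x y : ℝ} (hβ : 0 < β) (h : |y| ≤ |x|) :
    HasSum (fun m : ℕ => -(β * y / 2) * ((-(β / 4)) ^ m *
      ((x ^ 2 - y ^ 2) ^ m / (m.factorial * (m + 1).factorial)))) (kernel 1 β x y) := by
  have hs : Summable fun m : ℕ => (-(β / 4)) ^ m *
      ((x ^ 2 - y ^ 2) ^ m / (m.factorial * (m + 1).factorial)) :=
    Summable.of_norm_bounded (Real.summable_pow_div_factorial (β / 4 * x ^ 2))
      (kernel_term_bound hβ h)
  have := hs.hasSum.mul_left (-(β * y / 2))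
  simpa [kernel] using this

theorem continuousOn_kernel {β : ℝ} (hβ : 0 < β) (x : ℝ) :
    ContinuousOn (kernel 1 β x) (uIcc 0 x) := by
  have h : ContinuousOn (fun y => ∑' m : ℕ, (-(β / (4 * 1))) ^ m *
      ((x ^ 2 - y ^ 2) ^ m / (m.factorial * (m + 1).factorial))) (uIcc 0 x) := by
    refine continuousOn_tsum (u := fun m : ℕ => (β / 4 * x ^ 2) ^ m / m.factorial) ?_
      (Real.summable_pow_div_factorial _) ?_
    · intro m
      fun_prop
    · intro m y hy
      rw [mul_one]
      exact kernel_term_bound hβ (abs_le_of_mem_uIcc hy) m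
  unfold kernel
  exact ContinuousOn.mul (by fun_prop) h

/-- The Beta integral, arranged as a binomial term: the exponent `m + p + 1 - p` is left unreduced
to match `add_pow` when the terms with m + p = n are added. -/
theorem integral_kernelSineTerm (β θ x : ℝ) (m p : ℕ) :
    ∫ y in (0 : ℝ)..x, kernelSineTerm β θ x (m, p) y
      = θ * ((-(θ ^ 2)) ^ p * (-β) ^ (m + p + 1 - p) * ((m + p + 1).choose p : ℝ)) *
        (x ^ (2 * (m + p) + 3) / (2 * (m + p) + 3).factorial) := by
  have e : ∀ y, kernelSineTerm β θ x (m, p) y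
      = (-(β / 2) * (-(β / 4)) ^ m / (m.factorial * (m + 1).factorial) *
          ((-1) ^ p * θ ^ (2 * p + 1) / (2 * p + 1).factorial)) *
        ((x ^ 2 - y ^ 2) ^ m * y ^ (2 * (p + 1))) := by
    intro y
    simp only [kernelSineTerm]
    rw [mul_pow]
    ring
  simp only [e]
  rw [intervalIntegral.integral_const_mul, integral_sq_sub_sq_pow_mul_pow]
  have a1 : 2 * (p + 1) = 2 * p + 1 + 1 := by ring
  have a2 : m + (p + 1) = m + p + 1 := by ring
  have a3 : 2 * m + (2 * p + 1 + 1) + 1 = 2 * (m + p) + 3 := by ring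
  have a4 : m + p + 1 - p = m + 1 := by omega
  -- The factorial (m + p + 1)! produced by the Beta integral is what turns 1/(p! (m + 1)!) into a
  -- binomial coefficient.
  have hc : ((m + p + 1).choose p : ℝ) * (p.factorial * (m + 1).factorial)
      = (m + p + 1).factorial := by
    have := Nat.choose_mul_factorial_mul_factorial (show p ≤ m + p + 1 by omega)
    rw [a4, mul_assoc] at this
    exact_mod_cast this
  rw [a1, a2, a3, a4, ← hc]
  simp only [Nat.factorial_succ (2 * p + 1), Nat.factorial_succ (2 * p), Nat.factorial_succ m,
        Nat.factorial_succ p]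
  have h1 : ((2 * p).factorial : ℝ) ≠ 0 := by positivity
  have h2 : (p.factorial : ℝ) ≠ 0 := by positivity
  have h3 : (m.factorial : ℝ) ≠ 0 := by positivity
  have h5 : ((2 * (m + p) + 3).factorial : ℝ) ≠ 0 := by positivity
  have h6 : (2 * (p : ℝ) + 1 + 1) ≠ 0 := by positivity
  have h7 : (2 * (p : ℝ) + 1) ≠ 0 := by positivity
  have h8 : ((p : ℝ) + 1) ≠ 0 := by positivity
  have h9 : ((m : ℝ) + 1) ≠ 0 := by positivity
  have f1 : (-(β / 4)) ^ m = (-β) ^ m / 4 ^ m := by rw [← neg_div, div_pow]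
  have f2 : θ ^ (2 * p + 1) = θ * (θ ^ 2) ^ p := by rw [pow_succ, pow_mul]; ring
  have f3 : (-(θ ^ 2)) ^ p = (-1) ^ p * (θ ^ 2) ^ p := by rw [← mul_pow]; ring
  rw [f1, f2, f3]
  push_cast
  field_simp
  ring

/-- The antidiagonal gives the binomial expansion of (-θ² - β)^(n+1) without its last term
(-θ²)^(n+1), which accounts for the difference. -/
theorem sum_antidiagonal_integral_kernelSineTerm (β θ x : ℝ) (n : ℕ) :
    ∑ q ∈ Finset.HasAntidiagonal.antidiagonal n, ∫ y in (0 : ℝ)..x, kernelSineTerm β θ x q y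
      = θ * ((-(θ ^ 2 + β)) ^ (n + 1) - (-(θ ^ 2)) ^ (n + 1)) *
        (x ^ (2 * (n + 1) + 1) / (2 * (n + 1) + 1).factorial) := by
  have h1 : ∀ q ∈ Finset.HasAntidiagonal.antidiagonal n, ∫ y in (0 : ℝ)..x, kernelSineTerm β θ x q y
      = θ * ((-(θ ^ 2)) ^ q.2 * (-β) ^ (n + 1 - q.2) * ((n + 1).choose q.2 : ℝ)) *
        (x ^ (2 * (n + 1) + 1) / (2 * (n + 1) + 1).factorial) := by
    rintro ⟨m, p⟩ hq
    obtain rfl : m + p = n := by simpa using hq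
    rw [integral_kernelSineTerm, show 2 * (m + p) + 3 = 2 * (m + p + 1) + 1 by ring]
  rw [Finset.sum_congr rfl h1, ← Finset.sum_mul, ← Finset.mul_sum]
  congr 2
  -- Reflecting the range makes the power of -θ² the summation index; `sum_range_succ` then peels
  -- off the missing top term.
  rw [Finset.Nat.sum_antidiagonal_eq_sum_range_succ_mk,
    ← Finset.sum_range_reflect, neg_add, add_pow, Finset.sum_range_succ _ (n + 1)]
  simp only [Nat.sub_self, pow_zero, Nat.choose_self, Nat.cast_one, mul_one, add_sub_cancel_right]
  refine Finset.sum_congr rfl fun j hj => ?_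
  have hj' : j < n + 1 := Finset.mem_range.1 hj
  have : n - (n.succ - 1 - j) = j := by omega
  rw [this]

/-- Multiply the two power series, integrate termwise and regroup by total degree. The coefficients
that appear are those of the difference of the two sine series. This is what makes the whole closed
loop explicit. -/
theorem integral_kernel_mul_sin {β : ℝ} (hβ : 0 < β) (θ x : ℝ) :
    ∫ y in (0 : ℝ)..x, kernel 1 β x y * Real.sin (θ * y)
      = θ / √(θ ^ 2 + β) * Real.sin (√(θ ^ 2 + β) * x) - Real.sin (θ * x) := by
  -- A summable majorant, uniform for |y| ≤ |x|: an exponential series times the hyperbolic sine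
  -- series of |θx|.
  set b : ℕ × ℕ → ℝ := fun q => (β * |x| / 2 * ((β / 4 * x ^ 2) ^ q.1 / q.1.factorial)) *
    (|θ * x| ^ (2 * q.2 + 1) / (2 * q.2 + 1).factorial) with hb
  have hsinh : Summable fun p : ℕ => |θ * x| ^ (2 * p + 1) / (2 * p + 1).factorial :=
    (Real.summable_pow_div_factorial |θ * x|).comp_injective
      (i := fun p : ℕ => 2 * p + 1) (fun a c h => by simpa using h)
  have hbs : Summable b := by
    refine summable_mul_of_summable_norm
      (f := fun m : ℕ => β * |x| / 2 * ((β / 4 * x ^ 2) ^ m / m.factorial))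
      (g := fun p : ℕ => |θ * x| ^ (2 * p + 1) / (2 * p + 1).factorial) ?_ hsinh.norm
    exact ((Real.summable_pow_div_factorial (β / 4 * x ^ 2)).mul_left _).norm
  have hbound : ∀ q : ℕ × ℕ, ∀ y, |y| ≤ |x| → ‖kernelSineTerm β θ x q y‖ ≤ b q := by
    rintro ⟨m, p⟩ y hy
    simp only [kernelSineTerm, hb]
    rw [norm_mul, norm_mul]
    gcongr
    · rw [Real.norm_eq_abs, abs_neg, abs_div, abs_mul, abs_of_pos hβ, abs_two]
      gcongr
    · exact kernel_term_bound hβ hy m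
    · have hf : ‖((2 * p + 1).factorial : ℝ)‖ = (2 * p + 1).factorial := Real.norm_natCast _
      rw [norm_div, norm_mul, norm_pow, norm_neg, norm_one, one_pow, one_mul, norm_pow, hf,
        Real.norm_eq_abs, abs_mul, abs_mul]
      gcongr
  have hlim : ∀ y, |y| ≤ |x| →
      HasSum (fun q => kernelSineTerm β θ x q y) (kernel 1 β x y * Real.sin (θ * y)) := by
    intro y hy
    have hs : Summable (fun q => kernelSineTerm β θ x q y) :=
      Summable.of_norm_bounded hbs fun q => hbound q y hy
    have h1 := hasSum_kernel hβ hy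
    have h2 := Real.hasSum_sin (θ * y)
    simp only [kernelSineTerm] at hs ⊢
    exact HasSum.mul (f := fun m : ℕ => -(β * y / 2) * ((-(β / 4)) ^ m *
      ((x ^ 2 - y ^ 2) ^ m / (m.factorial * (m + 1).factorial))))
      (g := fun p : ℕ => (-1) ^ p * (θ * y) ^ (2 * p + 1) / (2 * p + 1).factorial) h1 h2 hs
  have hsub : ∀ y ∈ uIoc 0 x, |y| ≤ |x| := fun y hy => abs_le_of_mem_uIcc (uIoc_subset_uIcc hy)
  have h1 : HasSum (fun q => ∫ y in (0 : ℝ)..x, kernelSineTerm β θ x q y)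
      (∫ y in (0 : ℝ)..x, kernel 1 β x y * Real.sin (θ * y)) := by
    refine intervalIntegral.hasSum_integral_of_dominated_convergence (fun q _ => b q) ?_ ?_ ?_ ?_ ?_
    · intro q
      refine Continuous.aestronglyMeasurable ?_
      unfold kernelSineTerm
      fun_prop
    · exact fun q => .of_forall fun y hy => hbound q y (hsub y hy)
    · exact .of_forall fun y hy => hbs
    · exact intervalIntegrable_const
    · exact .of_forall fun y hy => hlim y (hsub y hy)
  have h2 : HasSum (fun n : ℕ => ∑ q ∈ Finset.HasAntidiagonal.antidiagonal n,
      ∫ y in (0 : ℝ)..x, kernelSineTerm β θ x q y)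
      (∫ y in (0 : ℝ)..x, kernel 1 β x y * Real.sin (θ * y)) := by
    refine HasSum.sigma (f := fun s : (Σ n : ℕ, Finset.HasAntidiagonal.antidiagonal n) =>
        ∫ y in (0 : ℝ)..x, kernelSineTerm β θ x s.2 y)
      ((Finset.HasAntidiagonal.sigmaAntidiagonalEquivProd.hasSum_iff
        (f := fun q => ∫ y in (0 : ℝ)..x, kernelSineTerm β θ x q y)).2 h1) fun n => ?_
    rw [← Finset.sum_coe_sort]
    exact hasSum_fintype _
  have hpos : 0 < θ ^ 2 + β := by positivity
  have h3 : HasSum (fun n : ℕ => θ * ((-(θ ^ 2 + β)) ^ n - (-(θ ^ 2)) ^ n) *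
        (x ^ (2 * n + 1) / (2 * n + 1).factorial))
      (θ / √(θ ^ 2 + β) * Real.sin (√(θ ^ 2 + β) * x) - Real.sin (θ * x)) := by
    have := ((Real.hasSum_sin (√(θ ^ 2 + β) * x)).mul_left (θ / √(θ ^ 2 + β))).sub
      (Real.hasSum_sin (θ * x))
    refine this.congr_fun fun n => ?_
    have f1 : (-(θ ^ 2 + β)) ^ n = (-1) ^ n * (√(θ ^ 2 + β) ^ 2) ^ n := by
      rw [Real.sq_sqrt hpos.le, ← mul_pow]; ring
    have f3 : (-(θ ^ 2)) ^ n = (-1) ^ n * (θ ^ 2) ^ n := by rw [← mul_pow]; ring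
    have hs : √(θ ^ 2 + β) ≠ 0 := (Real.sqrt_pos.2 hpos).ne'
    rw [f1, f3]
    field_simp
    ring
  -- The linear terms of the two sines cancel, so the series may start at n = 1 and then matches the
  -- antidiagonal sums.
  have h4 := (hasSum_nat_add_iff' 1).2 h3
  simp only [Finset.range_one, Finset.sum_singleton, pow_zero, sub_self, mul_zero, zero_mul,
    sub_zero] at h4
  refine h2.unique (h4.congr_fun fun n => ?_)
  rw [sum_antidiagonal_integral_kernelSineTerm]

/-! ### Sine functions and their derivatives -/

/-- The frequency `jπ/L`. -/
def freq (L : ℝ) (j : ℕ) : ℝ := j * Real.pi / L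

theorem freq_pos {L : ℝ} (hL : 0 < L) {j : ℕ} (hj : 0 < j) : 0 < freq L j := by
  unfold freq
  have : (0 : ℝ) < j := by exact_mod_cast hj
  positivity

theorem freq_sq (L : ℝ) (j : ℕ) : freq L j ^ 2 = eigenvalue L j := rfl

theorem freq_mul_self {L : ℝ} (hL : 0 < L) (j : ℕ) : freq L j * L = j * Real.pi := by
  unfold freq; field_simp

/-- The `n`-th derivative of `√(2/L) sin(θ x)`. -/
def sineDeriv (L θ : ℝ) (n : ℕ) (x : ℝ) : ℝ :=
  √(2 / L) * (θ ^ n * Real.sin (θ * x + n * (Real.pi / 2)))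

theorem hasDerivAt_sineDeriv (L θ : ℝ) (n : ℕ) (x : ℝ) :
    HasDerivAt (sineDeriv L θ n) (sineDeriv L θ (n + 1) x) x := by
  have h1 : HasDerivAt (fun x => θ * x + n * (Real.pi / 2)) θ x := by
    simpa using ((hasDerivAt_id x).const_mul θ).add_const (n * (Real.pi / 2))
  have h2 := (h1.sin.const_mul (θ ^ n)).const_mul √(2 / L)
  refine h2.congr_deriv ?_
  unfold sineDeriv
  have : θ * x + ((n + 1 : ℕ) : ℝ) * (Real.pi / 2)
      = θ * x + n * (Real.pi / 2) + Real.pi / 2 := by push_cast; ring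
  rw [this, Real.sin_add_pi_div_two]
  ring

theorem sineDeriv_add_two (L θ : ℝ) (n : ℕ) (x : ℝ) :
    sineDeriv L θ (n + 2) x = -(θ ^ 2) * sineDeriv L θ n x := by
  unfold sineDeriv
  have : θ * x + ((n + 2 : ℕ) : ℝ) * (Real.pi / 2)
      = θ * x + n * (Real.pi / 2) + Real.pi := by push_cast; ring
  rw [this, Real.sin_add_pi]
  ring

theorem continuous_sineDeriv (L θ : ℝ) (n : ℕ) : Continuous (sineDeriv L θ n) := by
  unfold sineDeriv; fun_prop

theorem sineDeriv_zero_zero (L θ : ℝ) : sineDeriv L θ 0 0 = 0 := by simp [sineDeriv]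

theorem sineMode_eq_sineDeriv (L : ℝ) (j : ℕ) : sineMode L j = sineDeriv L (freq L j) 0 := by
  ext x
  simp only [sineMode, sineDeriv, freq, pow_zero, one_mul, Nat.cast_zero, zero_mul, add_zero]
  ring_nf

theorem sineMode_zero (L : ℝ) (j : ℕ) : sineMode L j 0 = 0 := by simp [sineMode]

theorem sineMode_right {L : ℝ} (hL : 0 < L) (j : ℕ) : sineMode L j L = 0 := by
  have : (j : ℝ) * Real.pi * L / L = j * Real.pi := by field_simp
  simp [sineMode, this, Real.sin_nat_mul_pi]

theorem continuous_sineMode (L : ℝ) (j : ℕ) : Continuous (sineMode L j) := by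
  rw [sineMode_eq_sineDeriv]; exact continuous_sineDeriv _ _ _

theorem integral_cos_mul_add {a b : ℝ} (c L : ℝ) (ha : a ≠ 0) (h0 : Real.sin c = 0)
    (hb : a * L + c = b) (h1 : Real.sin b = 0) :
    ∫ x in (0 : ℝ)..L, Real.cos (a * x + c) = 0 := by
  have hd : ∀ x ∈ uIcc 0 L, HasDerivAt (fun x => Real.sin (a * x + c) / a)
      (Real.cos (a * x + c)) x := by
    intro x _
    have h1 : HasDerivAt (fun x => a * x + c) a x := by
      simpa using ((hasDerivAt_id x).const_mul a).add_const c
    refine (h1.sin.div_const a).congr_deriv ?_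
    field_simp
  rw [intervalIntegral.integral_eq_sub_of_hasDerivAt hd
    (Continuous.intervalIntegrable (by fun_prop) _ _)]
  simp [hb, h0, h1]

theorem setIntegral_Ioo_eq {L : ℝ} (hL : 0 < L) (f : ℝ → ℝ) :
    ∫ x in Ioo 0 L, f x = ∫ x in (0 : ℝ)..L, f x := by
  rw [intervalIntegral.integral_of_le hL.le, integral_Ioc_eq_integral_Ioo]

/-- Product-to-sum: the phases nπ/2 cancel in the difference and add up to nπ in the sum, so the
boundary terms are sines of multiples of π. Having every n makes the modes orthogonal in each H^m,
not only in L². -/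
theorem integral_sineDeriv_mul {L : ℝ} (hL : 0 < L) (n : ℕ) {i j : ℕ} (hi : 0 < i) :
    ∫ x in Ioo 0 L, sineDeriv L (freq L i) n x * sineDeriv L (freq L j) n x
      = if i = j then eigenvalue L i ^ n else 0 := by
  have e : ∀ x, sineDeriv L (freq L i) n x * sineDeriv L (freq L j) n x
      = (freq L i ^ n * freq L j ^ n / L) *
        (Real.cos ((freq L i - freq L j) * x + 0)
          - Real.cos ((freq L i + freq L j) * x + n * Real.pi)) := by
    intro x
    have h2 : √(2 / L) * √(2 / L) = 2 / L := Real.mul_self_sqrt (by positivity)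
    obtain ⟨A, hA⟩ : ∃ A, A = freq L i * x + n * (Real.pi / 2) := ⟨_, rfl⟩
    obtain ⟨B, hB⟩ : ∃ B, B = freq L j * x + n * (Real.pi / 2) := ⟨_, rfl⟩
    have h3 : (freq L i - freq L j) * x + 0 = A - B := by rw [hA, hB]; ring
    have h4 : (freq L i + freq L j) * x + n * Real.pi = A + B := by rw [hA, hB]; ring
    rw [h3, h4, Real.cos_sub, Real.cos_add]
    simp only [sineDeriv]
    rw [← hA, ← hB]
    calc _ = (√(2 / L) * √(2 / L)) * (freq L i ^ n * freq L j ^ n * (Real.sin A * Real.sin B)) := by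
          ring
      _ = _ := by rw [h2]; ring
  have hsin : ∀ z : ℤ, Real.sin (z * Real.pi) = 0 := Real.sin_int_mul_pi
  have h1 : ∫ x in (0 : ℝ)..L, Real.cos ((freq L i + freq L j) * x + n * Real.pi) = 0 := by
    refine integral_cos_mul_add (b := ((i + j + n : ℤ) : ℝ) * Real.pi) _ _ ?_ ?_ ?_ (hsin _)
    · have := freq_pos hL hi
      have : 0 ≤ freq L j := by unfold freq; positivity
      positivity
    · exact_mod_cast hsin n
    · rw [add_mul, freq_mul_self hL, freq_mul_self hL]; push_cast; ring
  rw [setIntegral_Ioo_eq hL]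
  simp only [e]
  rw [intervalIntegral.integral_const_mul, intervalIntegral.integral_sub, h1]
  · split_ifs with hij
    · subst hij
      simp only [sub_self, zero_mul, add_zero, Real.cos_zero, intervalIntegral.integral_const,
        smul_eq_mul, mul_one, sub_zero, ← freq_sq]
      rw [div_mul_cancel₀ _ hL.ne', ← mul_pow, sq]
    · have h2 : ∫ x in (0 : ℝ)..L, Real.cos ((freq L i - freq L j) * x + 0) = 0 := by
        refine integral_cos_mul_add (b := ((i - j : ℤ) : ℝ) * Real.pi) _ _ ?_ ?_ ?_ (hsin _)
        · rw [sub_ne_zero]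
          intro h
          have hh := congrArg (· * L) h
          simp only [freq_mul_self hL] at hh
          exact hij (by exact_mod_cast mul_right_cancel₀ Real.pi_ne_zero hh)
        · simp
        · rw [add_zero, sub_mul, freq_mul_self hL, freq_mul_self hL]; push_cast; ring
      rw [h2]; simp
  · exact Continuous.intervalIntegrable (by fun_prop) _ _
  · exact Continuous.intervalIntegrable (by fun_prop) _ _

theorem pairing_sineMode {L : ℝ} (hL : 0 < L) {i j : ℕ} (hi : 0 < i) :
    pairing L (sineMode L i) (sineMode L j) = if i = j then 1 else 0 := by
  simpa only [pairing, sineMode_eq_sineDeriv, pow_zero] using integral_sineDeriv_mul hL 0 hi (j := j)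

/-! ### The pairing on square integrable functions -/

theorem memLp_of_continuous {L : ℝ} {f : ℝ → ℝ} (hf : Continuous f) :
    MemLp f 2 (intervalMeasure L) := by
  obtain ⟨C, hC⟩ := (isCompact_Icc (a := (0 : ℝ)) (b := L)).exists_bound_of_continuousOn
    hf.continuousOn
  refine MemLp.of_bound hf.aestronglyMeasurable C ?_
  filter_upwards [ae_restrict_mem measurableSet_Ioo] with x hx
  exact hC x (Ioo_subset_Icc_self hx)

theorem pairing_comm (L : ℝ) (f g : ℝ → ℝ) : pairing L f g = pairing L g f := by
  simp only [pairing, mul_comm]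

theorem pairing_add {L : ℝ} {e f g : ℝ → ℝ} (he : MemLp e 2 (intervalMeasure L))
    (hf : MemLp f 2 (intervalMeasure L)) (hg : MemLp g 2 (intervalMeasure L)) :
    pairing L e (f + g) = pairing L e f + pairing L e g := by
  simp only [pairing, Pi.add_apply, mul_add]
  exact integral_add (he.integrable_mul hf) (he.integrable_mul hg)

theorem pairing_smul (L : ℝ) (c : ℝ) (e f : ℝ → ℝ) :
    pairing L e (c • f) = c * pairing L e f := by
  simp only [pairing, Pi.smul_apply, smul_eq_mul]
  rw [← integral_const_mul]
  exact integral_congr_ae (.of_forall fun x => by ring)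

theorem pairing_sub {L : ℝ} {e f g : ℝ → ℝ} (he : MemLp e 2 (intervalMeasure L))
    (hf : MemLp f 2 (intervalMeasure L)) (hg : MemLp g 2 (intervalMeasure L)) :
    pairing L e (f - g) = pairing L e f - pairing L e g := by
  simp only [pairing, Pi.sub_apply, mul_sub]
  exact integral_sub (he.integrable_mul hf) (he.integrable_mul hg)

theorem pairing_sum {L : ℝ} {ι : Type*} (s : Finset ι) {e : ℝ → ℝ} {f : ι → ℝ → ℝ} (c : ι → ℝ)
    (he : MemLp e 2 (intervalMeasure L)) (hf : ∀ i, MemLp (f i) 2 (intervalMeasure L)) :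
    pairing L e (∑ i ∈ s, c i • f i) = ∑ i ∈ s, c i * pairing L e (f i) := by
  induction s using Finset.cons_induction with
  | empty => simp [pairing]
  | cons a s ha ih =>
    rw [Finset.sum_cons, Finset.sum_cons, pairing_add he ((hf a).const_smul _), ih, pairing_smul]
    exact memLp_finsetSum' _ fun i _ => (hf i).const_smul _

/-- Passes from the indices 1, …, N of the controller to the zero-based indices of matrices and
series, where index j stands for mode j + 1. -/
theorem sum_Icc_one_eq_sum_fin {M : Type*} [AddCommMonoid M] (N : ℕ) (f : ℕ → M) :
    ∑ i ∈ Finset.Icc 1 N, f i = ∑ i : Fin N, f (i + 1) := by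
  induction N with
  | zero => simp
  | succ n ih => rw [Finset.sum_Icc_succ_top (by omega), ih, Fin.sum_univ_castSucc]; rfl

theorem memLp_sineMode (L : ℝ) (j : ℕ) : MemLp (sineMode L j) 2 (intervalMeasure L) :=
  memLp_of_continuous (continuous_sineMode L j)

/-! ### The transformed modes -/

/-- The frequency `√(λ_j + β)`. -/
def shiftFreq (L β : ℝ) (j : ℕ) : ℝ := √(freq L j ^ 2 + β)

/-- The image of `e_j` under `I + Υ_k`: a sine of frequency `√(λ_j + β)`. -/
def shiftMode (L β : ℝ) (j : ℕ) (n : ℕ) (x : ℝ) : ℝ :=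
  freq L j / shiftFreq L β j * sineDeriv L (shiftFreq L β j) n x

theorem continuous_shiftMode (L β : ℝ) (j n : ℕ) : Continuous (shiftMode L β j n) :=
  continuous_const.mul (continuous_sineDeriv _ _ _)

theorem volterra_sineMode {β : ℝ} (hβ : 0 < β) (L : ℝ) (j : ℕ) :
    volterra (kernel 1 β) (sineMode L j) = shiftMode L β j 0 - sineMode L j := by
  ext x
  rw [sineMode_eq_sineDeriv]
  have e : ∀ y, kernel 1 β x y * sineDeriv L (freq L j) 0 y
      = √(2 / L) * (kernel 1 β x y * Real.sin (freq L j * y)) := by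
    intro y; simp [sineDeriv]; ring
  simp only [volterra, e]
  rw [intervalIntegral.integral_const_mul, integral_kernel_mul_sin hβ]
  simp [sineDeriv, shiftMode, shiftFreq]
  ring

theorem intervalIntegrable_kernel_mul {β : ℝ} (hβ : 0 < β) {f : ℝ → ℝ} (hf : Continuous f)
    (x : ℝ) : IntervalIntegrable (fun y => kernel 1 β x y * f y) volume 0 x :=
  ((continuousOn_kernel hβ x).mul hf.continuousOn).intervalIntegrable

theorem volterra_sum {β : ℝ} (hβ : 0 < β) {ι : Type*} (s : Finset ι) {f : ι → ℝ → ℝ}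
    (hf : ∀ i, Continuous (f i)) (c : ι → ℝ) (x : ℝ) :
    volterra (kernel 1 β) (fun y => ∑ i ∈ s, f i y * c i) x
      = ∑ i ∈ s, c i * volterra (kernel 1 β) (f i) x := by
  unfold volterra
  simp only [Finset.mul_sum]
  rw [intervalIntegral.integral_finsetSum]
  · refine Finset.sum_congr rfl fun i _ => ?_
    rw [← intervalIntegral.integral_const_mul]
    refine intervalIntegral.integral_congr fun y _ => ?_
    ring
  · intro i _
    exact intervalIntegrable_kernel_mul hβ ((hf i).mul continuous_const) x

theorem volterra_proj {β : ℝ} (hβ : 0 < β) (L : ℝ) (n : ℕ) (φ : ℝ → ℝ) :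
    volterra (kernel 1 β) (proj L n φ) = ∑ i ∈ Finset.Icc 1 n,
      pairing L (sineMode L i) φ • volterra (kernel 1 β) (sineMode L i) := by
  ext x
  rw [Finset.sum_apply]
  exact volterra_sum hβ _ (fun i => continuous_sineMode L i) _ x

theorem memLp_volterra_sineMode {β : ℝ} (hβ : 0 < β) (L : ℝ) (j : ℕ) :
    MemLp (volterra (kernel 1 β) (sineMode L j)) 2 (intervalMeasure L) := by
  rw [volterra_sineMode hβ]
  exact memLp_of_continuous ((continuous_shiftMode _ _ _ _).sub (continuous_sineMode _ _))

/-- `I - Φ_j` is a right inverse of `I + Υ_k P_j`. -/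
theorem sub_invOp_add_volterra {L β : ℝ} (hβ : 0 < β) : ∀ j : ℕ,
    Admissible L (kernel 1 β) j → ∀ φ : ℝ → ℝ, MemLp φ 2 (intervalMeasure L) →
      MemLp (φ - invOp L (kernel 1 β) j φ) 2 (intervalMeasure L) ∧
      (φ - invOp L (kernel 1 β) j φ) + ∑ i ∈ Finset.Icc 1 j,
        pairing L (sineMode L i) (φ - invOp L (kernel 1 β) j φ) •
          volterra (kernel 1 β) (sineMode L i) = φ := by
  intro j
  induction j with
  | zero => intro _ φ hφ; simp [invOp, hφ]
  | succ j ih =>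
    intro hadm φ hφ
    have hadm' : Admissible L (kernel 1 β) j := fun i hi =>
      hadm i (Finset.mem_Icc.2 ⟨(Finset.mem_Icc.1 hi).1, (Finset.mem_Icc.1 hi).2.trans j.le_succ⟩)
    have hY : ∀ i, MemLp (volterra (kernel 1 β) (sineMode L i)) 2 (intervalMeasure L) :=
      memLp_volterra_sineMode hβ L
    have he : ∀ i, MemLp (sineMode L i) 2 (intervalMeasure L) := memLp_sineMode L
    have hP : MemLp (volterra (kernel 1 β) (proj L (j + 1) φ)) 2 (intervalMeasure L) := by
      rw [volterra_proj hβ]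
      exact memLp_finsetSum' _ fun i _ => (hY i).const_smul _
    obtain ⟨ha, haB⟩ := ih hadm' _ hP
    obtain ⟨hb, hbB⟩ := ih hadm' _ (hY (j + 1))
    have hne := hadm (j + 1) (Finset.mem_Icc.2 ⟨by omega, le_rfl⟩)
    rw [Nat.add_sub_cancel, pairing_comm] at hne
    have hΦ := invOp.eq_2 L (kernel 1 β) φ j
    simp only at hΦ
    rw [pairing_comm L _ (sineMode L (j + 1)), pairing_comm L _ (sineMode L (j + 1))] at hΦ
    set Y := fun i => volterra (kernel 1 β) (sineMode L i) with hYdef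
    set a := volterra (kernel 1 β) (proj L (j + 1) φ) -
      invOp L (kernel 1 β) j (volterra (kernel 1 β) (proj L (j + 1) φ)) with ha_def
    set b := volterra (kernel 1 β) (sineMode L (j + 1)) -
      invOp L (kernel 1 β) j (volterra (kernel 1 β) (sineMode L (j + 1))) with hb_def
    -- A Sherman–Morrison update: I + Υ_k P_{j+1} is a rank-one perturbation of I + Υ_k P_j, and
    -- admissibility says that the denominator is nonzero.
    set c := pairing L (sineMode L (j + 1)) a / (1 + pairing L (sineMode L (j + 1)) b) with hc
    have hcb : c * (1 + pairing L (sineMode L (j + 1)) b) = pairing L (sineMode L (j + 1)) a :=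
      div_mul_cancel₀ _ (fun h => hne (by linarith))
    have hψ : φ - invOp L (kernel 1 β) (j + 1) φ = φ - a + c • b := by rw [hΦ]; abel
    rw [hψ]
    have hpair : ∀ i, pairing L (sineMode L i) (φ - a + c • b)
        = pairing L (sineMode L i) φ - pairing L (sineMode L i) a
          + c * pairing L (sineMode L i) b := by
      intro i
      rw [pairing_add (he i) (hφ.sub ha) (hb.const_smul c), pairing_sub (he i) hφ ha, pairing_smul]
    refine ⟨(hφ.sub ha).add (hb.const_smul c), ?_⟩
    rw [Finset.sum_Icc_succ_top (by omega)]
    -- The choice of c makes the new coefficient of e_{j+1} equal to (e_{j+1}, φ)₂ - c, so that the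
    -- terms in c cancel against the inductive identity for b.
    have hlast : pairing L (sineMode L (j + 1)) (φ - a + c • b)
        = pairing L (sineMode L (j + 1)) φ - c := by
      rw [hpair, ← hcb]; ring
    rw [hlast]
    simp only [hpair, add_smul, sub_smul, Finset.sum_add_distrib, Finset.sum_sub_distrib, mul_smul,
      ← Finset.smul_sum]
    rw [volterra_proj hβ, Finset.sum_Icc_succ_top (by omega)] at haB
    ext x
    have h1 := congrFun haB x
    have h2 := congrFun hbB x
    simp only [Pi.add_apply, Pi.sub_apply, Pi.smul_apply, smul_eq_mul] at h1 h2 ⊢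
    linear_combination (-1 : ℝ) * h1 + c * h2

/-! ### The feedback functional -/

/-- The matrix of `P_N (I + Υ_k)` in the basis `e_1, …, e_N`. -/
def modeMatrix (L β : ℝ) (N : ℕ) : Matrix (Fin N) (Fin N) ℝ :=
  Matrix.of fun i j => pairing L (sineMode L (i + 1)) (shiftMode L β (j + 1) 0)

theorem memLp_shiftMode (L β : ℝ) (j n : ℕ) : MemLp (shiftMode L β j n) 2 (intervalMeasure L) :=
  memLp_of_continuous (continuous_shiftMode _ _ _ _)

/-- Pair the equation (I + Υ_k P_N)ψ = φ with e_i. Since Υ_k e_j = E_j - e_j, the identity and the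
correction together give exactly the entry (e_i, E_j)₂. -/
theorem modeMatrix_mulVec_pairing {L β : ℝ} (hL : 0 < L) (hβ : 0 < β) {N : ℕ} {ψ φ : ℝ → ℝ}
    (hψ : MemLp ψ 2 (intervalMeasure L))
    (h : ψ + ∑ i ∈ Finset.Icc 1 N, pairing L (sineMode L i) ψ •
      volterra (kernel 1 β) (sineMode L i) = φ) :
    (modeMatrix L β N).mulVec (fun i => pairing L (sineMode L (i + 1)) ψ)
      = fun i : Fin N => pairing L (sineMode L (i + 1)) φ := by
  ext i
  rw [← h, pairing_add (memLp_sineMode _ _) hψ, sum_Icc_one_eq_sum_fin, pairing_sum _ _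
    (memLp_sineMode _ _) (fun i : Fin N => memLp_volterra_sineMode hβ L (i + 1))]
  · have : ∀ j : Fin N, pairing L (sineMode L (i + 1)) (volterra (kernel 1 β) (sineMode L (j + 1)))
        = modeMatrix L β N i j - if i = j then 1 else 0 := by
      intro j
      rw [volterra_sineMode hβ, pairing_sub (memLp_sineMode _ _) (memLp_shiftMode _ _ _ _)
        (memLp_sineMode _ _), pairing_sineMode hL (by omega)]
      simp [modeMatrix, Fin.ext_iff]
    simp only [this, mul_sub, Finset.sum_sub_distrib, Matrix.mulVec, dotProduct]
    simp [mul_comm]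
  · exact memLp_finsetSum' _ fun i _ => (memLp_volterra_sineMode hβ L i).const_smul _

theorem pairing_proj {L : ℝ} (hL : 0 < L) {N : ℕ} (φ : ℝ → ℝ) (i : Fin N) :
    pairing L (sineMode L (i + 1)) (proj L N φ) = pairing L (sineMode L (i + 1)) φ := by
  have : proj L N φ = ∑ j : Fin N, pairing L (sineMode L (j + 1)) φ • sineMode L (j + 1) := by
    ext x
    simp only [proj, sum_Icc_one_eq_sum_fin, Finset.sum_apply, Pi.smul_apply, smul_eq_mul, mul_comm]
  rw [this, pairing_sum _ _ (memLp_sineMode _ _) (fun j : Fin N => memLp_sineMode L (j + 1))]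
  simp [pairing_sineMode hL, ← Fin.ext_iff]

theorem continuous_proj (L : ℝ) (N : ℕ) (φ : ℝ → ℝ) : Continuous (proj L N φ) := by
  unfold proj
  exact continuous_finsetSum _ fun i _ => (continuous_sineMode L i).mul continuous_const

/-- For a square matrix surjectivity suffices, so a right inverse of I + Υ_k P_N is enough: the
coefficients of (I - Φ_N)φ solve the system whose right-hand side is the coefficients of φ. -/
theorem isUnit_modeMatrix {L β : ℝ} (hL : 0 < L) (hβ : 0 < β) {N : ℕ}
    (hadm : Admissible L (kernel 1 β) N) : IsUnit (modeMatrix L β N) := by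
  rw [← Matrix.mulVec_surjective_iff_isUnit]
  intro y
  set φ : ℝ → ℝ := ∑ j : Fin N, y j • sineMode L (j + 1) with hφ
  have hm : MemLp φ 2 (intervalMeasure L) :=
    memLp_finsetSum' _ fun i _ => (memLp_sineMode L _).const_smul _
  obtain ⟨h1, h2⟩ := sub_invOp_add_volterra hβ N hadm φ hm
  refine ⟨_, (modeMatrix_mulVec_pairing hL hβ h1 h2).trans ?_⟩
  ext i
  rw [hφ, pairing_sum _ _ (memLp_sineMode _ _) (fun j : Fin N => memLp_sineMode L (j + 1))]
  simp [pairing_sineMode hL, ← Fin.ext_iff]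

/-- Γ P_N φ is P_N ψ with ψ = (I - Φ_N)P_N φ, and the coefficients of ψ are obtained with M⁻¹.
Applying ∫ k(L, y) · dy to e_j gives E_j(L) - e_j(L) = E_j(L). The recursive Φ_j do not occur any
more after this. -/
theorem feedback_eq {L β : ℝ} (hL : 0 < L) (hβ : 0 < β) {N : ℕ}
    (hadm : Admissible L (kernel 1 β) N) (φ : ℝ → ℝ) :
    feedback L (kernel 1 β) N φ = ∑ j : Fin N, ((modeMatrix L β N)⁻¹.mulVec
      (fun i => pairing L (sineMode L (i + 1)) φ)) j * shiftMode L β (j + 1) 0 L := by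
  set p := proj L N φ with hp
  have hpm : MemLp p 2 (intervalMeasure L) := memLp_of_continuous (continuous_proj _ _ _)
  obtain ⟨h1, h2⟩ := sub_invOp_add_volterra hβ N hadm p hpm
  set ψ := p - invOp L (kernel 1 β) N p with hψ
  have h3 := modeMatrix_mulVec_pairing hL hβ h1 h2
  have hdet := (Matrix.isUnit_iff_isUnit_det _).1 (isUnit_modeMatrix hL hβ hadm)
  have h4 : (modeMatrix L β N)⁻¹.mulVec (fun i => pairing L (sineMode L (i + 1)) φ)
      = fun i : Fin N => pairing L (sineMode L (i + 1)) ψ := by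
    have : (fun i : Fin N => pairing L (sineMode L (i + 1)) φ)
        = fun i : Fin N => pairing L (sineMode L (i + 1)) p := by
      ext i; rw [hp, pairing_proj hL]
    rw [this, ← h3, Matrix.mulVec_mulVec, Matrix.nonsing_inv_mul _ hdet, Matrix.one_mulVec]
  have h5 : gammaOp L (kernel 1 β) N p = fun y => ∑ j : Fin N,
      sineMode L (j + 1) y * pairing L (sineMode L (j + 1)) ψ := by
    ext y
    simp only [gammaOp, hp, Pi.sub_apply, proj, sum_Icc_one_eq_sum_fin]
    rw [← Finset.sum_sub_distrib]
    refine Finset.sum_congr rfl fun j _ => ?_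
    rw [← mul_sub]
    congr 1
    have e : invOp L (kernel 1 β) N p = p - ψ := by rw [hψ]; abel
    rw [← hp, e, pairing_sub (memLp_sineMode _ _) hpm h1, hp, pairing_proj hL]
    ring
  unfold feedback
  rw [← hp, h5, h4, setIntegral_Ioo_eq hL]
  have h6 := volterra_sum hβ Finset.univ (fun j : Fin N => continuous_sineMode L (j + 1))
    (fun j => pairing L (sineMode L (j + 1)) ψ) L
  unfold volterra at h6
  rw [h6]
  refine Finset.sum_congr rfl fun j _ => ?_
  have h7 := congrFun (volterra_sineMode hβ L (j + 1)) L
  unfold volterra at h7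
  rw [h7, Pi.sub_apply, sineMode_right hL, sub_zero]

/-! ### Completeness of the sine system -/

theorem ae_eq_zero_of_forall_test {U : Set ℝ} (hU : IsOpen U) {g : ℝ → ℝ}
    (hg : LocallyIntegrableOn g U)
    (h : ∀ φ : ℝ → ℝ, ContDiff ℝ ∞ φ → HasCompactSupport φ → tsupport φ ⊆ U →
      ∫ x in U, g x * φ x = 0) : ∀ᵐ x ∂volume.restrict U, g x = 0 := by
  rw [ae_restrict_iff' hU.measurableSet]
  refine hU.ae_eq_zero_of_integral_contDiff_smul_eq_zero hg fun φ hφ hc hs => ?_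
  have := h φ hφ hc hs
  rw [setIntegral_eq_integral_of_forall_compl_eq_zero] at this
  · simpa [mul_comm] using this
  · intro x hx
    rw [image_eq_zero_of_notMem_tsupport fun h => hx (hs h), mul_zero]

/-- The class in `L²(0, L)` of a continuous function. -/
def contL2 (L : ℝ) {f : ℝ → ℝ} (hf : Continuous f) : L2 L := (memLp_of_continuous hf).toLp f

theorem coeFn_contL2 {L : ℝ} {f : ℝ → ℝ} (hf : Continuous f) :
    contL2 L hf =ᵐ[intervalMeasure L] f := MemLp.coeFn_toLp _

theorem inner_eq_pairing {L : ℝ} (f g : L2 L) : inner ℝ f g = pairing L f g := by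
  rw [L2.inner_def, pairing]
  refine integral_congr_ae (.of_forall fun x => ?_)
  simp [mul_comm]

theorem pairing_congr {L : ℝ} {f f' g g' : ℝ → ℝ} (hf : f =ᵐ[intervalMeasure L] f')
    (hg : g =ᵐ[intervalMeasure L] g') : pairing L f g = pairing L f' g' :=
  integral_congr_ae (hf.mul hg)

theorem inner_contL2 {L : ℝ} {f : ℝ → ℝ} (hf : Continuous f) (g : L2 L) :
    inner ℝ (contL2 L hf) g = pairing L f g := by
  rw [inner_eq_pairing]
  exact pairing_congr (coeFn_contL2 hf) (Filter.EventuallyEq.refl _ _)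

theorem inner_contL2_contL2 {L : ℝ} {f g : ℝ → ℝ} (hf : Continuous f) (hg : Continuous g) :
    inner ℝ (contL2 L hf) (contL2 L hg) = pairing L f g := by
  rw [inner_eq_pairing]
  exact pairing_congr (coeFn_contL2 hf) (coeFn_contL2 hg)

theorem integrable_mul_continuous {L : ℝ} {f g : ℝ → ℝ} (hf : MemLp f 2 (intervalMeasure L))
    (hg : Continuous g) : Integrable (fun x => f x * g x) (intervalMeasure L) :=
  hf.integrable_mul (memLp_of_continuous hg)

/-- Induction by sin((i+1)s) cos s = ½(sin((i+2)s) + sin(is)). The index j = 0 is included because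
the term i = 0 occurs. -/
theorem integral_mul_sin_mul_cos_pow {L : ℝ} {f : ℝ → ℝ} (hf : MemLp f 2 (intervalMeasure L))
    (h : ∀ j : ℕ, 0 < j → ∫ x in Ioo 0 L, f x * Real.sin (freq L j * x) = 0) (n : ℕ) : ∀ j : ℕ,
    ∫ x in Ioo 0 L, f x * (Real.sin (freq L j * x) * Real.cos (freq L 1 * x) ^ n) = 0 := by
  induction n with
  | zero =>
    intro j
    rcases Nat.eq_zero_or_pos j with rfl | hj
    · simp [freq]
    · simpa using h j hj
  | succ n ih =>
    intro j
    rcases Nat.eq_zero_or_pos j with rfl | hj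
    · simp [freq]
    · obtain ⟨i, rfl⟩ : ∃ i, j = i + 1 := ⟨j - 1, by omega⟩
      have e : ∀ x, f x * (Real.sin (freq L (i + 1) * x) * Real.cos (freq L 1 * x) ^ (n + 1))
          = (1 / 2) * (f x * (Real.sin (freq L (i + 2) * x) * Real.cos (freq L 1 * x) ^ n))
            + (1 / 2) * (f x * (Real.sin (freq L i * x) * Real.cos (freq L 1 * x) ^ n)) := by
        intro x
        have h1 : freq L (i + 2) * x = freq L (i + 1) * x + freq L 1 * x := by
          unfold freq; push_cast; ring
        have h2 : freq L i * x = freq L (i + 1) * x - freq L 1 * x := by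
          unfold freq; push_cast; ring
        rw [h1, h2, Real.sin_add, Real.sin_sub]
        ring
      simp only [e]
      rw [integral_add, integral_const_mul, integral_const_mul, ih, ih]
      · simp
      · exact (integrable_mul_continuous hf (by fun_prop)).const_mul _
      · exact (integrable_mul_continuous hf (by fun_prop)).const_mul _

theorem integral_mul_sin_mul_polynomial {L : ℝ} {f : ℝ → ℝ} (hf : MemLp f 2 (intervalMeasure L))
    (h : ∀ j : ℕ, 0 < j → ∫ x in Ioo 0 L, f x * Real.sin (freq L j * x) = 0)
    (p : Polynomial ℝ) :
    ∫ x in Ioo 0 L, f x * (Real.sin (freq L 1 * x) * p.eval (Real.cos (freq L 1 * x))) = 0 := by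
  induction p using Polynomial.induction_on' with
  | add p q hp hq =>
    simp only [Polynomial.eval_add, mul_add]
    rw [integral_add, hp, hq, add_zero]
    · exact integrable_mul_continuous hf (by fun_prop)
    · exact integrable_mul_continuous hf (by fun_prop)
  | monomial n a =>
    have e : ∀ x, f x * (Real.sin (freq L 1 * x) *
        (Polynomial.monomial n a).eval (Real.cos (freq L 1 * x)))
        = a * (f x * (Real.sin (freq L 1 * x) * Real.cos (freq L 1 * x) ^ n)) := by
      intro x; rw [Polynomial.eval_monomial]; ring
    simp only [e]
    rw [integral_const_mul, integral_mul_sin_mul_cos_pow hf h, mul_zero]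

/-- The substitution s = cos(πx/L) is injective on (0, L), so a continuous φ is q(cos(πx/L)) with q
continuous on [-1, 1]. Weierstrass approximation of q reduces the claim to polynomials in the
cosine. -/
theorem integral_mul_sin_mul_continuous {L : ℝ} (hL : 0 < L) {f : ℝ → ℝ}
    (hf : MemLp f 2 (intervalMeasure L))
    (h : ∀ j : ℕ, 0 < j → ∫ x in Ioo 0 L, f x * Real.sin (freq L j * x) = 0)
    {φ : ℝ → ℝ} (hφ : Continuous φ) :
    ∫ x in Ioo 0 L, f x * Real.sin (freq L 1 * x) * φ x = 0 := by
  set q : ℝ → ℝ := fun s => φ (Real.arccos s / freq L 1) with hq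
  have hqc : ContinuousOn q (Icc (-1) 1) :=
    (hφ.comp (Real.continuous_arccos.div_const _)).continuousOn
  have hw : 0 < freq L 1 := freq_pos hL one_pos
  have hqx : ∀ x ∈ Ioo 0 L, q (Real.cos (freq L 1 * x)) = φ x := by
    intro x hx
    have h1 : freq L 1 * x ≤ Real.pi := by
      calc freq L 1 * x ≤ freq L 1 * L := by gcongr; exact hx.2.le
        _ = Real.pi := by rw [freq_mul_self hL]; simp
    simp only [hq]
    rw [Real.arccos_cos (by have := hx.1; positivity) h1, mul_div_cancel_left₀ _ hw.ne']
  set I := ∫ x in Ioo 0 L, |f x * Real.sin (freq L 1 * x)| with hI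
  have hint : Integrable (fun x => f x * Real.sin (freq L 1 * x)) (intervalMeasure L) :=
    integrable_mul_continuous hf (by fun_prop)
  have hI0 : 0 ≤ I := integral_nonneg fun x => abs_nonneg _
  have key : ∀ ε > 0, |∫ x in Ioo 0 L, f x * Real.sin (freq L 1 * x) * φ x| ≤ ε * I := by
    intro ε hε
    obtain ⟨p, hp⟩ := exists_polynomial_near_of_continuousOn (-1) 1 q hqc ε hε
    have h0 := integral_mul_sin_mul_polynomial hf h p
    have h1 : ∫ x in Ioo 0 L, f x * Real.sin (freq L 1 * x) * φ x
        = (∫ x in Ioo 0 L, f x * Real.sin (freq L 1 * x) * φ x) - ∫ x in Ioo 0 L,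
          f x * (Real.sin (freq L 1 * x) * p.eval (Real.cos (freq L 1 * x))) := by
      rw [h0, sub_zero]
    rw [h1, ← integral_sub]
    · rw [hI, ← integral_const_mul, ← Real.norm_eq_abs]
      refine norm_integral_le_of_norm_le (hint.abs.const_mul ε) ?_
      filter_upwards [ae_restrict_mem measurableSet_Ioo] with x hx
      rw [← mul_assoc, ← mul_sub, norm_mul, mul_comm, Real.norm_eq_abs, Real.norm_eq_abs,
        ← hqx x hx, abs_sub_comm]
      gcongr
      exact (hp _ ⟨Real.neg_one_le_cos _, Real.cos_le_one _⟩).le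
    · have := integrable_mul_continuous hf
        (g := fun x => Real.sin (freq L 1 * x) * φ x) (by fun_prop)
      simpa only [mul_assoc] using this
    · exact integrable_mul_continuous hf (by fun_prop)
  by_contra hne
  have hpos : 0 < |∫ x in Ioo 0 L, f x * Real.sin (freq L 1 * x) * φ x| := abs_pos.2 hne
  set J := |∫ x in Ioo 0 L, f x * Real.sin (freq L 1 * x) * φ x|
  -- With this ε the estimate reads J ≤ J/2, which is impossible for J > 0; I + 1 replaces I to
  -- allow I = 0.
  have := key (J / (2 * (I + 1))) (by positivity)
  have h2 : J / (2 * (I + 1)) * I ≤ J / 2 := by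
    rw [div_mul_eq_mul_div, div_le_div_iff₀ (by positivity) two_pos]
    nlinarith
  linarith

/-- The product f(x) sin(πx/L) annihilates all test functions, and sin(πx/L) has no zero in (0, L).
-/
theorem eq_zero_of_pairing_sineMode {L : ℝ} (hL : 0 < L) (f : L2 L)
    (h : ∀ j : ℕ, pairing L (sineMode L (j + 1)) f = 0) : f = 0 := by
  have hf := Lp.memLp f
  have h' : ∀ j : ℕ, 0 < j → ∫ x in Ioo 0 L, f x * Real.sin (freq L j * x) = 0 := by
    intro j hj
    obtain ⟨i, rfl⟩ : ∃ i, j = i + 1 := ⟨j - 1, by omega⟩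
    have h1 := h i
    have e : ∀ x, sineMode L (i + 1) x * f x
        = √(2 / L) * (f x * Real.sin (freq L (i + 1) * x)) := by
      intro x; rw [sineMode_eq_sineDeriv]; simp [sineDeriv]; ring
    simp only [pairing, e] at h1
    rw [integral_const_mul] at h1
    exact (mul_eq_zero.1 h1).resolve_left (Real.sqrt_pos.2 (by positivity)).ne'
  have hint : Integrable (fun x => f x * Real.sin (freq L 1 * x)) (intervalMeasure L) :=
    integrable_mul_continuous hf (by fun_prop)
  have h0 : ∀ᵐ x ∂volume.restrict (Ioo 0 L), f x * Real.sin (freq L 1 * x) = 0 := by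
    refine ae_eq_zero_of_forall_test isOpen_Ioo ?_ fun φ hφ _ _ =>
      integral_mul_sin_mul_continuous hL hf h' hφ.continuous
    exact IntegrableOn.locallyIntegrableOn hint
  rw [Lp.eq_zero_iff_ae_eq_zero]
  filter_upwards [h0, ae_restrict_mem measurableSet_Ioo] with x hx hm
  refine (mul_eq_zero.1 hx).resolve_right (ne_of_gt (Real.sin_pos_of_pos_of_lt_pi ?_ ?_))
  · exact mul_pos (freq_pos hL one_pos) hm.1
  · calc freq L 1 * x < freq L 1 * L := by
          have := freq_pos hL one_pos
          gcongr; exact hm.2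
      _ = Real.pi := by rw [freq_mul_self hL]; simp

/-! ### Sobolev spaces -/

theorem isWeakDeriv_iff {L : ℝ} {f g : L2 L} : IsWeakDeriv L f g ↔
    ∀ φ : ℝ → ℝ, ContDiff ℝ ∞ φ → HasCompactSupport φ → tsupport φ ⊆ Ioo 0 L →
      pairing L (deriv φ) f = - pairing L φ g := by
  simp only [IsWeakDeriv, pairing, mul_comm]

theorem continuous_pairing (L : ℝ) {φ : ℝ → ℝ} (hφ : Continuous φ) :
    Continuous fun f : L2 L => pairing L φ f := by
  simp only [← inner_contL2 hφ]
  fun_prop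

/-- Each test function imposes an equation between continuous functionals. Closedness gives
completeness, which is needed to sum sine series inside H^m. -/
theorem isClosed_sobolevSubmodule (L : ℝ) (m : ℕ) :
    IsClosed (sobolevSubmodule L m : Set (PiLp 2 (fun _ : Fin (m + 1) => L2 L))) := by
  have : (sobolevSubmodule L m : Set (PiLp 2 (fun _ : Fin (m + 1) => L2 L)))
      = {F | ∀ i : Fin m, ∀ φ : ℝ → ℝ, ContDiff ℝ ∞ φ → HasCompactSupport φ →
          tsupport φ ⊆ Ioo 0 L →
          pairing L (deriv φ) (F i.castSucc) = - pairing L φ (F i.succ)} := by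
    ext F
    simp only [← isWeakDeriv_iff]
    rfl
  rw [this]
  simp only [ofPred_forall]
  refine isClosed_iInter fun i => isClosed_iInter fun φ => isClosed_iInter fun hφ =>
    isClosed_iInter fun _ => isClosed_iInter fun _ => ?_
  refine isClosed_eq ?_ ?_
  · exact (continuous_pairing L (hφ.continuous_deriv (by simp))).comp
      (PiLp.continuous_apply 2 _ i.castSucc)
  · exact ((continuous_pairing L hφ.continuous).comp (PiLp.continuous_apply 2 _ i.succ)).neg

instance (L : ℝ) (m : ℕ) : CompleteSpace (Sobolev L m) :=
  (isClosed_sobolevSubmodule L m).completeSpace_coe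

/-- The inclusion `H^m(0, L) → L²(0, L)` as a continuous linear map. -/
def sobolevToL2 (L : ℝ) (m : ℕ) : Sobolev L m →L[ℝ] L2 L :=
  (PiLp.proj 2 (fun _ : Fin (m + 1) => L2 L) 0).comp (sobolevSubmodule L m).subtypeL

theorem sobolevToL2_apply {L : ℝ} {m : ℕ} (v : Sobolev L m) : sobolevToL2 L m v = v.toL2 := rfl

theorem norm_toL2_le {L : ℝ} {m : ℕ} (v : Sobolev L m) : ‖v.toL2‖ ≤ ‖v‖ :=
  PiLp.norm_apply_le v.1 0

/-! ### Smooth functions and modes as elements of H^m. -/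

theorem isWeakDeriv_contL2 {L : ℝ} (hL : 0 < L) {F G : ℝ → ℝ} (hF : Continuous F)
    (hG : Continuous G) (h : ∀ x, HasDerivAt F (G x) x) :
    IsWeakDeriv L (contL2 L hF) (contL2 L hG) := by
  rw [isWeakDeriv_iff]
  intro φ hφ _ hs
  have hd : Continuous (deriv φ) := hφ.continuous_deriv (by simp)
  rw [pairing_congr (Filter.EventuallyEq.refl _ _) (coeFn_contL2 hF),
    pairing_congr (Filter.EventuallyEq.refl _ _) (coeFn_contL2 hG), pairing_comm]
  simp only [pairing]
  rw [setIntegral_Ioo_eq hL, setIntegral_Ioo_eq hL,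
    intervalIntegral.integral_mul_deriv_eq_deriv_mul (u' := G) (v := φ) (fun x _ => h x)
      (fun x _ => (hφ.differentiable (by simp) x).hasDerivAt)
      (hG.intervalIntegrable _ _) (hd.intervalIntegrable _ _)]
  have h0 : φ 0 = 0 := image_eq_zero_of_notMem_tsupport fun h => lt_irrefl _ (hs h).1
  have h1 : φ L = 0 := image_eq_zero_of_notMem_tsupport fun h => lt_irrefl _ (hs h).2
  simp [h0, h1, mul_comm]

theorem continuous_of_hasDerivAt {F G : ℝ → ℝ} (h : ∀ x, HasDerivAt F (G x) x) : Continuous F :=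
  continuous_iff_continuousAt.2 fun x => (h x).continuousAt

/-- The element of `H^m(0, L)` given by a smooth function with its derivatives. -/
def smoothSobolev {L : ℝ} (hL : 0 < L) (m : ℕ) (F : ℕ → ℝ → ℝ)
    (h : ∀ n x, HasDerivAt (F n) (F (n + 1) x) x) : Sobolev L m :=
  ⟨WithLp.toLp 2 fun i : Fin (m + 1) => contL2 L (continuous_of_hasDerivAt (h i)),
    fun i => isWeakDeriv_contL2 hL (continuous_of_hasDerivAt (h i))
      (continuous_of_hasDerivAt (h (i + 1))) (h i)⟩

theorem toL2_smoothSobolev {L : ℝ} (hL : 0 < L) (m : ℕ) {F : ℕ → ℝ → ℝ}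
    (h : ∀ n x, HasDerivAt (F n) (F (n + 1) x) x) :
    (smoothSobolev hL m F h).toL2 = contL2 L (continuous_of_hasDerivAt (h 0)) := rfl

theorem inner_smoothSobolev {L : ℝ} (hL : 0 < L) (m : ℕ) {F G : ℕ → ℝ → ℝ}
    (hF : ∀ n x, HasDerivAt (F n) (F (n + 1) x) x) (hG : ∀ n x, HasDerivAt (G n) (G (n + 1) x) x) :
    inner ℝ (smoothSobolev hL m F hF) (smoothSobolev hL m G hG)
      = ∑ i : Fin (m + 1), pairing L (F i) (G i) := by
  rw [Submodule.coe_inner, PiLp.inner_apply]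
  exact Finset.sum_congr rfl fun i _ => inner_contL2_contL2 (continuous_of_hasDerivAt (hF i))
    (continuous_of_hasDerivAt (hG i))

/-- The mode `e_{j+1}` as an element of `H^m(0, L)`. -/
def sineSobolev {L : ℝ} (hL : 0 < L) (m : ℕ) (j : ℕ) : Sobolev L m :=
  smoothSobolev hL m (sineDeriv L (freq L (j + 1))) (hasDerivAt_sineDeriv L _)

/-- The squared norm of `e_{j+1}` in `H^m(0, L)`. -/
def sineWeight (L : ℝ) (m : ℕ) (j : ℕ) : ℝ :=
  ∑ i : Fin (m + 1), eigenvalue L (j + 1) ^ (i : ℕ)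

theorem inner_sineSobolev {L : ℝ} (hL : 0 < L) (m i j : ℕ) :
    inner ℝ (sineSobolev hL m i) (sineSobolev hL m j) = if i = j then sineWeight L m i else 0 := by
  simp only [sineSobolev, inner_smoothSobolev, pairing]
  simp only [integral_sineDeriv_mul hL _ (Nat.succ_pos i), Nat.succ_inj]
  split_ifs <;> simp [sineWeight]

theorem one_le_sineWeight (L : ℝ) (m j : ℕ) : 1 ≤ sineWeight L m j := by
  unfold sineWeight
  rw [Fin.sum_univ_succ]
  have : 0 ≤ ∑ i : Fin m, eigenvalue L (j + 1) ^ ((i.succ : Fin (m + 1)) : ℕ) :=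
    Finset.sum_nonneg fun i _ => by unfold eigenvalue; positivity
  simpa using this

/-- One more derivative costs at most the factor 1 + λ, which the heat factor exp(-2νλt) can absorb.
-/
theorem sineWeight_succ_le (L : ℝ) (m j : ℕ) :
    sineWeight L (m + 1) j ≤ (1 + eigenvalue L (j + 1)) * sineWeight L m j := by
  have h0 : 0 ≤ eigenvalue L (j + 1) := by unfold eigenvalue; positivity
  have h1 : sineWeight L (m + 1) j = 1 + eigenvalue L (j + 1) * sineWeight L m j := by
    unfold sineWeight
    rw [Fin.sum_univ_succ, Finset.mul_sum]
    simp [pow_succ, mul_comm]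
  have := one_le_sineWeight L m j
  rw [h1]; nlinarith

/-- The mode `e_{j+1}` as an element of `L²(0, L)`. -/
def sineL2 (L : ℝ) (j : ℕ) : L2 L := contL2 L (continuous_sineMode L (j + 1))

theorem toL2_sineSobolev {L : ℝ} (hL : 0 < L) (m j : ℕ) :
    (sineSobolev hL m j).toL2 = sineL2 L j := by
  rw [sineSobolev, toL2_smoothSobolev]
  simp only [sineL2, sineMode_eq_sineDeriv]

theorem inner_sineL2 {L : ℝ} (j : ℕ) (f : L2 L) :
    inner ℝ (sineL2 L j) f = pairing L (sineMode L (j + 1)) f := inner_contL2 _ _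

theorem orthonormal_sineL2 {L : ℝ} (hL : 0 < L) : Orthonormal ℝ (sineL2 L) := by
  rw [orthonormal_iff_ite]
  intro i j
  rw [sineL2, sineL2, inner_contL2_contL2, pairing_sineMode hL (by omega)]
  simp

theorem ext_sineL2 {L : ℝ} (hL : 0 < L) {f g : L2 L}
    (h : ∀ j, inner ℝ (sineL2 L j) f = inner ℝ (sineL2 L j) g) : f = g := by
  rw [← sub_eq_zero]
  refine eq_zero_of_pairing_sineMode hL _ fun j => ?_
  rw [← inner_sineL2, inner_sub_right, h, sub_self]

theorem hasDerivAt_corr (L β : ℝ) (j n : ℕ) (x : ℝ) :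
    HasDerivAt (fun x => shiftMode L β j n x - sineDeriv L (freq L j) n x)
      (shiftMode L β j (n + 1) x - sineDeriv L (freq L j) (n + 1) x) x :=
  ((hasDerivAt_sineDeriv L _ n x).const_mul _).sub (hasDerivAt_sineDeriv L _ n x)

/-- The difference of the transformed mode and `e_{j+1}` as an element of `H^m(0, L)`. -/
def corrSobolev {L : ℝ} (hL : 0 < L) (β : ℝ) (m j : ℕ) : Sobolev L m :=
  smoothSobolev hL m
    (fun n x => shiftMode L β (j + 1) n x - sineDeriv L (freq L (j + 1)) n x)
    (hasDerivAt_corr L β (j + 1))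

theorem continuous_corr (L β : ℝ) (j : ℕ) :
    Continuous fun x => shiftMode L β j 0 x - sineMode L j x :=
  (continuous_shiftMode _ _ _ _).sub (continuous_sineMode _ _)

/-- The difference of the transformed mode and `e_{j+1}` as an element of `L²(0, L)`. -/
def corrL2 (L β : ℝ) (j : ℕ) : L2 L := contL2 L (continuous_corr L β (j + 1))

theorem toL2_corrSobolev {L : ℝ} (hL : 0 < L) (β : ℝ) (m j : ℕ) :
    (corrSobolev hL β m j).toL2 = corrL2 L β j := by
  rw [corrSobolev, toL2_smoothSobolev]
  simp only [corrL2, sineMode_eq_sineDeriv]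

theorem inner_sineL2_corrL2 {L : ℝ} (hL : 0 < L) (β : ℝ) {N : ℕ} (i j : Fin N) :
    inner ℝ (sineL2 L i) (corrL2 L β j) = modeMatrix L β N i j - if i = j then 1 else 0 := by
  rw [sineL2, corrL2, inner_contL2_contL2]
  have := pairing_sub (L := L) (memLp_sineMode L (i + 1)) (memLp_shiftMode L β (j + 1) 0)
    (memLp_sineMode L (j + 1))
  rw [pairing_sineMode hL (by omega)] at this
  refine Eq.trans this ?_
  simp [modeMatrix, Fin.ext_iff]

/-! ### Orthogonal series -/

/-- Pythagoras on finite sums reduces the Cauchy criterion to that of the scalar series. The vectors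
are not normalised, so that one coefficient sequence serves in all H^m at once. -/
theorem summable_smul_of_orthogonal {H : Type*} [NormedAddCommGroup H] [InnerProductSpace ℝ H]
    [CompleteSpace H] {s : ℕ → H} {w : ℕ → ℝ}
    (hs : ∀ i j, inner ℝ (s i) (s j) = if i = j then w i else 0) (a : ℕ → ℝ)
    (ha : Summable fun j => a j ^ 2 * w j) :
    Summable (fun j => a j • s j) ∧ ‖∑' j, a j • s j‖ ^ 2 = ∑' j, a j ^ 2 * w j := by
  have hfin : ∀ t : Finset ℕ, ‖∑ j ∈ t, a j • s j‖ ^ 2 = ∑ j ∈ t, a j ^ 2 * w j := by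
    intro t
    rw [← real_inner_self_eq_norm_sq, sum_inner]
    refine Finset.sum_congr rfl fun i hi => ?_
    rw [inner_sum]
    simp only [inner_smul_left, inner_smul_right, hs]
    simp [hi]
    ring
  have hw : ∀ j, ‖s j‖ ^ 2 = w j := fun j => by rw [← real_inner_self_eq_norm_sq, hs]; simp
  have h1 : Summable (fun j => a j • s j) := by
    rw [summable_iff_vanishing_norm]
    intro ε hε
    obtain ⟨t, ht⟩ := summable_iff_vanishing_norm.1 ha (ε ^ 2) (by positivity)
    refine ⟨t, fun t' h' => ?_⟩
    have h2 := ht t' h'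
    rw [← hfin, Real.norm_eq_abs, abs_of_nonneg (by positivity)] at h2
    exact lt_of_pow_lt_pow_left₀ 2 hε.le h2
  refine ⟨h1, ?_⟩
  have h2 : Filter.Tendsto (fun t : Finset ℕ => ‖∑ j ∈ t, a j • s j‖ ^ 2) Filter.atTop
      (nhds (‖∑' j, a j • s j‖ ^ 2)) := (h1.hasSum.norm).pow 2
  simp only [hfin] at h2
  exact (HasSum.tsum_eq (L := SummationFilter.unconditional ℕ) (by simpa [HasSum] using h2)).symm

/-! ### Functions with vanishing boundary values -/

theorem exists_bound_deriv_smoothTransition :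
    ∃ C : ℝ, 0 ≤ C ∧ (∀ y, |deriv Real.smoothTransition y| ≤ C) ∧
      ∀ y, y ∉ Icc (0 : ℝ) 1 → deriv Real.smoothTransition y = 0 := by
  have h0 : ∀ y, y ∉ Icc (0 : ℝ) 1 → deriv Real.smoothTransition y = 0 := by
    intro y hy
    rcases lt_or_ge y 0 with h | h
    · have : Real.smoothTransition =ᶠ[nhds y] fun _ => 0 := by
        filter_upwards [Iio_mem_nhds h] with z hz
        exact Real.smoothTransition.zero_of_nonpos (le_of_lt hz)
      rw [this.deriv_eq, deriv_const]
    · have h1 : 1 < y := by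
        by_contra h2
        exact hy ⟨h, not_lt.1 h2⟩
      have : Real.smoothTransition =ᶠ[nhds y] fun _ => 1 := by
        filter_upwards [Ioi_mem_nhds h1] with z hz
        exact Real.smoothTransition.one_of_one_le (le_of_lt hz)
      rw [this.deriv_eq, deriv_const]
  have hc : Continuous (deriv Real.smoothTransition) :=
    (Real.smoothTransition.contDiff (n := 1)).continuous_deriv le_rfl
  obtain ⟨C, hC⟩ := (isCompact_Icc (a := (0 : ℝ)) (b := 1)).exists_bound_of_continuousOn
    hc.continuousOn
  have hC0 : 0 ≤ C := (norm_nonneg _).trans (hC 0 (by simp))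
  refine ⟨C, hC0, fun y => ?_, h0⟩
  by_cases hy : y ∈ Icc (0 : ℝ) 1
  · exact hC y hy
  · rw [h0 y hy, abs_zero]; exact hC0

/-- A smooth cutoff function, equal to `1` on `[2/r, L - 2/r]` and supported in
`[1/r, L - 1/r]`. -/
def cutoff (L r x : ℝ) : ℝ :=
  Real.smoothTransition (r * x - 1) * Real.smoothTransition (r * (L - x) - 1)

theorem contDiff_cutoff (L r : ℝ) : ContDiff ℝ ∞ (cutoff L r) := by
  unfold cutoff
  exact (Real.smoothTransition.contDiff.comp (by fun_prop)).mul
    (Real.smoothTransition.contDiff.comp (by fun_prop))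

theorem tsupport_cutoff_subset {L r : ℝ} (hr : 0 < r) :
    tsupport (cutoff L r) ⊆ Icc (1 / r) (L - 1 / r) := by
  refine closure_minimal (fun x hx => ?_) isClosed_Icc
  by_contra hmem
  refine hx ?_
  unfold cutoff
  rcases lt_or_ge x (1 / r) with h | h
  · rw [Real.smoothTransition.zero_of_nonpos, zero_mul]
    rw [lt_div_iff₀ hr] at h; linarith
  · rw [Real.smoothTransition.zero_of_nonpos (x := r * (L - x) - 1), mul_zero]
    have h2 : L - 1 / r < x := by
      by_contra h2
      exact hmem ⟨h, not_lt.1 h2⟩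
    have h3 : L - x < 1 / r := by linarith
    rw [lt_div_iff₀ hr] at h3; linarith

theorem abs_cutoff_le_one (L r x : ℝ) : |cutoff L r x| ≤ 1 := by
  unfold cutoff
  rw [abs_mul, abs_of_nonneg (Real.smoothTransition.nonneg _),
    abs_of_nonneg (Real.smoothTransition.nonneg _)]
  exact mul_le_one₀ (Real.smoothTransition.le_one _) (Real.smoothTransition.nonneg _)
    (Real.smoothTransition.le_one _)

theorem tendsto_cutoff {L x : ℝ} (hx : x ∈ Ioo 0 L) :
    Filter.Tendsto (fun n : ℕ => cutoff L n x) Filter.atTop (nhds 1) := by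
  refine tendsto_const_nhds.congr' ?_
  filter_upwards [Filter.eventually_ge_atTop ⌈2 / x⌉₊, Filter.eventually_ge_atTop ⌈2 / (L - x)⌉₊]
    with n h1 h2
  have h3 : 2 / x ≤ n := Nat.ceil_le.1 h1
  have h4 : 2 / (L - x) ≤ n := Nat.ceil_le.1 h2
  rw [div_le_iff₀ hx.1] at h3
  rw [div_le_iff₀ (sub_pos.2 hx.2)] at h4
  unfold cutoff
  rw [Real.smoothTransition.one_of_one_le (by linarith),
    Real.smoothTransition.one_of_one_le (by linarith), one_mul]

/-- The derivative is of size r, but it lives on two end strips of width 2/r, so its integral over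
(0, L) stays bounded as r grows. -/
theorem abs_deriv_cutoff_le {C : ℝ} (hC0 : 0 ≤ C)
    (hC : ∀ y, |deriv Real.smoothTransition y| ≤ C)
    (hz : ∀ y, y ∉ Icc (0 : ℝ) 1 → deriv Real.smoothTransition y = 0) {L r x : ℝ} (hr : 0 < r) :
    |deriv (cutoff L r) x| ≤ (Iic (2 / r)).indicator (fun _ => C * r) x
      + (Ici (L - 2 / r)).indicator (fun _ => C * r) x := by
  have hS : ∀ y, HasDerivAt Real.smoothTransition (deriv Real.smoothTransition y) y := fun y =>
    (Real.smoothTransition.contDiff (n := 1)).differentiable (by simp) y |>.hasDerivAt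
  have h1 : HasDerivAt (fun x => r * x - 1) r x := by
    simpa using ((hasDerivAt_id x).const_mul r).sub_const 1
  have h2 : HasDerivAt (fun x => r * (L - x) - 1) (-r) x := by
    simpa using (((hasDerivAt_id x).const_sub L).const_mul r).sub_const 1
  have h3 := ((hS _).comp x h1).mul ((hS _).comp x h2)
  have h4 : deriv (cutoff L r) x
      = deriv Real.smoothTransition (r * x - 1) * r * Real.smoothTransition (r * (L - x) - 1) +
        Real.smoothTransition (r * x - 1) *
          (deriv Real.smoothTransition (r * (L - x) - 1) * -r) := h3.deriv
  rw [h4]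
  refine (abs_add_le _ _).trans (add_le_add ?_ ?_)
  · rw [abs_mul, abs_mul, abs_of_pos hr, abs_of_nonneg (Real.smoothTransition.nonneg _)]
    by_cases hx : x ∈ Iic (2 / r)
    · rw [indicator_of_mem hx]
      exact (mul_le_of_le_one_right (by positivity) (Real.smoothTransition.le_one _)).trans
        (mul_le_mul_of_nonneg_right (hC _) hr.le)
    · rw [indicator_of_notMem hx, hz, abs_zero, zero_mul, zero_mul]
      intro h
      apply hx
      rw [mem_Iic, le_div_iff₀ hr]
      linarith [h.2]
  · rw [abs_mul, abs_mul, abs_neg, abs_of_pos hr, abs_of_nonneg (Real.smoothTransition.nonneg _)]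
    by_cases hx : x ∈ Ici (L - 2 / r)
    · rw [indicator_of_mem hx]
      exact (mul_le_of_le_one_left (by positivity) (Real.smoothTransition.le_one _)).trans
        (mul_le_mul_of_nonneg_right (hC _) hr.le)
    · rw [indicator_of_notMem hx, hz, abs_zero, zero_mul, mul_zero]
      intro h
      apply hx
      have : L - x ≤ 2 / r := by
        rw [le_div_iff₀ hr]
        linarith [h.2]
      rw [mem_Ici]; linarith

/-- On the end strips the cutoff derivative has bounded mass, while H is uniformly small there
because it is continuous and vanishes at the end points. -/
theorem tendsto_integral_mul_deriv_cutoff {L : ℝ} (hL : 0 < L) {H : ℝ → ℝ}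
    (hH : ContinuousOn H (Icc 0 L)) (h0 : H 0 = 0) (h1 : H L = 0) :
    Filter.Tendsto (fun n : ℕ => ∫ x in Ioo 0 L, H x * deriv (cutoff L n) x) Filter.atTop
      (nhds 0) := by
  obtain ⟨C, hC0, hC, hz⟩ := exists_bound_deriv_smoothTransition
  rw [Metric.tendsto_atTop]
  intro ε hε
  -- Two strips of width 2/n with height ηCn contribute at most 4Cη; the summand 1 makes the
  -- inequality strict and covers C = 0.
  set η := ε / (4 * C + 1) with hη
  have hη0 : 0 < η := by positivity
  have hc0 := Metric.continuousWithinAt_iff.1 (hH 0 ⟨le_rfl, hL.le⟩) η hη0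
  have hc1 := Metric.continuousWithinAt_iff.1 (hH L ⟨hL.le, le_rfl⟩) η hη0
  obtain ⟨δ₀, hδ₀, h0'⟩ := hc0
  obtain ⟨δ₁, hδ₁, h1'⟩ := hc1
  obtain ⟨n₀, hn₀⟩ := exists_nat_gt (2 / min δ₀ δ₁)
  have hδ : 0 < min δ₀ δ₁ := lt_min hδ₀ hδ₁
  refine ⟨n₀ + 1, fun n hn => ?_⟩
  have hnr : (n₀ : ℝ) < n := by exact_mod_cast hn
  have hn0 : (0 : ℝ) < n := lt_of_le_of_lt (Nat.cast_nonneg _) hnr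
  have hsmall : 2 / (n : ℝ) < min δ₀ δ₁ := by
    rw [div_lt_comm₀ hn0 hδ]; linarith
  have hpt : ∀ x ∈ Ioo 0 L, ‖H x * deriv (cutoff L n) x‖ ≤
      (Ioc 0 (2 / (n : ℝ))).indicator (fun _ => η * (C * n)) x
        + (Ico (L - 2 / n) L).indicator (fun _ => η * (C * n)) x := by
    intro x hx
    have hd := abs_deriv_cutoff_le hC0 hC hz (L := L) (x := x) hn0
    have e0 : (Iic (2 / (n : ℝ))).indicator (fun _ => C * n) x
        = (Ioc 0 (2 / (n : ℝ))).indicator (fun _ => C * n) x := by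
      simp only [indicator, mem_Iic, mem_Ioc, hx.1, true_and]
    have e1 : (Ici (L - 2 / (n : ℝ))).indicator (fun _ => C * n) x
        = (Ico (L - 2 / (n : ℝ)) L).indicator (fun _ => C * n) x := by
      simp only [indicator, mem_Ici, mem_Ico, hx.2, and_true]
    rw [e0, e1] at hd
    have em : ∀ s : Set ℝ, s.indicator (fun _ => η * (C * n)) x
        = η * s.indicator (fun _ => C * n) x := by
      intro s; simp only [indicator]; split_ifs <;> simp
    rw [em, em, ← mul_add, norm_mul, Real.norm_eq_abs, Real.norm_eq_abs]
    by_cases hnear : x ∈ Ioc 0 (2 / (n : ℝ)) ∨ x ∈ Ico (L - 2 / (n : ℝ)) L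
    · have hHx : |H x| ≤ η := by
        rcases hnear with h | h
        · have := h0' (Ioo_subset_Icc_self hx) (by
            rw [Real.dist_eq, sub_zero, abs_of_pos hx.1]
            exact h.2.trans_lt (hsmall.trans_le (min_le_left _ _)))
          rw [h0, Real.dist_eq, sub_zero] at this
          exact this.le
        · have := h1' (Ioo_subset_Icc_self hx) (by
            rw [Real.dist_eq, abs_sub_comm, abs_of_pos (sub_pos.2 hx.2)]
            have := hsmall.trans_le (min_le_right δ₀ δ₁)
            linarith [h.1])
          rw [h1, Real.dist_eq, sub_zero] at this
          exact this.le
      gcongr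
    · push Not at hnear
      rw [indicator_of_notMem hnear.1, indicator_of_notMem hnear.2, add_zero] at hd ⊢
      rw [le_antisymm hd (abs_nonneg _)]
      simp
  have hb : ∀ s : Set ℝ, MeasurableSet s → Integrable (s.indicator fun _ => η * (C * n))
      (volume.restrict (Ioo 0 L)) := fun s hs => (integrable_const _).indicator hs
  have hi : ∀ s : Set ℝ, MeasurableSet s → volume s ≤ ENNReal.ofReal (2 / n) →
      ∫ x in Ioo 0 L, s.indicator (fun _ => η * (C * n)) x ≤ η * (2 * C) := by
    intro s hs hv
    rw [integral_indicator hs, Measure.restrict_restrict hs, setIntegral_const, smul_eq_mul]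
    have : volume.real (s ∩ Ioo 0 L) ≤ 2 / n :=
      ENNReal.toReal_le_of_le_ofReal (by positivity) ((measure_mono inter_subset_left).trans hv)
    calc _ ≤ 2 / (n : ℝ) * (η * (C * n)) := by gcongr
      _ = _ := by field_simp
  rw [dist_zero_right]
  calc _ ≤ _ := norm_integral_le_of_norm_le ((hb _ measurableSet_Ioc).add (hb _ measurableSet_Ico))
        ((ae_restrict_mem measurableSet_Ioo).mono hpt)
    _ ≤ η * (2 * C) + η * (2 * C) := by
        rw [integral_add' (hb _ measurableSet_Ioc) (hb _ measurableSet_Ico)]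
        refine add_le_add (hi _ measurableSet_Ioc ?_) (hi _ measurableSet_Ico ?_)
        · rw [Real.volume_Ioc, sub_zero]
        · rw [Real.volume_Ico, sub_sub_cancel]
    _ = η * (4 * C) := by ring
    _ < η * (4 * C + 1) := by gcongr; linarith
    _ = ε := by rw [hη]; field_simp

theorem tendsto_integral_mul_cutoff {L : ℝ} {h : ℝ → ℝ}
    (hh : Integrable h (intervalMeasure L)) :
    Filter.Tendsto (fun n : ℕ => ∫ x in Ioo 0 L, h x * cutoff L n x) Filter.atTop
      (nhds (∫ x in Ioo 0 L, h x)) := by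
  refine tendsto_integral_of_dominated_convergence (fun x => |h x|) ?_ hh.abs ?_ ?_
  · exact fun n => hh.aestronglyMeasurable.mul
      (contDiff_cutoff L n).continuous.aestronglyMeasurable
  · refine fun n => .of_forall fun x => ?_
    rw [norm_mul, Real.norm_eq_abs, Real.norm_eq_abs]
    exact mul_le_of_le_one_right (abs_nonneg _) (abs_cutoff_le_one _ _ _)
  · filter_upwards [ae_restrict_mem measurableSet_Ioo] with x hx
    simpa using (tendsto_cutoff hx).const_mul (h x)

/-- Integration by parts against a smooth function which need not vanish at the end points. -/
theorem IsWeakDeriv.pairing_deriv {L : ℝ} (hL : 0 < L) {f g : L2 L} (hfg : IsWeakDeriv L f g)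
    (hb : HasBoundaryValues L f 0 0) {φ : ℝ → ℝ} (hφ : ContDiff ℝ ∞ φ) :
    pairing L (deriv φ) f = - pairing L φ g := by
  obtain ⟨F, hF, hfF, hF0, hF1⟩ := hb
  have hd : Continuous (deriv φ) := hφ.continuous_deriv (by simp)
  have l1 := tendsto_integral_mul_cutoff (integrable_mul_continuous (Lp.memLp f) hd)
  have l2 := tendsto_integral_mul_cutoff (integrable_mul_continuous (Lp.memLp g) hφ.continuous)
  have l3 := tendsto_integral_mul_deriv_cutoff hL (H := fun x => F x * φ x)
    (hF.mul hφ.continuous.continuousOn) (by simp [hF0]) (by simp [hF1])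
  -- The admissible test function is φ times the cutoff; the extra term carrying the derivative of
  -- the cutoff tends to zero by `l3`.
  have key : ∀ᶠ n : ℕ in Filter.atTop,
      -(∫ x in Ioo 0 L, g x * φ x * cutoff L n x) - ∫ x in Ioo 0 L, F x * φ x * deriv (cutoff L n) x
        = ∫ x in Ioo 0 L, f x * deriv φ x * cutoff L n x := by
    filter_upwards [Filter.eventually_ge_atTop 1] with n hn
    have hn0 : (0 : ℝ) < n := by exact_mod_cast hn
    have hχ := contDiff_cutoff L n
    have hts : tsupport (fun x => φ x * cutoff L n x) ⊆ Icc (1 / (n : ℝ)) (L - 1 / n) :=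
      (tsupport_mul_subset_right).trans (tsupport_cutoff_subset hn0)
    have hder : ∀ x, deriv (fun x => φ x * cutoff L n x) x
        = deriv φ x * cutoff L n x + φ x * deriv (cutoff L n) x := fun x =>
      deriv_fun_mul (hφ.differentiable (by simp) x) (hχ.differentiable (by simp) x)
    have h := hfg (fun x => φ x * cutoff L n x) (hφ.mul hχ)
      (HasCompactSupport.of_support_subset_isCompact isCompact_Icc (subset_closure.trans hts))
      (hts.trans fun x hx => ⟨lt_of_lt_of_le (by positivity) hx.1,
        lt_of_le_of_lt hx.2 (by have : 0 < 1 / (n : ℝ) := by positivity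
                                linarith)⟩)
    simp only [hder] at h
    have hdχ : Continuous (deriv (cutoff L n)) := hχ.continuous_deriv (by simp)
    have hI1 : Integrable (fun x => f x * deriv φ x * cutoff L n x) (intervalMeasure L) := by
      simpa only [mul_assoc] using
        integrable_mul_continuous (Lp.memLp f) (g := fun x => deriv φ x * cutoff L n x) (hd.mul hχ.continuous)
    have hI2 : Integrable (fun x => f x * φ x * deriv (cutoff L n) x) (intervalMeasure L) := by
      simpa only [mul_assoc] using
        integrable_mul_continuous (Lp.memLp f) 
          (g := fun x => φ x * deriv (cutoff L n) x) (hφ.continuous.mul hdχ)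
    have e1 : ∫ x in Ioo 0 L, F x * φ x * deriv (cutoff L n) x
        = ∫ x in Ioo 0 L, f x * φ x * deriv (cutoff L n) x := by
      refine integral_congr_ae ?_
      filter_upwards [hfF] with x hx
      rw [hx]
    have e2 : ∫ x in Ioo 0 L, f x * (deriv φ x * cutoff L n x + φ x * deriv (cutoff L n) x)
        = (∫ x in Ioo 0 L, f x * deriv φ x * cutoff L n x)
          + ∫ x in Ioo 0 L, f x * φ x * deriv (cutoff L n) x := by
      rw [← integral_add hI1 hI2]
      exact integral_congr_ae (.of_forall fun x => by ring)
    rw [e2] at h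
    simp only [← mul_assoc] at h
    rw [e1]; linarith
  have l4 := (l2.neg.sub l3).congr' key
  have := tendsto_nhds_unique l1 l4
  rw [sub_zero] at this
  rw [pairing_comm L _ f, pairing_comm L _ g]
  exact this

/-! ### Decay of the sine coefficients. -/

theorem contDiff_sineDeriv (L θ : ℝ) (n : ℕ) : ContDiff ℝ ∞ (sineDeriv L θ n) := by
  unfold sineDeriv
  fun_prop

theorem deriv_sineDeriv (L θ : ℝ) (n : ℕ) : deriv (sineDeriv L θ n) = sineDeriv L θ (n + 1) :=
  funext fun x => (hasDerivAt_sineDeriv L θ n x).deriv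

theorem eigenvalue_pos {L : ℝ} (hL : 0 < L) (j : ℕ) : 0 < eigenvalue L (j + 1) := by
  rw [← freq_sq]
  exact pow_pos (freq_pos hL (Nat.succ_pos j)) 2

/-- Integration by parts identifies the coefficients of w' in the orthonormal cosines with √λ_j
times the sine coefficients of w; Bessel's inequality for w and for w' then gives the weight 1 +
λ_j. The cosines do not vanish at the end points, hence the condition on the boundary values of w.
-/
theorem summable_sq_mul_sineWeight_one {L : ℝ} (hL : 0 < L) (w : Sobolev L 1)
    (hb : HasBoundaryValues L w.toL2 0 0) :
    Summable fun j => inner ℝ (sineL2 L j) w.toL2 ^ 2 * sineWeight L 1 j := by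
  have hw : IsWeakDeriv L w.toL2 (w.1 1) := w.2 0
  have hc : ∀ j, Continuous (sineDeriv L (freq L (j + 1)) 1) := fun j => continuous_sineDeriv _ _ _
  have horth : Orthonormal ℝ fun j => (freq L (j + 1))⁻¹ • contL2 L (hc j) := by
    rw [orthonormal_iff_ite]
    intro i j
    rw [inner_smul_left, inner_smul_right, inner_contL2_contL2, pairing,
      integral_sineDeriv_mul hL 1 (Nat.succ_pos i)]
    have := freq_pos hL (Nat.succ_pos i)
    by_cases h : i = j
    · subst h
      simp [← freq_sq]
      field_simp
    · simp [h]
  have hcoef : ∀ j, inner ℝ ((freq L (j + 1))⁻¹ • contL2 L (hc j)) (w.1 1)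
      = freq L (j + 1) * inner ℝ (sineL2 L j) w.toL2 := by
    intro j
    have h1 := hw.pairing_deriv hL hb (contDiff_sineDeriv L (freq L (j + 1)) 1)
    have h2 : deriv (sineDeriv L (freq L (j + 1)) 1)
        = (-(freq L (j + 1) ^ 2)) • sineMode L (j + 1) := by
      rw [deriv_sineDeriv]
      ext x
      rw [sineDeriv_add_two L _ 0, sineMode_eq_sineDeriv]; rfl
    rw [h2, pairing_comm, pairing_smul, pairing_comm] at h1
    rw [inner_smul_left, inner_contL2, inner_sineL2]
    have := freq_pos hL (Nat.succ_pos j)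
    simp only [conj_trivial]
    field_simp
    linarith
  have s1 := horth.inner_products_summable (x := w.1 1)
  have s2 := (orthonormal_sineL2 hL).inner_products_summable (x := w.toL2)
  refine (s1.add s2).congr fun j => ?_
  rw [hcoef, Real.norm_eq_abs, Real.norm_eq_abs, sq_abs, sq_abs, mul_pow, freq_sq]
  simp [sineWeight, Fin.sum_univ_two]
  ring

theorem summable_sq_mul_sineWeight_zero {L : ℝ} (hL : 0 < L) (f : L2 L) :
    Summable fun j => inner ℝ (sineL2 L j) f ^ 2 * sineWeight L 0 j := by
  refine (orthonormal_sineL2 hL).inner_products_summable (x := f) |>.congr fun j => ?_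
  simp [sineWeight]

/-! ### Uniqueness of weak derivatives and sine series in H^m. -/

theorem isWeakDeriv_unique {L : ℝ} {f g h : L2 L} (h₁ : IsWeakDeriv L f g)
    (h₂ : IsWeakDeriv L f h) : g = h := by
  rw [← sub_eq_zero, Lp.eq_zero_iff_ae_eq_zero]
  have hint : Integrable (g - h : L2 L) (intervalMeasure L) := (Lp.memLp _).integrable (by norm_num)
  refine ae_eq_zero_of_forall_test isOpen_Ioo (IntegrableOn.locallyIntegrableOn hint)
    fun φ hφ hc hs => ?_
  have e1 := isWeakDeriv_iff.1 h₁ φ hφ hc hs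
  have e2 := isWeakDeriv_iff.1 h₂ φ hφ hc hs
  have e3 : pairing L φ (g - h : L2 L) = 0 := by
    rw [pairing_congr (Filter.EventuallyEq.refl _ _) (Lp.coeFn_sub g h),
      pairing_sub (memLp_of_continuous hφ.continuous) (Lp.memLp g) (Lp.memLp h)]
    linarith
  rw [pairing_comm] at e3
  exact e3

/-- Weak derivatives are unique, so the zeroth component determines the tuple. Identities in H^m can
thus be checked on L² sine coefficients. -/
theorem toL2_injective {L : ℝ} {m : ℕ} {v w : Sobolev L m} (h : v.toL2 = w.toL2) : v = w := by
  have key : ∀ n : ℕ, ∀ hn : n < m + 1, v.1 ⟨n, hn⟩ = w.1 ⟨n, hn⟩ := by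
    intro n
    induction n with
    | zero => intro _; exact h
    | succ n ih =>
      intro hn
      have e := ih (by omega)
      have h1 : IsWeakDeriv L (v.1 ⟨n, by omega⟩) (v.1 ⟨n + 1, hn⟩) := v.2 ⟨n, by omega⟩
      have h2 : IsWeakDeriv L (w.1 ⟨n, by omega⟩) (w.1 ⟨n + 1, hn⟩) := w.2 ⟨n, by omega⟩
      rw [e] at h1
      exact isWeakDeriv_unique h1 h2
  refine Subtype.ext ?_
  ext i : 1
  exact key i i.2

theorem inner_sineL2_tsum {L : ℝ} (hL : 0 < L) {a : ℕ → ℝ}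
    (h : Summable fun j => a j • sineL2 L j) (i : ℕ) :
    inner ℝ (sineL2 L i) (∑' j, a j • sineL2 L j) = a i := by
  have h1 : inner ℝ (sineL2 L i) (∑' j, a j • sineL2 L j)
      = ∑' j, inner ℝ (sineL2 L i) (a j • sineL2 L j) :=
    (innerSL ℝ (sineL2 L i)).map_tsum h
  rw [h1, tsum_eq_single i]
  · rw [inner_smul_right, orthonormal_iff_ite.1 (orthonormal_sineL2 hL)]; simp
  · intro j hj
    rw [inner_smul_right, orthonormal_iff_ite.1 (orthonormal_sineL2 hL)]; simp [hj.symm]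

theorem toL2_tsum_sineSobolev {L : ℝ} (hL : 0 < L) {m : ℕ} {a : ℕ → ℝ}
    (ha : Summable fun j => a j ^ 2 * sineWeight L m j) :
    Sobolev.toL2 (∑' j, a j • sineSobolev hL m j) = ∑' j, a j • sineL2 L j := by
  have h := (summable_smul_of_orthogonal (inner_sineSobolev hL m) a ha).1
  rw [← sobolevToL2_apply, (sobolevToL2 L m).map_tsum h]
  refine tsum_congr fun j => ?_
  rw [map_smul, sobolevToL2_apply, toL2_sineSobolev]

theorem summable_smul_sineL2 {L : ℝ} (hL : 0 < L) {m : ℕ} {a : ℕ → ℝ}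
    (ha : Summable fun j => a j ^ 2 * sineWeight L m j) : Summable fun j => a j • sineL2 L j := by
  have h := (summable_smul_of_orthogonal (inner_sineSobolev hL m) a ha).1
  have := (sobolevToL2 L m).summable h
  refine this.congr fun j => ?_
  rw [map_smul, sobolevToL2_apply, toL2_sineSobolev]

/-- Sine expansion in `H^m(0, L)`. -/
theorem eq_tsum_sineSobolev {L : ℝ} (hL : 0 < L) {m : ℕ} (w : Sobolev L m)
    (h : Summable fun j => inner ℝ (sineL2 L j) w.toL2 ^ 2 * sineWeight L m j) :
    w = ∑' j, inner ℝ (sineL2 L j) w.toL2 • sineSobolev hL m j := by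
  refine toL2_injective ?_
  rw [toL2_tsum_sineSobolev hL h]
  refine ext_sineL2 hL fun i => ?_
  rw [inner_sineL2_tsum hL (summable_smul_sineL2 hL h)]

/-! ### The closed-loop modes -/

/-- The closed-loop modes (and their derivatives): the first `N` sine modes are replaced by their
images under `I + Υ_k`. -/
def modeFun (L β : ℝ) (N j n : ℕ) (x : ℝ) : ℝ :=
  if j < N then shiftMode L β (j + 1) n x else sineDeriv L (freq L (j + 1)) n x

/-- The squared frequency of a closed-loop mode. -/
def modeSq (L β : ℝ) (N j : ℕ) : ℝ := eigenvalue L (j + 1) + if j < N then β else 0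

theorem hasDerivAt_modeFun (L β : ℝ) (N j n : ℕ) (x : ℝ) :
    HasDerivAt (modeFun L β N j n) (modeFun L β N j (n + 1) x) x := by
  unfold modeFun
  by_cases h : j < N
  · simp only [h, if_true]
    exact (hasDerivAt_sineDeriv L _ n x).const_mul _
  · simp only [h, if_false]
    exact hasDerivAt_sineDeriv L _ n x

theorem continuous_modeFun (L β : ℝ) (N j n : ℕ) : Continuous (modeFun L β N j n) :=
  continuous_of_hasDerivAt (hasDerivAt_modeFun L β N j n)

theorem modeFun_two {β : ℝ} (hβ : 0 < β) (L : ℝ) (N j : ℕ) (x : ℝ) :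
    modeFun L β N j 2 x = -modeSq L β N j * modeFun L β N j 0 x := by
  unfold modeFun modeSq
  by_cases h : j < N
  · simp only [h, if_true, shiftMode]
    rw [sineDeriv_add_two L _ 0, shiftFreq, Real.sq_sqrt (by positivity), freq_sq]
    ring
  · simp only [h, if_false]
    rw [sineDeriv_add_two L _ 0, freq_sq, add_zero]

theorem modeFun_zero (L β : ℝ) (N j : ℕ) : modeFun L β N j 0 0 = 0 := by
  simp [modeFun, shiftMode, sineDeriv_zero_zero]

/-- A closed-loop mode as an element of `L²(0, L)`. -/
def modeL2 (L β : ℝ) (N j : ℕ) : L2 L := contL2 L (continuous_modeFun L β N j 0)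

/-- The closed-loop system is the sine basis plus N corrections. This is why no basis theory beyond
orthogonal series is needed. -/
theorem modeL2_eq (L β : ℝ) (N j : ℕ) :
    modeL2 L β N j = sineL2 L j + if j < N then corrL2 L β j else 0 := by
  refine Lp.ext ?_
  by_cases h : j < N
  · simp only [h, if_true]
    filter_upwards [coeFn_contL2 (L := L) (continuous_modeFun L β N j 0),
      Lp.coeFn_add (sineL2 L j) (corrL2 L β j), coeFn_contL2 (L := L) (continuous_sineMode L (j + 1)),
      coeFn_contL2 (L := L) (continuous_corr L β (j + 1))] with x h1 h2 h3 h4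
    rw [modeL2, h1, h2, Pi.add_apply, sineL2, corrL2, h3, h4]
    simp [modeFun, h]
  · simp only [h, if_false, add_zero]
    filter_upwards [coeFn_contL2 (L := L) (continuous_modeFun L β N j 0),
      coeFn_contL2 (L := L) (continuous_sineMode L (j + 1))] with x h1 h3
    rw [modeL2, h1, sineL2, h3, sineMode_eq_sineDeriv]
    simp [modeFun, h]

/-- The `j`-th coefficient of `P_N (I + Υ_k P_N)⁻¹ f`. -/
def coefCLM (L β : ℝ) (N : ℕ) (j : Fin N) : L2 L →L[ℝ] ℝ :=
  ∑ i : Fin N, (modeMatrix L β N)⁻¹ j i • innerSL ℝ (sineL2 L i)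

theorem coefCLM_apply (L β : ℝ) (N : ℕ) (j : Fin N) (f : L2 L) :
    coefCLM L β N j f = ((modeMatrix L β N)⁻¹.mulVec fun i => inner ℝ (sineL2 L i) f) j := by
  simp [coefCLM, Matrix.mulVec, dotProduct]

/-- The feedback as a continuous linear functional. -/
def feedbackCLM (L β : ℝ) (N : ℕ) : L2 L →L[ℝ] ℝ :=
  ∑ j : Fin N, shiftMode L β (j + 1) 0 L • coefCLM L β N j

theorem feedbackCLM_apply (L β : ℝ) (N : ℕ) (f : L2 L) :
    feedbackCLM L β N f = ∑ j : Fin N, shiftMode L β (j + 1) 0 L * coefCLM L β N j f := by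
  simp [feedbackCLM]

theorem feedback_eq_feedbackCLM {L β : ℝ} (hL : 0 < L) (hβ : 0 < β) {N : ℕ}
    (hadm : Admissible L (kernel 1 β) N) (f : L2 L) :
    feedback L (kernel 1 β) N f = feedbackCLM L β N f := by
  rw [feedback_eq hL hβ hadm, feedbackCLM_apply]
  refine Finset.sum_congr rfl fun j _ => ?_
  rw [coefCLM_apply, mul_comm]
  simp only [inner_sineL2]

theorem inner_sineL2_modeL2 {L : ℝ} (hL : 0 < L) (β : ℝ) {N : ℕ} (k : Fin N) (j : ℕ) :
    inner ℝ (sineL2 L k) (modeL2 L β N j)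
      = if h : j < N then modeMatrix L β N k ⟨j, h⟩ else 0 := by
  have ho := orthonormal_iff_ite.1 (orthonormal_sineL2 hL) k j
  rw [modeL2_eq, inner_add_right, ho]
  by_cases h : j < N
  · have := inner_sineL2_corrL2 hL β k ⟨j, h⟩
    simp only [h, if_true, dif_pos, this, Fin.ext_iff]
    ring
  · have : (k : ℕ) ≠ j := fun e => h (e ▸ k.2)
    simp [h, this]

theorem isUnit_det_modeMatrix {L β : ℝ} (hL : 0 < L) (hβ : 0 < β) {N : ℕ}
    (hadm : Admissible L (kernel 1 β) N) : IsUnit (modeMatrix L β N).det :=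
  (Matrix.isUnit_iff_isUnit_det _).1 (isUnit_modeMatrix hL hβ hadm)

/-- Biorthogonality: M⁻¹M = 1 for the first N modes, while the later sines are orthogonal to e_1, …,
e_N. -/
theorem coefCLM_modeL2 {L β : ℝ} (hL : 0 < L) (hβ : 0 < β) {N : ℕ}
    (hadm : Admissible L (kernel 1 β) N) (k : Fin N) (j : ℕ) :
    coefCLM L β N k (modeL2 L β N j) = if (k : ℕ) = j then 1 else 0 := by
  rw [coefCLM_apply]
  simp only [inner_sineL2_modeL2 hL]
  by_cases h : j < N
  · simp only [h, dif_pos]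
    have := congrFun (congrFun (Matrix.nonsing_inv_mul _ (isUnit_det_modeMatrix hL hβ hadm)) k)
      ⟨j, h⟩
    rw [Matrix.mul_apply, Matrix.one_apply] at this
    simpa [Matrix.mulVec, dotProduct, Fin.ext_iff] using this
  · have : (k : ℕ) ≠ j := fun e => h (e ▸ k.2)
    simp [h, this, Matrix.mulVec, dotProduct]

/-- By biorthogonality the feedback of E_j is E_j(L). An unmodified sine produces no feedback and
vanishes at L. So every mode obeys the boundary law on its own, and the closed loop decouples. -/
theorem feedbackCLM_modeL2 {L β : ℝ} (hL : 0 < L) (hβ : 0 < β) {N : ℕ}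
    (hadm : Admissible L (kernel 1 β) N) (j : ℕ) :
    feedbackCLM L β N (modeL2 L β N j) = modeFun L β N j 0 L := by
  rw [feedbackCLM_apply]
  simp only [coefCLM_modeL2 hL hβ hadm]
  by_cases h : j < N
  · rw [Finset.sum_eq_single ⟨j, h⟩]
    · simp [modeFun, h]
    · intro i _ hi
      have : (i : ℕ) ≠ j := fun e => hi (Fin.ext e)
      simp [this]
    · simp
  · rw [Finset.sum_eq_zero]
    · have := sineMode_right hL (j + 1)
      rw [sineMode_eq_sineDeriv] at this
      simp [modeFun, h, this]
    · intro i _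
      have : (i : ℕ) ≠ j := fun e => h (e ▸ i.2)
      simp [this]

/-! ### Synthesis from coefficients -/

/-- The function with coefficients `b` with respect to the closed-loop modes. -/
def synth (L β : ℝ) (N : ℕ) (b : ℕ → ℝ) : L2 L :=
  ∑' j, b j • sineL2 L j + ∑ i : Fin N, b i • corrL2 L β i

theorem hasSum_synth {L β : ℝ} {N : ℕ} {b : ℕ → ℝ} (h : Summable fun j => b j • sineL2 L j) :
    HasSum (fun j => b j • modeL2 L β N j) (synth L β N b) := by
  have h1 : HasSum (fun j => b j • (if j < N then corrL2 L β j else 0))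
      (∑ i : Fin N, b i • corrL2 L β i) := by
    have e : ∑ i : Fin N, b i • corrL2 L β i
        = ∑ j ∈ Finset.range N, b j • (if j < N then corrL2 L β j else 0) := by
      rw [Finset.sum_range]; simp
    rw [e]
    refine hasSum_sum_of_ne_finset_zero fun j hj => ?_
    rw [Finset.mem_range] at hj
    simp [hj]
  simp only [modeL2_eq, smul_add]
  exact h.hasSum.add h1

theorem modeMatrix_mulVec_coefCLM {L β : ℝ} (hL : 0 < L) (hβ : 0 < β) {N : ℕ}
    (hadm : Admissible L (kernel 1 β) N) (f : L2 L) (i : Fin N) :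
    ∑ k : Fin N, modeMatrix L β N i k * coefCLM L β N k f = inner ℝ (sineL2 L i) f := by
  have h1 : (fun k => coefCLM L β N k f)
      = (modeMatrix L β N)⁻¹.mulVec fun i => inner ℝ (sineL2 L i) f :=
    funext fun k => coefCLM_apply _ _ _ _ _
  have h2 := congrArg (modeMatrix L β N).mulVec h1
  rw [Matrix.mulVec_mulVec, Matrix.mul_nonsing_inv _ (isUnit_det_modeMatrix hL hβ hadm),
    Matrix.one_mulVec] at h2
  exact congrFun h2 i

/-- The coefficients of `f` with respect to the closed-loop modes: the sine coefficients of
`(I + Υ_k P_N)⁻¹ f`. -/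
def modeCoef (L β : ℝ) (N : ℕ) (f : L2 L) (j : ℕ) : ℝ :=
  inner ℝ (sineL2 L j) (f - ∑ i : Fin N, coefCLM L β N i f • corrL2 L β i)

/-- The corrections have sine coefficients M - 1, and (e_j, f)₂ = (Mc)_j; subtracting (M - 1)c
leaves c_j. -/
theorem modeCoef_fin {L β : ℝ} (hL : 0 < L) (hβ : 0 < β) {N : ℕ}
    (hadm : Admissible L (kernel 1 β) N) (f : L2 L) (j : Fin N) :
    modeCoef L β N f j = coefCLM L β N j f := by
  rw [modeCoef, inner_sub_right, inner_sum]
  simp only [inner_smul_right, inner_sineL2_corrL2 hL, mul_sub, Finset.sum_sub_distrib]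
  rw [← modeMatrix_mulVec_coefCLM hL hβ hadm f j]
  simp [mul_comm]

/-- Completeness of the sines recovers f minus the corrections, and the synthesis adds the same
corrections back. -/
theorem synth_modeCoef {L β : ℝ} (hL : 0 < L) (hβ : 0 < β) {N : ℕ}
    (hadm : Admissible L (kernel 1 β) N) (f : L2 L) : synth L β N (modeCoef L β N f) = f := by
  have h1 : ∑' j, modeCoef L β N f j • sineL2 L j
      = f - ∑ i : Fin N, coefCLM L β N i f • corrL2 L β i := by
    refine ext_sineL2 hL fun i => ?_
    rw [inner_sineL2_tsum hL]
    · rfl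
    · exact summable_smul_sineL2 hL (m := 0) (summable_sq_mul_sineWeight_zero hL _)
  rw [synth, h1]
  simp only [modeCoef_fin hL hβ hadm]
  abel

/-! ### Smooth test functions -/

theorem contDiff_deriv_snd {φ : ℝ → ℝ → ℝ} (h : ContDiff ℝ ∞ (Function.uncurry φ)) :
    ContDiff ℝ ∞ (Function.uncurry fun t x => deriv (φ t) x) := by
  have e : (Function.uncurry fun t x => deriv (φ t) x)
      = fun p => fderiv ℝ (Function.uncurry φ) p (0, 1) := by
    ext ⟨t, x⟩
    have h1 : HasFDerivAt (Function.uncurry φ) (fderiv ℝ (Function.uncurry φ) (t, x)) (t, x) :=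
      (h.differentiable (by simp) _).hasFDerivAt
    have h2 : HasDerivAt (fun x : ℝ => (t, x)) ((0 : ℝ), (1 : ℝ)) x :=
      (hasDerivAt_const x t).prodMk (hasDerivAt_id x)
    exact (h1.comp_hasDerivAt x h2).deriv
  rw [e]
  exact (h.fderiv_right (m := ∞) (by simp)).clm_apply contDiff_const

theorem contDiff_deriv_fst {φ : ℝ → ℝ → ℝ} (h : ContDiff ℝ ∞ (Function.uncurry φ)) :
    ContDiff ℝ ∞ (Function.uncurry fun t x => deriv (fun s => φ s x) t) := by
  have e : (Function.uncurry fun t x => deriv (fun s => φ s x) t)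
      = fun p => fderiv ℝ (Function.uncurry φ) p (1, 0) := by
    ext ⟨t, x⟩
    have h1 : HasFDerivAt (Function.uncurry φ) (fderiv ℝ (Function.uncurry φ) (t, x)) (t, x) :=
      (h.differentiable (by simp) _).hasFDerivAt
    have h2 : HasDerivAt (fun t : ℝ => (t, x)) ((1 : ℝ), (0 : ℝ)) t :=
      (hasDerivAt_id t).prodMk (hasDerivAt_const t x)
    exact (h1.comp_hasDerivAt t h2).deriv
  rw [e]
  exact (h.fderiv_right (m := ∞) (by simp)).clm_apply contDiff_const

theorem hasDerivAt_snd {φ : ℝ → ℝ → ℝ} (h : ContDiff ℝ ∞ (Function.uncurry φ)) (t x : ℝ) :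
    HasDerivAt (φ t) (deriv (φ t) x) x := by
  have : Differentiable ℝ (φ t) :=
    (h.comp (contDiff_const.prodMk contDiff_id : ContDiff ℝ ∞ fun x : ℝ => (t, x))).differentiable
      (by simp)
  exact (this x).hasDerivAt

theorem hasDerivAt_fst {φ : ℝ → ℝ → ℝ} (h : ContDiff ℝ ∞ (Function.uncurry φ)) (t x : ℝ) :
    HasDerivAt (fun s => φ s x) (deriv (fun s => φ s x) t) t := by
  have : Differentiable ℝ (fun s => φ s x) :=
    (h.comp (contDiff_id.prodMk contDiff_const : ContDiff ℝ ∞ fun s : ℝ => (s, x))).differentiable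
      (by simp)
  exact (this t).hasDerivAt

/-- The adjoint operator `∂_t + ν ∂_x² + α` applied to a test function. -/
def adjointOp (ν α : ℝ) (φ : ℝ → ℝ → ℝ) (t x : ℝ) : ℝ :=
  deriv (fun s => φ s x) t + ν * iteratedDeriv 2 (φ t) x + α * φ t x

theorem iteratedDeriv_two (f : ℝ → ℝ) (x : ℝ) : iteratedDeriv 2 f x = deriv (deriv f) x := by
  rw [iteratedDeriv_succ, iteratedDeriv_one]

theorem continuous_adjointOp (ν α : ℝ) {φ : ℝ → ℝ → ℝ} (h : ContDiff ℝ ∞ (Function.uncurry φ)) :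
    Continuous (Function.uncurry (adjointOp ν α φ)) := by
  have h1 := (contDiff_deriv_fst h).continuous
  have h2 := (contDiff_deriv_snd (contDiff_deriv_snd h)).continuous
  have h3 := h.continuous
  have e : Function.uncurry (adjointOp ν α φ)
      = fun p => Function.uncurry (fun t x => deriv (fun s => φ s x) t) p
        + ν * Function.uncurry (fun t x => deriv (deriv (φ t)) x) p
        + α * Function.uncurry φ p := by
    ext ⟨t, x⟩
    simp only [Function.uncurry, adjointOp, iteratedDeriv_two]
  rw [e]
  fun_prop

theorem adjointOp_eq_zero {ν α R : ℝ} {φ : ℝ → ℝ → ℝ} (hR : ∀ t x, R ≤ t → φ t x = 0) {t : ℝ}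
    (ht : R < t) (x : ℝ) : adjointOp ν α φ t x = 0 := by
  have h1 : deriv (fun s => φ s x) t = 0 := by
    have : (fun s => φ s x) =ᶠ[nhds t] fun _ => 0 := by
      filter_upwards [Ioi_mem_nhds ht] with s hs
      exact hR s x (le_of_lt hs)
    rw [this.deriv_eq, deriv_const]
  have h2 : φ t = fun _ => 0 := funext fun x => hR t x ht.le
  rw [adjointOp, h1, iteratedDeriv_two, h2]
  simp

theorem integral_Ioi_eq_intervalIntegral {R : ℝ} (hR : 0 ≤ R) {f : ℝ → ℝ}
    (hf : ∀ t, R < t → f t = 0) : ∫ t in Ioi (0 : ℝ), f t = ∫ t in (0 : ℝ)..R, f t := by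
  rw [intervalIntegral.integral_of_le hR]
  refine setIntegral_eq_of_subset_of_forall_sdiff_eq_zero measurableSet_Ioi
    (fun t ht => ht.1) fun t ht => ?_
  exact hf t (not_le.1 fun h => ht.2 ⟨ht.1, h⟩)

theorem continuous_integral_mul {L : ℝ} {F : ℝ → ℝ} (hF : Continuous F) {h : ℝ → ℝ → ℝ}
    (hh : Continuous (Function.uncurry h)) : Continuous fun t => ∫ x in (0 : ℝ)..L, F x * h t x := by
  refine intervalIntegral.continuous_parametric_intervalIntegral_of_continuous' ?_ _ _
  exact (hF.comp continuous_snd).mul hh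

theorem hasDerivAt_integral_mul {L : ℝ} (hL : 0 < L) {F : ℝ → ℝ} (hF : Continuous F)
    {φ : ℝ → ℝ → ℝ} (h : ContDiff ℝ ∞ (Function.uncurry φ)) (t : ℝ) :
    HasDerivAt (fun t => ∫ x in (0 : ℝ)..L, F x * φ t x)
      (∫ x in (0 : ℝ)..L, F x * deriv (fun s => φ s x) t) t := by
  have hc := (contDiff_deriv_fst h).continuous
  have hcF : Continuous (fun p : ℝ × ℝ => F p.2 * deriv (fun s => φ s p.2) p.1) :=
    (hF.comp continuous_snd).mul hc
  obtain ⟨C, hC⟩ := ((isCompact_Icc (a := t - 1) (b := t + 1)).prod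
    (isCompact_Icc (a := (0 : ℝ)) (b := L))).exists_bound_of_continuousOn hcF.continuousOn
  refine (intervalIntegral.hasDerivAt_integral_of_dominated_loc_of_deriv_le
    (F := fun t x => F x * φ t x) (F' := fun t x => F x * deriv (fun s => φ s x) t)
    (bound := fun _ => C) (Icc_mem_nhds (by linarith : t - 1 < t) (by linarith : t < t + 1))
    ?_ ?_ ?_ ?_ ?_ ?_).2
  · refine .of_forall fun s => Continuous.aestronglyMeasurable ?_
    exact hF.mul (h.continuous.comp (Continuous.prodMk_right s))
  · exact (hF.mul (h.continuous.comp (Continuous.prodMk_right t))).intervalIntegrable _ _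
  · exact (hcF.comp (Continuous.prodMk_right t)).aestronglyMeasurable
  · refine .of_forall fun x hx s hs => hC (s, x) ⟨hs, ?_⟩
    rw [uIoc_of_le hL.le] at hx
    exact Ioc_subset_Icc_self hx
  · exact intervalIntegrable_const
  · exact .of_forall fun x _ s _ => (hasDerivAt_fst h s x).const_mul (F x)

/-- Integrate by parts twice. The zero boundary values of φ remove one pair of boundary terms and
the zero of the mode at 0 removes half of the other, so only the flux at L remains. -/
theorem integral_mul_adjointOp {L ν α β : ℝ} (hβ : 0 < β) {N j : ℕ}
    {φ : ℝ → ℝ → ℝ} (h : ContDiff ℝ ∞ (Function.uncurry φ))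
    (hbd : ∀ t : ℝ, φ t 0 = 0 ∧ φ t L = 0) (t : ℝ) :
    ∫ x in (0 : ℝ)..L, modeFun L β N j 0 x * adjointOp ν α φ t x
      = (∫ x in (0 : ℝ)..L, modeFun L β N j 0 x * deriv (fun s => φ s x) t)
        - (ν * modeSq L β N j - α) * (∫ x in (0 : ℝ)..L, modeFun L β N j 0 x * φ t x)
        + ν * (modeFun L β N j 0 L * deriv (φ t) L) := by
  have c0 : Continuous (φ t) := h.continuous.comp (Continuous.prodMk_right t)
  have c1 : Continuous (deriv (φ t)) :=
    (contDiff_deriv_snd h).continuous.comp (Continuous.prodMk_right t)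
  have c2 : Continuous (deriv (deriv (φ t))) :=
    (contDiff_deriv_snd (contDiff_deriv_snd h)).continuous.comp (Continuous.prodMk_right t)
  have ct : Continuous (fun x => deriv (fun s => φ s x) t) :=
    (contDiff_deriv_fst h).continuous.comp (Continuous.prodMk_right t)
  have cF : ∀ n, Continuous (modeFun L β N j n) := continuous_modeFun L β N j
  have hx : ∫ x in (0 : ℝ)..L, modeFun L β N j 0 x * deriv (deriv (φ t)) x
      = modeFun L β N j 0 L * deriv (φ t) L
        - modeSq L β N j * ∫ x in (0 : ℝ)..L, modeFun L β N j 0 x * φ t x := by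
    rw [intervalIntegral.integral_mul_deriv_eq_deriv_mul (u' := modeFun L β N j 1)
      (v := deriv (φ t)) (fun x _ => hasDerivAt_modeFun L β N j 0 x)
      (fun x _ => hasDerivAt_snd (contDiff_deriv_snd h) t x)
      ((cF 1).intervalIntegrable _ _) (c2.intervalIntegrable _ _),
      intervalIntegral.integral_mul_deriv_eq_deriv_mul (u' := modeFun L β N j 2)
      (v := φ t) (fun x _ => hasDerivAt_modeFun L β N j 1 x)
      (fun x _ => hasDerivAt_snd h t x)
      ((cF 2).intervalIntegrable _ _) (c1.intervalIntegrable _ _)]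
    simp only [modeFun_two hβ, mul_assoc, intervalIntegral.integral_const_mul]
    rw [modeFun_zero, (hbd t).1, (hbd t).2]
    ring
  have e : ∀ x, modeFun L β N j 0 x * adjointOp ν α φ t x
      = modeFun L β N j 0 x * deriv (fun s => φ s x) t
        + (ν * (modeFun L β N j 0 x * deriv (deriv (φ t)) x)
          + α * (modeFun L β N j 0 x * φ t x)) := by
    intro x; rw [adjointOp, iteratedDeriv_two]; ring
  simp only [e]
  rw [intervalIntegral.integral_add, intervalIntegral.integral_add,
    intervalIntegral.integral_const_mul, intervalIntegral.integral_const_mul, hx]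
  · ring
  · exact (continuous_const.mul ((cF 0).mul c2)).intervalIntegrable _ _
  · exact (continuous_const.mul ((cF 0).mul c0)).intervalIntegrable _ _
  · exact ((cF 0).mul ct).intervalIntegrable _ _
  · exact ((continuous_const.mul ((cF 0).mul c2)).add
      (continuous_const.mul ((cF 0).mul c0))).intervalIntegrable _ _

/-- Each closed-loop mode gives a weak solution. -/
theorem mode_weak {L ν α β : ℝ} (hL : 0 < L) (hβ : 0 < β) {N j : ℕ}
    {φ : ℝ → ℝ → ℝ} (h : ContDiff ℝ ∞ (Function.uncurry φ)) {R : ℝ}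
    (hR : ∀ t x, R ≤ t → φ t x = 0)
    (hbd : ∀ t : ℝ, φ t 0 = 0 ∧ φ t L = 0) :
    (∫ t in (0 : ℝ)..R, Real.exp (-(ν * modeSq L β N j - α) * t) *
        ∫ x in (0 : ℝ)..L, modeFun L β N j 0 x * adjointOp ν α φ t x)
      + (∫ x in (0 : ℝ)..L, modeFun L β N j 0 x * φ 0 x)
      - ν * ∫ t in (0 : ℝ)..R, Real.exp (-(ν * modeSq L β N j - α) * t) *
          (modeFun L β N j 0 L * deriv (φ t) L) = 0 := by
  set κ := ν * modeSq L β N j - α with hκ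
  have cF := continuous_modeFun L β N j 0
  set Q : ℝ → ℝ := fun t => ∫ x in (0 : ℝ)..L, modeFun L β N j 0 x * φ t x with hQ
  set Q' : ℝ → ℝ := fun t => ∫ x in (0 : ℝ)..L, modeFun L β N j 0 x * deriv (fun s => φ s x) t
    with hQ'
  have cQ : Continuous Q := continuous_integral_mul cF h.continuous
  have cQ' : Continuous Q' := continuous_integral_mul cF (contDiff_deriv_fst h).continuous
  have cφ : Continuous fun t => deriv (φ t) L :=
    (contDiff_deriv_snd h).continuous.comp (Continuous.prodMk_left L)
  -- The time integral is that of an exact derivative: it contributes -Q(0), as Q(R) = 0, and this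
  -- cancels the initial term. The flux at L cancels the boundary integral.
  have hd : ∀ t ∈ uIcc 0 R, HasDerivAt (fun t => Real.exp (-κ * t) * Q t)
      (Real.exp (-κ * t) * (Q' t - κ * Q t)) t := by
    intro t _
    have h1 : HasDerivAt (fun t => Real.exp (-κ * t)) (Real.exp (-κ * t) * -κ) t := by
      have := ((hasDerivAt_id t).const_mul (-κ)).exp
      simpa using this
    refine (h1.mul (hasDerivAt_integral_mul hL cF h t)).congr_deriv ?_
    simp only [hQ, hQ']
    ring
  have hint := intervalIntegral.integral_eq_sub_of_hasDerivAt hd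
    (Continuous.intervalIntegrable (by fun_prop) _ _)
  have hQR : Q R = 0 := by simp [hQ, hR R _ le_rfl]
  have e : ∀ t, Real.exp (-κ * t) * ∫ x in (0 : ℝ)..L, modeFun L β N j 0 x * adjointOp ν α φ t x
      = Real.exp (-κ * t) * (Q' t - κ * Q t)
        + ν * (Real.exp (-κ * t) * (modeFun L β N j 0 L * deriv (φ t) L)) := by
    intro t
    rw [integral_mul_adjointOp hβ h hbd]
    simp only [hQ, hQ', ← hκ]
    ring
  simp only [e]
  rw [intervalIntegral.integral_add (Continuous.intervalIntegrable (by fun_prop) _ _)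
    (Continuous.intervalIntegrable (by fun_prop) _ _), hint, hQR,
    intervalIntegral.integral_const_mul]
  simp [hQ]

/-! ### Synthesis in Sobolev spaces -/

/-- The element of `H^m(0, L)` with coefficients `b` with respect to the closed-loop modes. -/
def synthSobolev {L : ℝ} (hL : 0 < L) (β : ℝ) (N m : ℕ) (b : ℕ → ℝ) : Sobolev L m :=
  ∑' j, b j • sineSobolev hL m j + ∑ i : Fin N, b i • corrSobolev hL β m i

theorem toL2_synthSobolev {L : ℝ} (hL : 0 < L) (β : ℝ) (N : ℕ) {m : ℕ} {b : ℕ → ℝ}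
    (hb : Summable fun j => b j ^ 2 * sineWeight L m j) :
    (synthSobolev hL β N m b).toL2 = synth L β N b := by
  have h := toL2_tsum_sineSobolev hL hb
  rw [← sobolevToL2_apply] at h
  rw [synthSobolev, ← sobolevToL2_apply, map_add, h, map_sum, synth]
  congr 1
  refine Finset.sum_congr rfl fun i _ => ?_
  rw [map_smul, sobolevToL2_apply, toL2_corrSobolev]

theorem sineWeight_nonneg (L : ℝ) (m j : ℕ) : 0 ≤ sineWeight L m j :=
  zero_le_one.trans (one_le_sineWeight L m j)

theorem summable_of_abs_le {L : ℝ} {m : ℕ} {a b : ℕ → ℝ} {q : ℝ}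
    (ha : Summable fun j => a j ^ 2 * sineWeight L m j)
    (hab : ∀ j, |b j| ≤ q * |a j|) : Summable fun j => b j ^ 2 * sineWeight L m j := by
  refine Summable.of_nonneg_of_le (fun j => mul_nonneg (sq_nonneg _) (sineWeight_nonneg _ _ _))
    (fun j => ?_) (ha.mul_left (q ^ 2))
  rw [← mul_assoc]
  refine mul_le_mul_of_nonneg_right ?_ (sineWeight_nonneg _ _ _)
  calc b j ^ 2 = |b j| ^ 2 := (sq_abs _).symm
    _ ≤ (q * |a j|) ^ 2 := by have := hab j; gcongr
    _ = q ^ 2 * a j ^ 2 := by rw [mul_pow, sq_abs]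

theorem norm_tsum_sineSobolev_le {L : ℝ} (hL : 0 < L) {m : ℕ} {a b : ℕ → ℝ} {q : ℝ} (hq : 0 ≤ q)
    (ha : Summable fun j => a j ^ 2 * sineWeight L m j)
    (hab : ∀ j, |b j| ≤ q * |a j|) :
    ‖∑' j, b j • sineSobolev hL m j‖ ≤ q * ‖∑' j, a j • sineSobolev hL m j‖ := by
  have hb := summable_of_abs_le ha hab
  refine le_of_sq_le_sq ?_ (by positivity)
  rw [mul_pow, (summable_smul_of_orthogonal (inner_sineSobolev hL m) b hb).2,
    (summable_smul_of_orthogonal (inner_sineSobolev hL m) a ha).2, ← tsum_mul_left]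
  refine hb.tsum_le_tsum (fun j => ?_) (ha.mul_left _)
  rw [← mul_assoc]
  refine mul_le_mul_of_nonneg_right ?_ (sineWeight_nonneg _ _ _)
  calc b j ^ 2 = |b j| ^ 2 := (sq_abs _).symm
    _ ≤ (q * |a j|) ^ 2 := by have := hab j; gcongr
    _ = q ^ 2 * a j ^ 2 := by rw [mul_pow, sq_abs]

theorem norm_synthSobolev_le {L : ℝ} (hL : 0 < L) (β : ℝ) (N : ℕ) {m : ℕ} {a b : ℕ → ℝ} {q : ℝ}
    (hq : 0 ≤ q) (ha : Summable fun j => a j ^ 2 * sineWeight L m j)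
    (hab : ∀ j, |b j| ≤ q * |a j|) :
    ‖synthSobolev hL β N m b‖ ≤ q * (‖∑' j, a j • sineSobolev hL m j‖
      + ∑ i : Fin N, |a i| * ‖corrSobolev hL β m i‖) := by
  rw [synthSobolev, mul_add, Finset.mul_sum]
  refine (norm_add_le _ _).trans (add_le_add (norm_tsum_sineSobolev_le hL hq ha hab) ?_)
  refine (norm_sum_le _ _).trans (Finset.sum_le_sum fun i _ => ?_)
  rw [norm_smul, ← mul_assoc, Real.norm_eq_abs]
  exact mul_le_mul_of_nonneg_right (hab i) (norm_nonneg _)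

theorem hasSum_synth_of_sq {L β : ℝ} (hL : 0 < L) {N m : ℕ} {b : ℕ → ℝ}
    (hb : Summable fun j => b j ^ 2 * sineWeight L m j) :
    HasSum (fun j => b j • modeL2 L β N j) (synth L β N b) :=
  hasSum_synth (summable_smul_sineL2 hL hb)

/-- A coefficient sequence set to zero from index n on is still dominated by q|a|, so its partial
sum is itself a synthesis and obeys the same bound. The constant does not depend on n, as dominated
convergence in time requires. -/
theorem exists_norm_sum_modeL2_le {L : ℝ} (hL : 0 < L) (β : ℝ) (N : ℕ) {a : ℕ → ℝ}
    (ha : Summable fun j => a j ^ 2 * sineWeight L 0 j) :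
    ∃ K : ℝ, 0 ≤ K ∧ ∀ (q : ℝ) (b : ℕ → ℝ) (n : ℕ), 0 ≤ q → (∀ j, |b j| ≤ q * |a j|) →
      ‖∑ j ∈ Finset.range n, b j • modeL2 L β N j‖ ≤ q * K := by
  refine ⟨‖∑' j, a j • sineSobolev hL 0 j‖
      + ∑ i : Fin N, |a i| * ‖corrSobolev hL β 0 i‖, by positivity, fun q b n hq hab => ?_⟩
  set b' : ℕ → ℝ := fun j => if j < n then b j else 0 with hb'
  have hab' : ∀ j, |b' j| ≤ q * |a j| := by
    intro j
    by_cases h : j < n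
    · simpa [hb', h] using hab j
    · simp only [hb', h, if_false, abs_zero]; positivity
  have hs := summable_of_abs_le ha hab'
  have h1 : HasSum (fun j => b' j • modeL2 L β N j)
      (∑ j ∈ Finset.range n, b' j • modeL2 L β N j) := by
    refine hasSum_sum_of_ne_finset_zero fun j hj => ?_
    rw [Finset.mem_range] at hj
    simp [hb', hj]
  have h2 : ∑ j ∈ Finset.range n, b j • modeL2 L β N j = synth L β N b' := by
    rw [← h1.unique (hasSum_synth_of_sq hL hs)]
    refine Finset.sum_congr rfl fun j hj => ?_
    rw [Finset.mem_range] at hj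
    simp [hb', hj]
  rw [h2, ← toL2_synthSobolev hL β N hs]
  exact (norm_toL2_le _).trans (norm_synthSobolev_le hL β N hq ha hab')

/-! ### The closed-loop evolution -/

instance (L : ℝ) (m : ℕ) : SecondCountableTopologyEither ℝ (Sobolev L m) :=
  secondCountableTopologyEither_of_left ℝ _

/-- The decay rate of a closed-loop mode. -/
def modeRate (L ν α β : ℝ) (N j : ℕ) : ℝ := ν * modeSq L β N j - α

/-- The coefficients at time `t`. -/
def evol (L ν α β : ℝ) (N : ℕ) (a : ℕ → ℝ) (t : ℝ) (j : ℕ) : ℝ :=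
  Real.exp (-modeRate L ν α β N j * t) * a j

theorem modeSq_ge {L β : ℝ} (hβ : 0 < β) (N j : ℕ) : eigenvalue L (j + 1) ≤ modeSq L β N j := by
  unfold modeSq
  split_ifs <;> linarith

theorem modeSq_nonneg {L β : ℝ} (hβ : 0 < β) (N j : ℕ) : 0 ≤ modeSq L β N j :=
  le_trans (by unfold eigenvalue; positivity) (modeSq_ge hβ N j)

theorem abs_evol_le {L ν α β : ℝ} (hν : 0 < ν) (hβ : 0 < β) (N : ℕ) (a : ℕ → ℝ) {t : ℝ}
    (ht : 0 ≤ t) (j : ℕ) : |evol L ν α β N a t j| ≤ Real.exp (α * t) * |a j| := by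
  rw [evol, abs_mul, abs_of_pos (Real.exp_pos _)]
  have h : -modeRate L ν α β N j * t ≤ α * t := by
    refine mul_le_mul_of_nonneg_right ?_ ht
    have := mul_nonneg hν.le (modeSq_nonneg (L := L) hβ N j)
    unfold modeRate; linarith
  gcongr

theorem continuous_evol (L ν α β : ℝ) (N : ℕ) (a : ℕ → ℝ) (j : ℕ) :
    Continuous fun t => evol L ν α β N a t j := by
  unfold evol; fun_prop

/-- A pointwise limit of continuous partial sums. Summability is asked only for t > 0, so that the
lemma also applies one order above the regularity of the data. -/
theorem aestronglyMeasurable_synthSobolev_evol {L : ℝ} (hL : 0 < L) (ν α β : ℝ) (N m : ℕ)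
    (a : ℕ → ℝ)
    (h : ∀ t, 0 < t → Summable fun j => evol L ν α β N a t j ^ 2 * sineWeight L m j) :
    AEStronglyMeasurable (fun t => synthSobolev hL β N m (evol L ν α β N a t))
      (volume.restrict (Ioi 0)) := by
  refine AEStronglyMeasurable.add (f := fun t => ∑' j, evol L ν α β N a t j • sineSobolev hL m j)
    ?_ (Continuous.aestronglyMeasurable ?_)
  · refine aestronglyMeasurable_of_tendsto_ae Filter.atTop
      (f := fun n t => ∑ j ∈ Finset.range n, evol L ν α β N a t j • sineSobolev hL m j) ?_ ?_
    · intro n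
      refine Continuous.aestronglyMeasurable ?_
      exact continuous_finsetSum _ fun j _ => (continuous_evol L ν α β N a j).smul continuous_const
    · filter_upwards [ae_restrict_mem measurableSet_Ioi] with t ht
      exact (summable_smul_of_orthogonal (inner_sineSobolev hL m) _
        (h t ht)).1.hasSum.tendsto_sum_nat
  · exact continuous_finsetSum _ fun j _ => (continuous_evol L ν α β N a j).smul continuous_const

theorem summable_evol {L ν α β : ℝ} (hν : 0 < ν) (hβ : 0 < β) (N : ℕ) {m : ℕ} {a : ℕ → ℝ}
    (ha : Summable fun j => a j ^ 2 * sineWeight L m j) {t : ℝ} (ht : 0 ≤ t) :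
    Summable fun j => evol L ν α β N a t j ^ 2 * sineWeight L m j :=
  summable_of_abs_le ha (abs_evol_le hν hβ N a ht)

theorem exp_le_of_mem_Ioo {α T t : ℝ} (hα : 0 < α) (ht : t ∈ Ioo 0 T) :
    Real.exp (α * t) ≤ Real.exp (α * T) :=
  Real.exp_le_exp.2 (mul_le_mul_of_nonneg_left ht.2.le hα.le)

theorem memLp_top_synthSobolev_evol {L ν α β : ℝ} (hL : 0 < L) (hν : 0 < ν) (hα : 0 < α)
    (hβ : 0 < β) (N : ℕ) {m : ℕ} {a : ℕ → ℝ}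
    (ha : Summable fun j => a j ^ 2 * sineWeight L m j) (T : ℝ) :
    MemLp (fun t => synthSobolev hL β N m (evol L ν α β N a t)) ∞ (volume.restrict (Ioo 0 T)) := by
  have hmeas := (aestronglyMeasurable_synthSobolev_evol hL ν α β N m a
    fun t ht => summable_evol hν hβ N ha ht.le).mono_measure
      (Measure.restrict_mono (μ := volume) (ν := volume) (s := Ioo 0 T) (fun t ht => ht.1) le_rfl)
  refine memLp_top_of_bound hmeas (Real.exp (α * T) * (‖∑' j, a j • sineSobolev hL m j‖
      + ∑ i : Fin N, |a i| * ‖corrSobolev hL β m i‖)) ?_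
  filter_upwards [ae_restrict_mem measurableSet_Ioo] with t ht
  refine (norm_synthSobolev_le hL β N (Real.exp_pos _).le ha
    (abs_evol_le hν hβ N a ht.1.le)).trans ?_
  have := exp_le_of_mem_Ioo hα ht
  gcongr

/-- The solution of the closed-loop problem with initial coefficients `a`. -/
def solution (L ν α β : ℝ) (N : ℕ) (a : ℕ → ℝ) (t : ℝ) : L2 L :=
  synth L β N (evol L ν α β N a t)

theorem memLp_two_solution {L ν α β : ℝ} (hL : 0 < L) (hν : 0 < ν) (hα : 0 < α)
    (hβ : 0 < β) (N : ℕ) {a : ℕ → ℝ}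
    (ha : Summable fun j => a j ^ 2 * sineWeight L 0 j) (T : ℝ) :
    MemLp (solution L ν α β N a) 2 (volume.restrict (Ioo 0 T)) := by
  have h1 := (memLp_top_synthSobolev_evol hL hν hα hβ N ha T).mono_exponent (p := 2) le_top
  have h2 := (sobolevToL2 L 0).comp_memLp' h1
  refine (memLp_congr_ae ?_).1 h2
  filter_upwards [ae_restrict_mem measurableSet_Ioo] with t ht
  exact toL2_synthSobolev hL β N (summable_evol hν hβ N ha ht.1.le)

theorem exists_norm_contL2_le {L : ℝ} (h : ℝ → ℝ → ℝ) (hc : Continuous (Function.uncurry h))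
    (R : ℝ) : ∃ C : ℝ, ∀ t ∈ Icc 0 R,
      ‖contL2 L (hc.comp (Continuous.prodMk_right t))‖ ≤ C := by
  obtain ⟨C, hC⟩ := ((isCompact_Icc (a := (0 : ℝ)) (b := R)).prod
    (isCompact_Icc (a := (0 : ℝ)) (b := L))).exists_bound_of_continuousOn hc.continuousOn
  refine ⟨(intervalMeasure L).real univ ^ (2 : ℝ≥0∞).toReal⁻¹ * max C 0, fun t ht => ?_⟩
  refine Lp.norm_le_of_ae_bound (le_max_right _ _) ?_
  filter_upwards [coeFn_contL2 (L := L) (hc.comp (Continuous.prodMk_right t)),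
    ae_restrict_mem measurableSet_Ioo] with x hx hm
  rw [hx]
  exact (hC (t, x) ⟨ht, Ioo_subset_Icc_self hm⟩).trans (le_max_left _ _)

theorem inner_contL2_modeL2 {L : ℝ} (hL : 0 < L) (β : ℝ) (N j : ℕ) {f : ℝ → ℝ}
    (hf : Continuous f) :
    inner ℝ (contL2 L hf) (modeL2 L β N j) = ∫ x in (0 : ℝ)..L, modeFun L β N j 0 x * f x := by
  rw [modeL2, inner_contL2_contL2, pairing_comm, pairing, setIntegral_Ioo_eq hL]

theorem integral_mul_eq_inner_contL2 {L : ℝ} {f : ℝ → ℝ} (hf : Continuous f) (u : L2 L) :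
    ∫ x in Ioo 0 L, u x * f x = inner ℝ (contL2 L hf) u := by
  rw [inner_contL2, pairing_comm, pairing]

/-- The finite sums satisfy the identity exactly, by linearity from `mode_weak`. The passage to the
limit uses bounds uniform in n and in t ∈ [0, R], and the continuity of the feedback on L². -/
theorem solution_weak {L ν α β : ℝ} (hL : 0 < L) (hν : 0 < ν) (hα : 0 < α) (hβ : 0 < β) {N : ℕ}
    (hadm : Admissible L (kernel 1 β) N) {a : ℕ → ℝ}
    (ha : Summable fun j => a j ^ 2 * sineWeight L 0 j)
    {φ : ℝ → ℝ → ℝ} (h : ContDiff ℝ ∞ (Function.uncurry φ)) {R : ℝ} (hR0 : 0 ≤ R)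
    (hR : ∀ t x, R ≤ t → φ t x = 0)
    (hbd : ∀ t : ℝ, φ t 0 = 0 ∧ φ t L = 0) :
    (∫ t in (0 : ℝ)..R, ∫ x in Ioo 0 L, solution L ν α β N a t x * adjointOp ν α φ t x)
      + (∫ x in Ioo 0 L, synth L β N a x * φ 0 x)
      - ν * ∫ t in (0 : ℝ)..R,
          feedbackCLM L β N (solution L ν α β N a t) * deriv (φ t) L = 0 := by
  have hc := continuous_adjointOp ν α h
  have hct : ∀ t, Continuous (adjointOp ν α φ t) := fun t => hc.comp (Continuous.prodMk_right t)
  have hc0 : Continuous (φ 0) := h.continuous.comp (Continuous.prodMk_right 0)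
  have cφ : Continuous fun t => deriv (φ t) L :=
    (contDiff_deriv_snd h).continuous.comp (Continuous.prodMk_left L)
  obtain ⟨K, hK0, hK⟩ := exists_norm_sum_modeL2_le hL β N ha
  obtain ⟨C, hC⟩ := exists_norm_contL2_le (L := L) _ hc R
  have hCφ := (isCompact_Icc (a := (0 : ℝ)) (b := R)).exists_bound_of_continuousOn cφ.continuousOn
  obtain ⟨Cφ, hCφ⟩ := hCφ
  have hC0 : 0 ≤ C := (norm_nonneg _).trans (hC 0 ⟨le_rfl, hR0⟩)
  have hCφ0 : 0 ≤ Cφ := (norm_nonneg _).trans (hCφ 0 ⟨le_rfl, hR0⟩)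
  set U : ℕ → ℝ → L2 L := fun n t =>
    ∑ j ∈ Finset.range n, evol L ν α β N a t j • modeL2 L β N j with hU
  have hUlim : ∀ t, 0 ≤ t → Filter.Tendsto (fun n => U n t) Filter.atTop
      (nhds (solution L ν α β N a t)) := fun t ht =>
    (hasSum_synth_of_sq hL (summable_evol hν hβ N ha ht)).tendsto_sum_nat
  have hUbound : ∀ n t, t ∈ Icc 0 R → ‖U n t‖ ≤ Real.exp (α * R) * K := fun n t ht =>
    hK _ _ n (Real.exp_pos _).le fun j => (abs_evol_le hν hβ N a ht.1 j).trans
      (mul_le_mul_of_nonneg_right (Real.exp_le_exp.2 (mul_le_mul_of_nonneg_left ht.2 hα.le))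
        (abs_nonneg _))
  have hmem : ∀ t ∈ uIoc 0 R, t ∈ Icc 0 R := fun t ht => by
    rw [uIoc_of_le hR0] at ht; exact Ioc_subset_Icc_self ht
  have hAU : ∀ n t, inner ℝ (contL2 L (hct t)) (U n t) = ∑ j ∈ Finset.range n,
      evol L ν α β N a t j * ∫ x in (0 : ℝ)..L, modeFun L β N j 0 x * adjointOp ν α φ t x := by
    intro n t
    rw [hU, inner_sum]
    refine Finset.sum_congr rfl fun j _ => ?_
    rw [inner_smul_right, inner_contL2_modeL2 hL]
  have hBU : ∀ n t, feedbackCLM L β N (U n t) * deriv (φ t) L = ∑ j ∈ Finset.range n,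
      evol L ν α β N a t j * (modeFun L β N j 0 L * deriv (φ t) L) := by
    intro n t
    rw [hU, map_sum, Finset.sum_mul]
    refine Finset.sum_congr rfl fun j _ => ?_
    rw [map_smul, feedbackCLM_modeL2 hL hβ hadm, smul_eq_mul, mul_assoc]
  have cA : ∀ j, Continuous fun t => evol L ν α β N a t j *
      ∫ x in (0 : ℝ)..L, modeFun L β N j 0 x * adjointOp ν α φ t x := fun j =>
    (continuous_evol _ _ _ _ _ _ _).mul (continuous_integral_mul (continuous_modeFun _ _ _ _ _) hc)
  have cB : ∀ j, Continuous fun t => evol L ν α β N a t j *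
      (modeFun L β N j 0 L * deriv (φ t) L) := fun j =>
    (continuous_evol _ _ _ _ _ _ _).mul (continuous_const.mul cφ)
  have limA : Filter.Tendsto (fun n => ∫ t in (0 : ℝ)..R, inner ℝ (contL2 L (hct t)) (U n t))
      Filter.atTop (nhds (∫ t in (0 : ℝ)..R,
        inner ℝ (contL2 L (hct t)) (solution L ν α β N a t))) := by
    refine intervalIntegral.tendsto_integral_filter_of_dominated_convergence
      (fun _ => C * (Real.exp (α * R) * K)) ?_ ?_ ?_ ?_
    · refine .of_forall fun n => Continuous.aestronglyMeasurable ?_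
      simp only [hAU]
      exact continuous_finsetSum _ fun j _ => cA j
    · refine .of_forall fun n => .of_forall fun t ht => ?_
      refine (norm_inner_le_norm _ _).trans ?_
      exact mul_le_mul (hC t (hmem t ht)) (hUbound n t (hmem t ht)) (norm_nonneg _) hC0
    · exact intervalIntegrable_const
    · exact .of_forall fun t ht => (hUlim t (hmem t ht).1).inner tendsto_const_nhds |>.congr
        (fun n => real_inner_comm _ _) |>.trans (by rw [real_inner_comm])
  have limB : Filter.Tendsto (fun n => ∫ t in (0 : ℝ)..R,
      feedbackCLM L β N (U n t) * deriv (φ t) L)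
      Filter.atTop (nhds (∫ t in (0 : ℝ)..R,
        feedbackCLM L β N (solution L ν α β N a t) * deriv (φ t) L)) := by
    refine intervalIntegral.tendsto_integral_filter_of_dominated_convergence
      (fun _ => ‖feedbackCLM L β N‖ * (Real.exp (α * R) * K) * Cφ) ?_ ?_ ?_ ?_
    · refine .of_forall fun n => Continuous.aestronglyMeasurable ?_
      simp only [hBU]
      exact continuous_finsetSum _ fun j _ => cB j
    · refine .of_forall fun n => .of_forall fun t ht => ?_
      rw [norm_mul]
      have h1 := (feedbackCLM L β N).le_opNorm (U n t)
      have h2 := hUbound n t (hmem t ht)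
      have h3 := hCφ t (hmem t ht)
      refine mul_le_mul (h1.trans ?_) h3 (norm_nonneg _) (by positivity)
      gcongr
    · exact intervalIntegrable_const
    · exact .of_forall fun t ht =>
        (((feedbackCLM L β N).continuous.tendsto _).comp (hUlim t (hmem t ht).1)).mul_const _
  have lim0 : Filter.Tendsto (fun n => ∑ j ∈ Finset.range n,
      a j * ∫ x in (0 : ℝ)..L, modeFun L β N j 0 x * φ 0 x) Filter.atTop
      (nhds (inner ℝ (contL2 L hc0) (synth L β N a))) := by
    have := ((innerSL ℝ (contL2 L hc0)).hasSum
      (hasSum_synth_of_sq (β := β) (N := N) hL ha)).tendsto_sum_nat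
    refine this.congr fun n => Finset.sum_congr rfl fun j _ => ?_
    rw [map_smul, innerSL_apply_apply, inner_contL2_modeL2 hL, smul_eq_mul]
  have hzero : ∀ n, (∫ t in (0 : ℝ)..R, inner ℝ (contL2 L (hct t)) (U n t))
      + (∑ j ∈ Finset.range n, a j * ∫ x in (0 : ℝ)..L, modeFun L β N j 0 x * φ 0 x)
      - ν * (∫ t in (0 : ℝ)..R, feedbackCLM L β N (U n t) * deriv (φ t) L) = 0 := by
    intro n
    simp only [hAU, hBU]
    rw [intervalIntegral.integral_finsetSum fun j _ => (cA j).intervalIntegrable _ _,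
      intervalIntegral.integral_finsetSum fun j _ => (cB j).intervalIntegrable _ _,
      Finset.mul_sum, ← Finset.sum_add_distrib, ← Finset.sum_sub_distrib]
    refine Finset.sum_eq_zero fun j _ => ?_
    have hm := mode_weak (ν := ν) (α := α) (N := N) (j := j) hL hβ h hR hbd
    have e : ∀ (t y : ℝ), evol L ν α β N a t j * y
        = a j * (Real.exp (-(ν * modeSq L β N j - α) * t) * y) := by
      intro t y; rw [evol, modeRate]; ring
    simp only [e, intervalIntegral.integral_const_mul]
    linear_combination (a j) * hm
  have hlim := (limA.add lim0).sub (limB.const_mul ν)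
  simp only [hzero] at hlim
  have hfin := tendsto_nhds_unique hlim tendsto_const_nhds
  rw [integral_mul_eq_inner_contL2 hc0]
  simp only [integral_mul_eq_inner_contL2 (hct _)]
  exact hfin

/-! ### Uniqueness -/

theorem contDiff_integral {f : ℝ → ℝ} (hf : ContDiff ℝ ∞ f) (R : ℝ) :
    ContDiff ℝ ∞ fun t => ∫ s in R..t, f s := by
  have hd : ∀ t, HasDerivAt (fun t => ∫ s in R..t, f s) (f t) t := fun t =>
    intervalIntegral.integral_hasDerivAt_right (hf.continuous.intervalIntegrable _ _)
      hf.continuous.stronglyMeasurable.stronglyMeasurableAtFilter hf.continuous.continuousAt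
  rw [contDiff_infty_iff_deriv]
  refine ⟨fun t => (hd t).differentiableAt, ?_⟩
  rwa [show deriv (fun t => ∫ s in R..t, f s) = f from funext fun t => (hd t).deriv]

/-- Uniqueness for the weak form of a scalar linear differential equation. -/
theorem ae_eq_zero_of_weak_ode {z : ℝ → ℝ} {κ : ℝ} (hz : LocallyIntegrableOn z (Ioi 0))
    (h : ∀ χ : ℝ → ℝ, ContDiff ℝ ∞ χ → (∃ R, ∀ t, R ≤ t → χ t = 0) →
      ∫ t in Ioi (0 : ℝ), (deriv χ t - κ * χ t) * z t = 0) :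
    ∀ᵐ t ∂volume.restrict (Ioi (0 : ℝ)), z t = 0 := by
  refine ae_eq_zero_of_forall_test isOpen_Ioi hz fun f hf hc _ => ?_
  obtain ⟨R, hR⟩ := hc.isCompact.bddAbove
  have hfR : ∀ t, R < t → f t = 0 := fun t ht =>
    image_eq_zero_of_notMem_tsupport fun hm => not_lt.2 (hR hm) ht
  have hg : ContDiff ℝ ∞ fun s => Real.exp (-κ * s) * f s :=
    (Real.contDiff_exp.comp (contDiff_const.mul contDiff_id)).mul hf
  -- The test function exp(κt) η(t) solves χ' - κχ = f. Integrating from R, beyond the support of f,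
  -- makes it vanish for t ≥ R.
  set η : ℝ → ℝ := fun t => ∫ s in R..t, Real.exp (-κ * s) * f s with hη
  have hηd : ∀ t, HasDerivAt η (Real.exp (-κ * t) * f t) t := fun t =>
    intervalIntegral.integral_hasDerivAt_right (hg.continuous.intervalIntegrable _ _)
      hg.continuous.stronglyMeasurable.stronglyMeasurableAtFilter hg.continuous.continuousAt
  have hχ : ContDiff ℝ ∞ fun t => Real.exp (κ * t) * η t :=
    (Real.contDiff_exp.comp (contDiff_const.mul contDiff_id)).mul (contDiff_integral hg R)
  have hη0 : ∀ t, R ≤ t → η t = 0 := by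
    intro t ht
    refine intervalIntegral.integral_zero_ae (.of_forall fun s hs => ?_)
    rw [uIoc_of_le ht] at hs
    rw [hfR s hs.1, mul_zero]
  have := h _ hχ ⟨R, fun t ht => by rw [hη0 t ht, mul_zero]⟩
  refine Eq.trans ?_ this
  refine integral_congr_ae (.of_forall fun t => ?_)
  have h1 : HasDerivAt (fun t => Real.exp (κ * t)) (Real.exp (κ * t) * κ) t := by
    simpa using ((hasDerivAt_id t).const_mul κ).exp
  have h2 : deriv (fun t => Real.exp (κ * t) * η t) t = _ := (h1.mul (hηd t)).deriv
  have h3 : Real.exp (κ * t) * Real.exp (-κ * t) = 1 := by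
    rw [← Real.exp_add]; simp
  simp only [h2]
  linear_combination (-(f t * z t)) * h3

theorem integrable_mul_clm {L : ℝ} {v : ℝ → L2 L}
    (hv : ∀ T : ℝ, 0 < T → MemLp v 2 (volume.restrict (Ioo 0 T))) (Λ : L2 L →L[ℝ] ℝ)
    {χ : ℝ → ℝ} (hχ : Continuous χ) {R : ℝ} (hR : ∀ t, R < t → χ t = 0) :
    Integrable (fun t => χ t * Λ (v t)) (volume.restrict (Ioi 0)) := by
  -- Any positive time beyond R would do: χ vanishes from T on.
  set T := max R 0 + 1 with hT
  have hT0 : 0 < T := by positivity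
  have h1 : Integrable (fun t => Λ (v t)) (volume.restrict (Ioo 0 T)) :=
    (Λ.comp_memLp' (hv T hT0)).integrable (by norm_num)
  obtain ⟨C, hC⟩ := (isCompact_Icc (a := (0 : ℝ)) (b := T)).exists_bound_of_continuousOn
    hχ.continuousOn
  have h2 : IntegrableOn (fun t => χ t * Λ (v t)) (Ioo 0 T) := by
    refine h1.bdd_mul (c := C) hχ.aestronglyMeasurable ?_
    filter_upwards [ae_restrict_mem measurableSet_Ioo] with t ht
    exact hC t (Ioo_subset_Icc_self ht)
  refine IntegrableOn.of_forall_sdiff_eq_zero h2 measurableSet_Ioi fun t ht => ?_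
  have : T ≤ t := not_lt.1 fun hlt => ht.2 ⟨ht.1, hlt⟩
  rw [hR t (lt_of_lt_of_le (by rw [hT]; linarith [le_max_left R 0]) this), zero_mul]

theorem locallyIntegrableOn_clm {L : ℝ} {v : ℝ → L2 L}
    (hv : ∀ T : ℝ, 0 < T → MemLp v 2 (volume.restrict (Ioo 0 T))) (Λ : L2 L →L[ℝ] ℝ) :
    LocallyIntegrableOn (fun t => Λ (v t)) (Ioi 0) := by
  intro t ht
  refine ⟨Ioo 0 (t + 1), mem_nhdsWithin_of_mem_nhds (Ioo_mem_nhds ht (by linarith)), ?_⟩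
  exact (Λ.comp_memLp' (hv (t + 1) (by linarith [mem_Ioi.1 ht]))).integrable (by norm_num)

/-- The weak form of the closed-loop equation tested with `χ(t) e_{j+1}(x)`. -/
theorem IsWeakSolution.test_sineMode {L ν α β : ℝ} (hL : 0 < L) (hβ : 0 < β) {N : ℕ}
    (hadm : Admissible L (kernel 1 β) N) {u₀ : L2 L} {v : ℝ → L2 L}
    (hv : IsWeakSolution L ν α (kernel 1 β) N u₀ v) (j : ℕ) {χ : ℝ → ℝ} (hχ : ContDiff ℝ ∞ χ)
    (hR : ∃ R, ∀ t, R ≤ t → χ t = 0) :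
    (∫ t in Ioi (0 : ℝ), (deriv χ t + (α - ν * eigenvalue L (j + 1)) * χ t) *
        inner ℝ (sineL2 L j) (v t)
        - ν * sineDeriv L (freq L (j + 1)) 1 L * (χ t * feedbackCLM L β N (v t)))
      = -(χ 0 * inner ℝ (sineL2 L j) u₀) := by
  obtain ⟨R, hR⟩ := hR
  set e := sineDeriv L (freq L (j + 1)) with he
  have hsm : sineMode L (j + 1) = e 0 := sineMode_eq_sineDeriv _ _
  have hw := hv.weak (fun t x => χ t * e 0 x)
    ((hχ.comp contDiff_fst).mul ((contDiff_sineDeriv L _ 0).comp contDiff_snd))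
    ⟨R, fun t x ht => by rw [hR t ht, zero_mul]⟩
    (fun t => ⟨by rw [he, sineDeriv_zero_zero, mul_zero],
      by rw [← hsm, sineMode_right hL, mul_zero]⟩)
  have hdt : ∀ t x, deriv (fun s => χ s * e 0 x) t = deriv χ t * e 0 x := fun t x =>
    (((hχ.differentiable (by simp) t).hasDerivAt).mul_const _).deriv
  have hdx : ∀ t, deriv (fun x => χ t * e 0 x) = fun x => χ t * e 1 x := fun t =>
    funext fun x => ((hasDerivAt_sineDeriv L _ 0 x).const_mul _).deriv
  have hdxx : ∀ t x, iteratedDeriv 2 (fun x => χ t * e 0 x) x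
      = χ t * (-(eigenvalue L (j + 1)) * e 0 x) := by
    intro t x
    rw [iteratedDeriv_two, hdx, ((hasDerivAt_sineDeriv L _ 1 x).const_mul _).deriv,
      sineDeriv_add_two L _ 0, freq_sq]
  simp only [hdt, hdxx, hdx] at hw
  have hin : ∀ (c : ℝ) (f : L2 L), ∫ x in Ioo 0 L, f x * (c * e 0 x)
      = c * inner ℝ (sineL2 L j) f := by
    intro c f
    rw [inner_sineL2, pairing, ← integral_const_mul, hsm]
    exact integral_congr_ae (.of_forall fun x => by ring)
  have h1 : ∀ t x, v t x * (deriv χ t * e 0 x + ν * (χ t * (-eigenvalue L (j + 1) * e 0 x))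
      + α * (χ t * e 0 x))
      = v t x * ((deriv χ t + (α - ν * eigenvalue L (j + 1)) * χ t) * e 0 x) := by
    intro t x; ring
  simp only [h1, hin, feedback_eq_feedbackCLM hL hβ hadm] at hw
  have hdχ : Continuous (deriv χ) := hχ.continuous_deriv (by simp)
  have hdχR : ∀ t, R < t → deriv χ t = 0 := by
    intro t ht
    have : χ =ᶠ[nhds t] fun _ => 0 := by
      filter_upwards [Ioi_mem_nhds ht] with s hs
      exact hR s (le_of_lt hs)
    rw [this.deriv_eq, deriv_const]
  have i1 := integrable_mul_clm hv.memLp (innerSL ℝ (sineL2 L j))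
    (χ := fun t => deriv χ t + (α - ν * eigenvalue L (j + 1)) * χ t) (R := R)
    (hdχ.add (continuous_const.mul hχ.continuous))
    (fun t ht => by rw [hdχR t ht, hR t ht.le]; ring)
  have i2 := integrable_mul_clm hv.memLp (feedbackCLM L β N) hχ.continuous
    (fun t (ht : R < t) => hR t ht.le)
  have e2 : ∫ t in Ioi (0 : ℝ), feedbackCLM L β N (v t) * (χ t * e 1 L)
      = e 1 L * ∫ t in Ioi (0 : ℝ), χ t * feedbackCLM L β N (v t) := by
    rw [← integral_const_mul]
    exact integral_congr_ae (.of_forall fun t => by ring)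
  rw [e2] at hw
  simp only [innerSL_apply_apply] at i1
  rw [integral_sub i1 (i2.const_mul _), integral_const_mul]
  linarith

/-- Green's identity for e_i and E_l. As e_i vanishes at both ends and E_l at 0, the only boundary
term is e_i'(L) E_l(L). -/
theorem green_modeMatrix {L β : ℝ} (hL : 0 < L) (hβ : 0 < β) {N : ℕ} (i l : Fin N) :
    eigenvalue L (i + 1) * modeMatrix L β N i l
        + sineDeriv L (freq L (i + 1)) 1 L * shiftMode L β (l + 1) 0 L
      = (eigenvalue L (l + 1) + β) * modeMatrix L β N i l := by
  set e := sineDeriv L (freq L (i + 1)) with he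
  have hsm : sineMode L (i + 1) = e 0 := sineMode_eq_sineDeriv _ _
  have hM : modeMatrix L β N i l = ∫ x in (0 : ℝ)..L, e 0 x * shiftMode L β (l + 1) 0 x := by
    rw [← setIntegral_Ioo_eq hL, ← hsm]; rfl
  have hE : ∀ n x, HasDerivAt (shiftMode L β (l + 1) n) (shiftMode L β (l + 1) (n + 1) x) x :=
    fun n x => (hasDerivAt_sineDeriv L _ n x).const_mul _
  have hE2 : ∀ x, shiftMode L β (l + 1) 2 x
      = -(eigenvalue L (l + 1) + β) * shiftMode L β (l + 1) 0 x := by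
    intro x
    simp only [shiftMode]
    rw [sineDeriv_add_two L _ 0, shiftFreq, Real.sq_sqrt (by positivity), freq_sq]
    ring
  have hc : ∀ n, Continuous (e n) := continuous_sineDeriv L _
  have hcE : ∀ n, Continuous (shiftMode L β (l + 1) n) := continuous_shiftMode L β _
  have h1 : ∫ x in (0 : ℝ)..L, e 0 x * shiftMode L β (l + 1) 2 x
      = e 0 L * shiftMode L β (l + 1) 1 L - e 0 0 * shiftMode L β (l + 1) 1 0
        - ∫ x in (0 : ℝ)..L, e 1 x * shiftMode L β (l + 1) 1 x :=
    intervalIntegral.integral_mul_deriv_eq_deriv_mul (fun x _ => hasDerivAt_sineDeriv L _ 0 x)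
      (fun x _ => hE 1 x) ((hc 1).intervalIntegrable _ _) ((hcE 2).intervalIntegrable _ _)
  have h2 : ∫ x in (0 : ℝ)..L, e 1 x * shiftMode L β (l + 1) 1 x
      = e 1 L * shiftMode L β (l + 1) 0 L - e 1 0 * shiftMode L β (l + 1) 0 0
        - ∫ x in (0 : ℝ)..L, e 2 x * shiftMode L β (l + 1) 0 x :=
    intervalIntegral.integral_mul_deriv_eq_deriv_mul (fun x _ => hasDerivAt_sineDeriv L _ 1 x)
      (fun x _ => hE 0 x) ((hc 2).intervalIntegrable _ _) ((hcE 1).intervalIntegrable _ _)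
  have z1 : e 0 L = 0 := by rw [← hsm, sineMode_right hL]
  have z2 : e 0 0 = 0 := sineDeriv_zero_zero _ _
  have z3 : shiftMode L β (l + 1) 0 0 = 0 := by simp [shiftMode, sineDeriv_zero_zero]
  have h3 : ∫ x in (0 : ℝ)..L, e 0 x * shiftMode L β (l + 1) 2 x
      = -(eigenvalue L (l + 1) + β) * modeMatrix L β N i l := by
    rw [hM, ← intervalIntegral.integral_const_mul]
    refine intervalIntegral.integral_congr fun x _ => ?_
    simp only [hE2]; ring
  have h4 : ∫ x in (0 : ℝ)..L, e 2 x * shiftMode L β (l + 1) 0 x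
      = -eigenvalue L (i + 1) * modeMatrix L β N i l := by
    rw [hM, ← intervalIntegral.integral_const_mul]
    refine intervalIntegral.integral_congr fun x _ => ?_
    simp only [he]
    rw [sineDeriv_add_two L _ 0, freq_sq]; ring
  rw [h3, h2, h4, z1, z2, z3] at h1
  linarith

/-- The first N sine coefficients evolve by a closed N × N system, because the feedback depends on
them alone. By Green's identity the columns of M are eigenvectors of its matrix, so multiplication
by M⁻¹ decouples it. -/
theorem coefCLM_diagonalizes {L ν α β : ℝ} (hL : 0 < L) (hβ : 0 < β) {N : ℕ}
    (hadm : Admissible L (kernel 1 β) N) (f : L2 L) (k : Fin N) :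
    ∑ i : Fin N, (modeMatrix L β N)⁻¹ k i * ((α - ν * eigenvalue L (i + 1)) *
        inner ℝ (sineL2 L i) f - ν * sineDeriv L (freq L (i + 1)) 1 L * feedbackCLM L β N f)
      = -(ν * (eigenvalue L (k + 1) + β) - α) * coefCLM L β N k f := by
  have h1 : ∀ i : Fin N, (α - ν * eigenvalue L (i + 1)) *
        inner ℝ (sineL2 L i) f - ν * sineDeriv L (freq L (i + 1)) 1 L * feedbackCLM L β N f
      = ∑ l : Fin N, modeMatrix L β N i l *
          (-(ν * (eigenvalue L (l + 1) + β) - α) * coefCLM L β N l f) := by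
    intro i
    rw [← modeMatrix_mulVec_coefCLM hL hβ hadm f i, feedbackCLM_apply, Finset.mul_sum,
      Finset.mul_sum, ← Finset.sum_sub_distrib]
    refine Finset.sum_congr rfl fun l _ => ?_
    linear_combination (-(ν * coefCLM L β N l f)) * green_modeMatrix hL hβ i l
  simp only [h1]
  have h2 := Matrix.mulVec_mulVec
    (fun l : Fin N => -(ν * (eigenvalue L (l + 1) + β) - α) * coefCLM L β N l f)
    (modeMatrix L β N)⁻¹ (modeMatrix L β N)
  rw [Matrix.nonsing_inv_mul _ (isUnit_det_modeMatrix hL hβ hadm), Matrix.one_mulVec] at h2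
  exact congrFun h2 k

theorem IsWeakSolution.ae_eq {L ν α β : ℝ} (hL : 0 < L) (hβ : 0 < β) {N : ℕ}
    (hadm : Admissible L (kernel 1 β) N) {u₀ : L2 L} {v u : ℝ → L2 L}
    (hv : IsWeakSolution L ν α (kernel 1 β) N u₀ v)
    (hu : IsWeakSolution L ν α (kernel 1 β) N u₀ u) :
    ∀ᵐ t ∂volume.restrict (Ioi (0 : ℝ)), v t = u t := by
  set d : ℝ → L2 L := fun t => v t - u t with hd
  have hdm : ∀ T : ℝ, 0 < T → MemLp d 2 (volume.restrict (Ioo 0 T)) := fun T hT =>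
    (hv.memLp T hT).sub (hu.memLp T hT)
  have hdχR : ∀ (χ : ℝ → ℝ) (R : ℝ), (∀ t, R ≤ t → χ t = 0) → ∀ t, R < t → deriv χ t = 0 := by
    intro χ R hR t ht
    have : χ =ᶠ[nhds t] fun _ => 0 := by
      filter_upwards [Ioi_mem_nhds ht] with s hs
      exact hR s (le_of_lt hs)
    rw [this.deriv_eq, deriv_const]
  have hint : ∀ (w : ℝ → L2 L), (∀ T : ℝ, 0 < T → MemLp w 2 (volume.restrict (Ioo 0 T))) →
      ∀ (j : ℕ) (χ : ℝ → ℝ), ContDiff ℝ ∞ χ → (∃ R, ∀ t, R ≤ t → χ t = 0) →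
      Integrable (fun t => (deriv χ t + (α - ν * eigenvalue L (j + 1)) * χ t) *
        inner ℝ (sineL2 L j) (w t)
        - ν * sineDeriv L (freq L (j + 1)) 1 L * (χ t * feedbackCLM L β N (w t)))
        (volume.restrict (Ioi 0)) := by
    rintro w hw j χ hχ ⟨R, hR⟩
    refine Integrable.sub ?_ (Integrable.const_mul ?_ _)
    · exact integrable_mul_clm hw (innerSL ℝ (sineL2 L j))
        (χ := fun t => deriv χ t + (α - ν * eigenvalue L (j + 1)) * χ t) (R := R)
        ((hχ.continuous_deriv (by simp)).add (continuous_const.mul hχ.continuous))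
        (fun t ht => by rw [hdχR χ R hR t ht, hR t ht.le]; ring)
    · exact integrable_mul_clm hw (feedbackCLM L β N) hχ.continuous
        (fun t (ht : R < t) => hR t ht.le)
  have hI : ∀ (j : ℕ) (χ : ℝ → ℝ), ContDiff ℝ ∞ χ → (∃ R, ∀ t, R ≤ t → χ t = 0) →
      (∫ t in Ioi (0 : ℝ), (deriv χ t + (α - ν * eigenvalue L (j + 1)) * χ t) *
        inner ℝ (sineL2 L j) (d t)
        - ν * sineDeriv L (freq L (j + 1)) 1 L * (χ t * feedbackCLM L β N (d t))) = 0 := by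
    intro j χ hχ hR
    have h1 := hv.test_sineMode hL hβ hadm j hχ hR
    have h2 := hu.test_sineMode hL hβ hadm j hχ hR
    refine Eq.trans ?_ (sub_eq_zero.2 (h1.trans h2.symm))
    rw [← integral_sub (hint v hv.memLp j χ hχ hR) (hint u hu.memLp j χ hχ hR)]
    refine integral_congr_ae (.of_forall fun t => ?_)
    simp only [hd, inner_sub_right, map_sub]
    ring
  -- Combining the first N tested equations with row k of M⁻¹ leaves a scalar equation for the k-th
  -- mode coefficient of the difference.
  have hz : ∀ k : Fin N, ∀ᵐ t ∂volume.restrict (Ioi (0 : ℝ)), coefCLM L β N k (d t) = 0 := by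
    intro k
    refine ae_eq_zero_of_weak_ode (κ := ν * (eigenvalue L (k + 1) + β) - α)
      (locallyIntegrableOn_clm hdm _) fun χ hχ hR => ?_
    have h1 : ∑ i : Fin N, (modeMatrix L β N)⁻¹ k i *
        (∫ t in Ioi (0 : ℝ), (deriv χ t + (α - ν * eigenvalue L (i + 1)) * χ t) *
        inner ℝ (sineL2 L i) (d t)
        - ν * sineDeriv L (freq L (i + 1)) 1 L * (χ t * feedbackCLM L β N (d t))) = 0 :=
      Finset.sum_eq_zero fun i _ => by rw [hI i χ hχ hR, mul_zero]
    simp only [← integral_const_mul] at h1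
    rw [← integral_finsetSum _ fun (i : Fin N) _ => (hint d hdm i χ hχ hR).const_mul _] at h1
    refine Eq.trans ?_ h1
    refine integral_congr_ae (.of_forall fun t => ?_)
    have h2 := coefCLM_diagonalizes (ν := ν) (α := α) hL hβ hadm (d t) k
    have h3 : coefCLM L β N k (d t)
        = ∑ i : Fin N, (modeMatrix L β N)⁻¹ k i * inner ℝ (sineL2 L i) (d t) := by
      simp [coefCLM]
    calc (deriv χ t - (ν * (eigenvalue L (k + 1) + β) - α) * χ t) * coefCLM L β N k (d t)
        = deriv χ t * coefCLM L β N k (d t)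
          + χ t * (-(ν * (eigenvalue L (k + 1) + β) - α) * coefCLM L β N k (d t)) := by ring
      _ = _ := by
        rw [← h2, h3, Finset.mul_sum, Finset.mul_sum, ← Finset.sum_add_distrib]
        refine Finset.sum_congr rfl fun i _ => ?_
        ring
  rw [← ae_all_iff] at hz
  -- Once these coefficients vanish there is no boundary input left, and each sine coefficient
  -- satisfies its own scalar equation.
  have hj : ∀ j : ℕ, ∀ᵐ t ∂volume.restrict (Ioi (0 : ℝ)), inner ℝ (sineL2 L j) (d t) = 0 := by
    intro j
    refine ae_eq_zero_of_weak_ode (κ := ν * eigenvalue L (j + 1) - α)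
      (locallyIntegrableOn_clm hdm (innerSL ℝ (sineL2 L j))) fun χ hχ hR => ?_
    refine Eq.trans ?_ (hI j χ hχ hR)
    refine integral_congr_ae ?_
    filter_upwards [hz] with t ht
    have : feedbackCLM L β N (d t) = 0 := by simp [feedbackCLM_apply, ht]
    rw [this]
    ring
  rw [← ae_all_iff] at hj
  filter_upwards [hj] with t ht
  rw [← sub_eq_zero]
  refine eq_zero_of_pairing_sineMode hL _ fun j => ?_
  rw [← inner_sineL2]
  exact ht j

/-! ### Smoothing -/

theorem exp_modeRate_le {L ν α β : ℝ} (hν : 0 < ν) (hβ : 0 < β) (N : ℕ) {t : ℝ}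
    (ht : 0 ≤ t) (j : ℕ) :
    Real.exp (-modeRate L ν α β N j * t) ^ 2
      ≤ Real.exp (2 * α * t) * Real.exp (-(2 * ν * eigenvalue L (j + 1)) * t) := by
  rw [← Real.exp_nat_mul, ← Real.exp_add]
  refine Real.exp_le_exp.2 ?_
  have h1 := mul_le_mul_of_nonneg_left (modeSq_ge (L := L) hβ N j) hν.le
  have h2 := mul_le_mul_of_nonneg_right h1 ht
  unfold modeRate
  push_cast
  nlinarith

theorem evol_sq_mul_sineWeight_le {L ν α β : ℝ} (hν : 0 < ν) (hβ : 0 < β) (N m : ℕ)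
    (a : ℕ → ℝ) {t : ℝ} (ht : 0 ≤ t) (j : ℕ) :
    evol L ν α β N a t j ^ 2 * sineWeight L (1 + m) j
      ≤ Real.exp (2 * α * t) * Real.exp (-(2 * ν * eigenvalue L (j + 1)) * t) *
        ((1 + eigenvalue L (j + 1)) * (a j ^ 2 * sineWeight L m j)) := by
  have h1 := exp_modeRate_le (L := L) (α := α) hν hβ N ht j
  have h2 := sineWeight_succ_le L m j
  have h0 : 0 ≤ eigenvalue L (j + 1) := by unfold eigenvalue; positivity
  rw [add_comm 1 m, evol, mul_pow]
  calc _ ≤ Real.exp (2 * α * t) * Real.exp (-(2 * ν * eigenvalue L (j + 1)) * t) * a j ^ 2 *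
        ((1 + eigenvalue L (j + 1)) * sineWeight L m j) := by
        gcongr
        exact sineWeight_nonneg _ _ _
    _ = _ := by ring

theorem exp_neg_le_inv {y : ℝ} (hy : 0 ≤ y) : Real.exp (-y) ≤ 1 / (1 + y) := by
  rw [Real.exp_neg, ← one_div]
  have := Real.add_one_le_exp y
  exact one_div_le_one_div_of_le (by linarith) (by linarith)

/-- Parabolic smoothing at fixed t > 0: exp(-y) ≤ 1/(1 + y) bounds (1 + λ)exp(-2νλt) by 1 + 1/(2νt),
uniformly in the mode. -/
theorem summable_evol_succ {L ν α β : ℝ} (hν : 0 < ν) (hβ : 0 < β) (N : ℕ) {m : ℕ} {a : ℕ → ℝ}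
    (ha : Summable fun j => a j ^ 2 * sineWeight L m j) {t : ℝ} (ht : 0 < t) :
    Summable fun j => evol L ν α β N a t j ^ 2 * sineWeight L (1 + m) j := by
  refine Summable.of_nonneg_of_le (fun j => mul_nonneg (sq_nonneg _) (sineWeight_nonneg _ _ _))
    (fun j => ?_) (ha.mul_left (Real.exp (2 * α * t) * (1 + 1 / (2 * ν * t))))
  refine (evol_sq_mul_sineWeight_le hν hβ N m a ht.le j).trans ?_
  have h0 : 0 ≤ eigenvalue L (j + 1) := by unfold eigenvalue; positivity
  have h1 : Real.exp (-(2 * ν * eigenvalue L (j + 1)) * t) * (1 + eigenvalue L (j + 1))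
      ≤ 1 + 1 / (2 * ν * t) := by
    have h2 := exp_neg_le_inv (y := 2 * ν * eigenvalue L (j + 1) * t) (by positivity)
    rw [← neg_mul] at h2
    calc _ ≤ 1 / (1 + 2 * ν * eigenvalue L (j + 1) * t) * (1 + eigenvalue L (j + 1)) := by gcongr
      _ ≤ _ := by
        rw [div_mul_eq_mul_div, div_le_iff₀ (by positivity)]
        have : (1 + 1 / (2 * ν * t)) * (1 + 2 * ν * eigenvalue L (j + 1) * t)
            = 1 + eigenvalue L (j + 1) + (2 * ν * eigenvalue L (j + 1) * t + 1 / (2 * ν * t)) := by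
          field_simp
          ring
        rw [this, one_mul]
        have : 0 ≤ 2 * ν * eigenvalue L (j + 1) * t + 1 / (2 * ν * t) := by positivity
        linarith
  have h3 : 0 ≤ a j ^ 2 * sineWeight L m j := mul_nonneg (sq_nonneg _) (sineWeight_nonneg _ _ _)
  calc _ = Real.exp (2 * α * t) * (Real.exp (-(2 * ν * eigenvalue L (j + 1)) * t) *
        (1 + eigenvalue L (j + 1))) * (a j ^ 2 * sineWeight L m j) := by ring
    _ ≤ _ := by gcongr

theorem eigenvalue_succ (L : ℝ) (j : ℕ) :
    eigenvalue L (j + 1) = ((j : ℝ) + 1) ^ 2 * eigenvalue L 1 := by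
  unfold eigenvalue; push_cast; ring

theorem eigenvalue_one_le {L : ℝ} (j : ℕ) : eigenvalue L 1 ≤ eigenvalue L (j + 1) := by
  rw [eigenvalue_succ L j]
  have h : 0 ≤ eigenvalue L 1 := by unfold eigenvalue; positivity
  have : (1 : ℝ) ≤ ((j : ℝ) + 1) ^ 2 := by
    have : (0 : ℝ) ≤ j := Nat.cast_nonneg j
    nlinarith
  nlinarith

theorem summable_inv_eigenvalue (L : ℝ) :
    Summable fun j : ℕ => 1 / eigenvalue L (j + 1) := by
  have h1 : Summable fun j : ℕ => 1 / ((j + 1 : ℕ) : ℝ) ^ 2 :=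
    (summable_nat_add_iff 1).2 (Real.summable_one_div_nat_pow.2 one_lt_two)
  refine (h1.mul_right (1 / eigenvalue L 1)).congr fun j => ?_
  rw [eigenvalue_succ L j, one_div_mul_one_div]
  push_cast
  rfl

/-- The product exp(-κ_j t)|a_j| is at most exp(-2κ_j t) + a_j², and the exponentials are summable
by comparison with 1/λ_j. Absolute summability yields uniform convergence in x, as the modes are
uniformly bounded. -/
theorem summable_abs_evol {L ν α β : ℝ} (hL : 0 < L) (hν : 0 < ν) (hβ : 0 < β) (N : ℕ)
    {a : ℕ → ℝ} (ha : Summable fun j => a j ^ 2 * sineWeight L 0 j) {t : ℝ} (ht : 0 < t) :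
    Summable fun j => |evol L ν α β N a t j| := by
  have h1 : Summable fun j => Real.exp (-modeRate L ν α β N j * t) ^ 2 := by
    refine Summable.of_nonneg_of_le (fun j => sq_nonneg _) (fun j => ?_)
      ((summable_inv_eigenvalue L).mul_left (Real.exp (2 * α * t) * (1 / (2 * ν * t))))
    refine (exp_modeRate_le hν hβ N ht.le j).trans ?_
    have h0 := eigenvalue_pos hL j
    have h2 := exp_neg_le_inv (y := 2 * ν * eigenvalue L (j + 1) * t) (by positivity)
    rw [← neg_mul] at h2
    rw [mul_assoc (Real.exp (2 * α * t))]
    refine mul_le_mul_of_nonneg_left (h2.trans ?_) (Real.exp_pos _).le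
    rw [one_div_mul_one_div]
    refine one_div_le_one_div_of_le (by positivity) ?_
    nlinarith
  refine Summable.of_nonneg_of_le (fun j => abs_nonneg _) (fun j => ?_) (h1.add ha)
  have h2 : a j ^ 2 ≤ a j ^ 2 * sineWeight L 0 j :=
    le_mul_of_one_le_right (sq_nonneg _) (one_le_sineWeight _ _ _)
  rw [evol, abs_mul, abs_of_pos (Real.exp_pos _)]
  nlinarith [sq_nonneg (Real.exp (-modeRate L ν α β N j * t) - |a j|), sq_abs (a j),
    sq_nonneg (Real.exp (-modeRate L ν α β N j * t)), sq_nonneg (a j)]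

/-! ### Boundary values -/

theorem abs_modeFun_le {L β : ℝ} (hL : 0 < L) (hβ : 0 < β) (N j : ℕ) (x : ℝ) :
    |modeFun L β N j 0 x| ≤ √(2 / L) := by
  have h1 : ∀ θ, |sineDeriv L θ 0 x| ≤ √(2 / L) := by
    intro θ
    rw [sineDeriv, pow_zero, one_mul, abs_mul, abs_of_nonneg (Real.sqrt_nonneg _)]
    exact mul_le_of_le_one_right (Real.sqrt_nonneg _) (Real.abs_sin_le_one _)
  unfold modeFun
  split_ifs
  · rw [shiftMode, abs_mul]
    refine (mul_le_of_le_one_left (abs_nonneg _) ?_).trans (h1 _)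
    have hf := freq_pos hL (Nat.succ_pos j)
    have hle : freq L (j + 1) ≤ shiftFreq L β (j + 1) :=
      Real.le_sqrt_of_sq_le (by linarith)
    rw [abs_of_nonneg (div_nonneg hf.le (hf.le.trans hle))]
    exact div_le_one_of_le₀ hle (hf.le.trans hle)
  · exact h1 _

theorem coeFn_sum_smul_modeL2 (L β : ℝ) (N : ℕ) (b : ℕ → ℝ) (n : ℕ) :
    (∑ j ∈ Finset.range n, b j • modeL2 L β N j : L2 L) =ᵐ[intervalMeasure L]
      fun x => ∑ j ∈ Finset.range n, b j * modeFun L β N j 0 x := by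
  induction n with
  | zero =>
    simp only [Finset.range_zero, Finset.sum_empty]
    exact Lp.coeFn_zero _ _ _
  | succ n ih =>
    simp only [Finset.sum_range_succ]
    filter_upwards [ih, Lp.coeFn_add (∑ j ∈ Finset.range n, b j • modeL2 L β N j)
      (b n • modeL2 L β N n), Lp.coeFn_smul (b n) (modeL2 L β N n),
      coeFn_contL2 (L := L) (continuous_modeFun L β N n 0)] with x h1 h2 h3 h4
    rw [h2, Pi.add_apply, h1, h3, Pi.smul_apply, modeL2, h4, smul_eq_mul]

/-- The series converges uniformly, so its sum is a continuous representative. Its end values are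
the sums of those of the modes, and at L the continuous feedback functional sums to the same series.
-/
theorem hasBoundaryValues_synth {L β : ℝ} (hL : 0 < L) (hβ : 0 < β) {N : ℕ}
    (hadm : Admissible L (kernel 1 β) N) {b : ℕ → ℝ}
    (hb : Summable fun j => b j ^ 2 * sineWeight L 0 j) (hb1 : Summable fun j => |b j|) :
    HasBoundaryValues L (synth L β N b) 0 (feedbackCLM L β N (synth L β N b)) := by
  have hs := hasSum_synth_of_sq (β := β) (N := N) hL hb
  have hbound : ∀ j x, ‖b j * modeFun L β N j 0 x‖ ≤ |b j| * √(2 / L) := by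
    intro j x
    rw [norm_mul, Real.norm_eq_abs, Real.norm_eq_abs]
    have := abs_modeFun_le hL hβ N j x
    gcongr
  have hsum : ∀ x, Summable fun j => b j * modeFun L β N j 0 x := fun x =>
    Summable.of_norm_bounded (hb1.mul_right _) fun j => hbound j x
  refine ⟨fun x => ∑' j, b j * modeFun L β N j 0 x, ?_, ?_, ?_, ?_⟩
  · exact (continuous_tsum (fun j => continuous_const.mul (continuous_modeFun _ _ _ _ _))
      (hb1.mul_right _) hbound).continuousOn
  -- Convergence in L² gives almost everywhere convergence along a subsequence, which identifies the
  -- pointwise sum with the L² sum.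
  · obtain ⟨ns, hns, hlim⟩ :=
      (tendstoInMeasure_of_tendsto_Lp hs.tendsto_sum_nat).exists_seq_tendsto_ae
    have hall := ae_all_iff.2 fun n => coeFn_sum_smul_modeL2 L β N b n
    filter_upwards [hlim, hall] with x h1 h2
    simp only [h2] at h1
    exact tendsto_nhds_unique h1 ((hsum x).hasSum.tendsto_sum_nat.comp hns.tendsto_atTop)
  · simp [modeFun_zero]
  · have := (feedbackCLM L β N).hasSum hs
    rw [← this.tsum_eq]
    refine tsum_congr fun j => ?_
    rw [map_smul, feedbackCLM_modeL2 hL hβ hadm, smul_eq_mul]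

/-! ### Square integrability in time -/

theorem integral_exp_neg_mul_le {r T : ℝ} (hr : 0 < r) (hT : 0 < T) :
    ∫ t in Ioo 0 T, Real.exp (-r * t) ≤ 1 / r := by
  have hd : ∀ t ∈ uIcc 0 T, HasDerivAt (fun t => -(Real.exp (-r * t) / r))
      (Real.exp (-r * t)) t := by
    intro t _
    have h1 : HasDerivAt (fun t => Real.exp (-r * t)) (Real.exp (-r * t) * -r) t := by
      simpa using ((hasDerivAt_id t).const_mul (-r)).exp
    refine (h1.div_const r).neg.congr_deriv ?_
    field_simp
  rw [setIntegral_Ioo_eq hT, intervalIntegral.integral_eq_sub_of_hasDerivAt hd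
    (Continuous.intervalIntegrable (by fun_prop) _ _)]
  have : 0 ≤ Real.exp (-r * T) / r := by positivity
  simp only [mul_zero, Real.exp_zero]
  linarith

/-- Orthogonality turns the squared norm into a series of nonnegative terms, and Tonelli integrates
it termwise. The time integral of exp(-2νλt) is at most 1/(2νλ), which compensates the factor 1 + λ
of the extra derivative. -/
theorem memLp_two_tsum_evol {L ν α β : ℝ} (hL : 0 < L) (hν : 0 < ν) (hα : 0 < α)
    (hβ : 0 < β) (N : ℕ) {m : ℕ} {a : ℕ → ℝ}
    (ha : Summable fun j => a j ^ 2 * sineWeight L m j) {T : ℝ} (hT : 0 < T)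
    (hmeas : AEStronglyMeasurable
      (fun t => ∑' j, evol L ν α β N a t j • sineSobolev hL (1 + m) j)
      (volume.restrict (Ioo 0 T))) :
    MemLp (fun t => ∑' j, evol L ν α β N a t j • sineSobolev hL (1 + m) j) 2
      (volume.restrict (Ioo 0 T)) := by
  rw [memLp_two_iff_integrable_sq_norm hmeas]
  refine ⟨(hmeas.norm.pow 2), ?_⟩
  rw [hasFiniteIntegral_iff_ofReal (.of_forall fun t => sq_nonneg _)]
  set f : ℕ → ℝ → ℝ := fun j t => evol L ν α β N a t j ^ 2 * sineWeight L (1 + m) j with hf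
  have hf0 : ∀ j t, 0 ≤ f j t := fun j t => mul_nonneg (sq_nonneg _) (sineWeight_nonneg _ _ _)
  have hfc : ∀ j, Continuous (f j) := fun j =>
    ((continuous_evol L ν α β N a j).pow 2).mul continuous_const
  have h1 : ∫⁻ t in Ioo 0 T, ENNReal.ofReal
      (‖∑' j, evol L ν α β N a t j • sineSobolev hL (1 + m) j‖ ^ 2)
      = ∫⁻ t in Ioo 0 T, ∑' j, ENNReal.ofReal (f j t) := by
    refine setLIntegral_congr_fun measurableSet_Ioo fun t ht => ?_
    have hs := summable_evol_succ (α := α) hν hβ N ha ht.1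
    rw [(summable_smul_of_orthogonal (inner_sineSobolev hL (1 + m)) _ hs).2,
      ENNReal.ofReal_tsum_of_nonneg (fun j => hf0 j t) hs]
  rw [h1, lintegral_tsum fun j => ((hfc j).measurable.ennreal_ofReal).aemeasurable]
  -- Here 1 + 1/λ_1 bounds (1 + λ_j)/λ_j for every j.
  set C := Real.exp (2 * α * T) * ((1 + 1 / eigenvalue L 1) / (2 * ν)) with hC
  have hl1 : 0 < eigenvalue L 1 := eigenvalue_pos hL 0
  have h2 : ∀ j, ∫⁻ t in Ioo 0 T, ENNReal.ofReal (f j t)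
      ≤ ENNReal.ofReal (C * (a j ^ 2 * sineWeight L m j)) := by
    intro j
    have hl := eigenvalue_pos hL j
    have hA : 0 ≤ a j ^ 2 * sineWeight L m j :=
      mul_nonneg (sq_nonneg _) (sineWeight_nonneg _ _ _)
    have hint : ∀ g : ℝ → ℝ, Continuous g → Integrable g (volume.restrict (Ioo 0 T)) :=
      fun g hg => (hg.integrableOn_Icc (a := 0) (b := T)).mono_set Ioo_subset_Icc_self
    rw [← ofReal_integral_eq_lintegral_ofReal (hint _ (hfc j)) (.of_forall fun t => hf0 j t)]
    refine ENNReal.ofReal_le_ofReal ?_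
    set D := Real.exp (2 * α * T) * ((1 + eigenvalue L (j + 1)) * (a j ^ 2 * sineWeight L m j))
      with hD
    have h3 : ∫ t in Ioo 0 T, f j t
        ≤ ∫ t in Ioo 0 T, D * Real.exp (-(2 * ν * eigenvalue L (j + 1)) * t) := by
      refine setIntegral_mono_on (hint _ (hfc j)) (hint _ (by fun_prop)) measurableSet_Ioo
        fun t ht => ?_
      refine (evol_sq_mul_sineWeight_le hν hβ N m a ht.1.le j).trans ?_
      have h4 : Real.exp (2 * α * t) ≤ Real.exp (2 * α * T) :=
        Real.exp_le_exp.2 (mul_le_mul_of_nonneg_left ht.2.le (by positivity))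
      calc _ ≤ Real.exp (2 * α * T) * Real.exp (-(2 * ν * eigenvalue L (j + 1)) * t) *
            ((1 + eigenvalue L (j + 1)) * (a j ^ 2 * sineWeight L m j)) := by gcongr
        _ = _ := by rw [hD]; ring
    rw [integral_const_mul] at h3
    have hD0 : 0 ≤ D := by positivity
    have h5 := integral_exp_neg_mul_le (r := 2 * ν * eigenvalue L (j + 1)) (by positivity) hT
    refine h3.trans ((mul_le_mul_of_nonneg_left h5 hD0).trans ?_)
    have h6 : (1 + eigenvalue L (j + 1)) / eigenvalue L (j + 1) ≤ 1 + 1 / eigenvalue L 1 := by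
      rw [add_div, div_self hl.ne', add_comm]
      have := one_div_le_one_div_of_le hl1 (eigenvalue_one_le (L := L) j)
      linarith
    calc D * (1 / (2 * ν * eigenvalue L (j + 1)))
        = Real.exp (2 * α * T) * ((1 + eigenvalue L (j + 1)) / eigenvalue L (j + 1) / (2 * ν)) *
          (a j ^ 2 * sineWeight L m j) := by rw [hD]; field_simp
      _ ≤ _ := by rw [hC]; gcongr
  refine (ENNReal.tsum_le_tsum h2).trans_lt ?_
  exact (ha.mul_left C).tsum_ofReal_lt_top

theorem memLp_two_synthSobolev_evol {L ν α β : ℝ} (hL : 0 < L) (hν : 0 < ν) (hα : 0 < α)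
    (hβ : 0 < β) (N : ℕ) {m : ℕ} {a : ℕ → ℝ}
    (ha : Summable fun j => a j ^ 2 * sineWeight L m j) {T : ℝ} (hT : 0 < T) :
    MemLp (fun t => synthSobolev hL β N (1 + m) (evol L ν α β N a t)) 2
      (volume.restrict (Ioo 0 T)) := by
  have hc : Continuous fun t => ∑ i : Fin N, evol L ν α β N a t i • corrSobolev hL β (1 + m) i :=
    continuous_finsetSum _ fun j _ => (continuous_evol L ν α β N a j).smul continuous_const
  have hmeas := (aestronglyMeasurable_synthSobolev_evol hL ν α β N (1 + m) a
    fun t ht => summable_evol_succ hν hβ N ha ht).mono_measure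
      (Measure.restrict_mono (μ := volume) (ν := volume) (s := Ioo 0 T) (fun t ht => ht.1) le_rfl)
  -- The correction part is continuous in time, so measurability of the sine series follows from
  -- that of the full synthesis.
  have e : (fun t => ∑' j, evol L ν α β N a t j • sineSobolev hL (1 + m) j)
      = fun t => synthSobolev hL β N (1 + m) (evol L ν α β N a t)
        - ∑ i : Fin N, evol L ν α β N a t i • corrSobolev hL β (1 + m) i := by
    ext1 t; rw [synthSobolev]; abel
  have hA := memLp_two_tsum_evol hL hν hα hβ N ha hT (by
    rw [e]; exact hmeas.sub hc.aestronglyMeasurable)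
  obtain ⟨C, hC⟩ := (isCompact_Icc (a := (0 : ℝ)) (b := T)).exists_bound_of_continuousOn
    hc.continuousOn
  have hB : MemLp (fun t => ∑ i : Fin N, evol L ν α β N a t i • corrSobolev hL β (1 + m) i) 2
      (volume.restrict (Ioo 0 T)) := by
    refine MemLp.of_bound hc.aestronglyMeasurable C ?_
    filter_upwards [ae_restrict_mem measurableSet_Ioo] with t ht
    exact hC t (Ioo_subset_Icc_self ht)
  exact hA.add hB

theorem memX_solution {L ν α β : ℝ} (hL : 0 < L) (hν : 0 < ν) (hα : 0 < α)
    (hβ : 0 < β) (N : ℕ) {m : ℕ} {a : ℕ → ℝ}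
    (ha : Summable fun j => a j ^ 2 * sineWeight L m j) {T : ℝ} (hT : 0 < T) :
    MemX L m T (solution L ν α β N a) := by
  refine ⟨⟨_, memLp_top_synthSobolev_evol hL hν hα hβ N ha T, ?_⟩,
    ⟨_, memLp_two_synthSobolev_evol hL hν hα hβ N ha hT, ?_⟩⟩
  · filter_upwards [ae_restrict_mem measurableSet_Ioo] with t ht
    exact toL2_synthSobolev hL β N (summable_evol hν hβ N ha ht.1.le)
  · filter_upwards [ae_restrict_mem measurableSet_Ioo] with t ht
    exact toL2_synthSobolev hL β N (summable_evol_succ hν hβ N ha ht.1)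

/-! ### Initial data -/

/-- The preimage of `u₀` under `I + Υ_k P_N`, as an element of `H^m(0, L)`. -/
def target {L : ℝ} (hL : 0 < L) (β : ℝ) (N : ℕ) {m : ℕ} (u₀ : Sobolev L m) : Sobolev L m :=
  u₀ - ∑ i : Fin N, coefCLM L β N i u₀.toL2 • corrSobolev hL β m i

theorem toL2_target {L : ℝ} (hL : 0 < L) (β : ℝ) (N : ℕ) {m : ℕ} (u₀ : Sobolev L m) :
    (target hL β N u₀).toL2
      = u₀.toL2 - ∑ i : Fin N, coefCLM L β N i u₀.toL2 • corrL2 L β i := by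
  rw [target, ← sobolevToL2_apply, map_sub, map_sum, sobolevToL2_apply]
  congr 1
  refine Finset.sum_congr rfl fun i _ => ?_
  rw [map_smul, sobolevToL2_apply, toL2_corrSobolev]

theorem modeCoef_toL2 {L : ℝ} (hL : 0 < L) (β : ℝ) (N : ℕ) {m : ℕ} (u₀ : Sobolev L m) (j : ℕ) :
    modeCoef L β N u₀.toL2 j = inner ℝ (sineL2 L j) (target hL β N u₀).toL2 := by
  rw [modeCoef, toL2_target]

theorem HasBoundaryValues.sub_smul_contL2 {L : ℝ} {f : L2 L} {a b : ℝ}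
    (hf : HasBoundaryValues L f a b) (c : ℝ) {g : ℝ → ℝ} (hg : Continuous g) :
    HasBoundaryValues L (f - c • contL2 L hg) (a - c * g 0) (b - c * g L) := by
  obtain ⟨F, hF, hfF, h0, h1⟩ := hf
  refine ⟨fun x => F x - c * g x, hF.sub (continuous_const.mul hg).continuousOn, ?_,
    by simp only [h0], by simp only [h1]⟩
  filter_upwards [hfF, Lp.coeFn_sub f (c • contL2 L hg), Lp.coeFn_smul c (contL2 L hg),
    coeFn_contL2 (L := L) hg] with x h2 h3 h4 h5
  rw [h3, Pi.sub_apply, h4, Pi.smul_apply, h5, h2, smul_eq_mul]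

theorem HasBoundaryValues.sub_sum_contL2 {L : ℝ} {f : L2 L} {a b : ℝ}
    (hf : HasBoundaryValues L f a b) {ι : Type*} (s : Finset ι) (c : ι → ℝ) {g : ι → ℝ → ℝ}
    (hg : ∀ i, Continuous (g i)) :
    HasBoundaryValues L (f - ∑ i ∈ s, c i • contL2 L (hg i)) (a - ∑ i ∈ s, c i * g i 0)
      (b - ∑ i ∈ s, c i * g i L) := by
  induction s using Finset.cons_induction with
  | empty => simpa using hf
  | cons i s hi ih =>
    have := ih.sub_smul_contL2 (c i) (hg i)
    simp only [Finset.sum_cons]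
    convert this using 1 <;> abel

/-- For m = 1 the remainder u₀ - Σ c_i(u₀)(E_i - e_i) vanishes at 0, and at L its value is g(P_N u₀)
- Σ c_i(u₀)E_i(L) = 0. The compatibility conditions are what makes its H¹ sine expansion possible.
-/
theorem summable_modeCoef {L β : ℝ} (hL : 0 < L) (hβ : 0 < β) {N : ℕ}
    (hadm : Admissible L (kernel 1 β) N) {m : ℕ} (hm : m = 0 ∨ m = 1) (u₀ : Sobolev L m)
    (hu : m = 1 → HasBoundaryValues L u₀.toL2 0 (feedback L (kernel 1 β) N u₀.toL2)) :
    Summable fun j => modeCoef L β N u₀.toL2 j ^ 2 * sineWeight L m j := by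
  rcases hm with rfl | rfl
  · exact summable_sq_mul_sineWeight_zero hL _
  · simp only [modeCoef_toL2 hL]
    refine summable_sq_mul_sineWeight_one hL _ ?_
    have h := (hu rfl).sub_sum_contL2 Finset.univ (fun i : Fin N => coefCLM L β N i u₀.toL2)
      (fun i => continuous_corr L β (i + 1))
    rw [toL2_target]
    convert h using 1
    · simp only [corrL2]
    · simp [shiftMode, sineDeriv_zero_zero, sineMode_zero]
    · simp only [sineMode_right hL, sub_zero]
      rw [feedback_eq_feedbackCLM hL hβ hadm, feedbackCLM_apply, eq_comm, sub_eq_zero]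
      exact Finset.sum_congr rfl fun i _ => mul_comm _ _

theorem summable_weight_zero {L : ℝ} {m : ℕ} {a : ℕ → ℝ}
    (ha : Summable fun j => a j ^ 2 * sineWeight L m j) :
    Summable fun j => a j ^ 2 * sineWeight L 0 j := by
  refine Summable.of_nonneg_of_le (fun j => mul_nonneg (sq_nonneg _) (sineWeight_nonneg _ _ _))
    (fun j => mul_le_mul_of_nonneg_left ?_ (sq_nonneg _)) ha
  have : sineWeight L 0 j = 1 := by simp [sineWeight]
  rw [this]
  exact one_le_sineWeight L m j

/-! ### Decay -/

/-- The constant in the decay estimate. -/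
def decayConst {L : ℝ} (hL : 0 < L) (β : ℝ) (N m : ℕ) : ℝ :=
  1 + 2 * ∑ i : Fin N, ‖coefCLM L β N i‖ * ‖corrSobolev hL β m i‖

theorem decayConst_nonneg {L : ℝ} (hL : 0 < L) (β : ℝ) (N m : ℕ) : 0 ≤ decayConst hL β N m := by
  unfold decayConst; positivity

/-- All coefficients shrink by exp(-γt). The two copies of S in the constant come from subtracting
the corrections to form the sine part and from adding them back. -/
theorem norm_synthSobolev_evol_le {L ν α β γ : ℝ} (hL : 0 < L) (hβ : 0 < β) {N : ℕ}
    (hadm : Admissible L (kernel 1 β) N) {m : ℕ} (u₀ : Sobolev L m)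
    (hs : Summable fun j => modeCoef L β N u₀.toL2 j ^ 2 * sineWeight L m j)
    (hγ : ∀ j, γ ≤ modeRate L ν α β N j) {t : ℝ} (ht : 0 ≤ t) :
    ‖synthSobolev hL β N m (evol L ν α β N (modeCoef L β N u₀.toL2) t)‖
      ≤ decayConst hL β N m * Real.exp (-γ * t) * ‖u₀‖ := by
  have h1 : ∀ j, |evol L ν α β N (modeCoef L β N u₀.toL2) t j|
      ≤ Real.exp (-γ * t) * |modeCoef L β N u₀.toL2 j| := by
    intro j
    rw [evol, abs_mul, abs_of_pos (Real.exp_pos _)]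
    have : -modeRate L ν α β N j * t ≤ -γ * t :=
      mul_le_mul_of_nonneg_right (neg_le_neg (hγ j)) ht
    gcongr
  refine (norm_synthSobolev_le hL β N (Real.exp_pos _).le hs h1).trans ?_
  have h2 : ∑' j, modeCoef L β N u₀.toL2 j • sineSobolev hL m j = target hL β N u₀ := by
    simp only [modeCoef_toL2 hL] at hs ⊢
    exact (eq_tsum_sineSobolev hL _ hs).symm
  set S := ∑ i : Fin N, ‖coefCLM L β N i‖ * ‖corrSobolev hL β m i‖ with hS
  have h3 : ∀ i : Fin N, |coefCLM L β N i u₀.toL2| ≤ ‖coefCLM L β N i‖ * ‖u₀‖ := fun i =>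
    ((coefCLM L β N i).le_opNorm _).trans
      (mul_le_mul_of_nonneg_left (norm_toL2_le u₀) (norm_nonneg _))
  have h4 : ∑ i : Fin N, |coefCLM L β N i u₀.toL2| * ‖corrSobolev hL β m i‖ ≤ S * ‖u₀‖ := by
    rw [hS, Finset.sum_mul]
    refine Finset.sum_le_sum fun i _ => ?_
    calc _ ≤ ‖coefCLM L β N i‖ * ‖u₀‖ * ‖corrSobolev hL β m i‖ :=
          mul_le_mul_of_nonneg_right (h3 i) (norm_nonneg _)
      _ = _ := by ring
  have h5 : ‖target hL β N u₀‖ ≤ ‖u₀‖ + S * ‖u₀‖ := by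
    refine (norm_sub_le _ _).trans (add_le_add le_rfl (le_trans (norm_sum_le _ _) ?_))
    simpa only [norm_smul, Real.norm_eq_abs] using h4
  simp only [modeCoef_fin hL hβ hadm]
  rw [h2]
  calc _ ≤ Real.exp (-γ * t) * ((‖u₀‖ + S * ‖u₀‖) + S * ‖u₀‖) := by gcongr
    _ = _ := by rw [decayConst, ← hS]; ring

/-- For j < N the shift by μ already exceeds what is claimed. For the other modes λ_{j+1} ≥
(N+1)²λ_1, so the gain over νλ_1 is at least N(N+2)νλ_1; as μ < 2(N+1)νλ_1 and 2 ≤ N + 2, this is at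
least μN/(N+1). -/
theorem decayRate_le_modeRate {L ν α β : ℝ} (hL : 0 < L) (hν : 0 < ν) (hβ : 0 < β) {N : ℕ}
    (hN : 0 < N) (h : ν * β / (2 * ν * eigenvalue L 1) - 1 < N) (j : ℕ) :
    ν * eigenvalue L 1 - α + ν * β * (1 - 1 / ((N : ℝ) + 1)) ≤ modeRate L ν α β N j := by
  have hl : 0 < eigenvalue L 1 := eigenvalue_pos hL 0
  have hN1 : (1 : ℝ) ≤ N := by exact_mod_cast hN
  rw [sub_lt_iff_lt_add, div_lt_iff₀ (by positivity)] at h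
  unfold modeRate modeSq
  by_cases hj : j < N
  · simp only [hj, if_true]
    have h1 := mul_le_mul_of_nonneg_left (eigenvalue_one_le (L := L) j) hν.le
    have h2 : 0 ≤ ν * β * (1 / ((N : ℝ) + 1)) := by positivity
    linarith
  · simp only [hj, if_false, add_zero]
    have hx : (N : ℝ) + 1 ≤ j + 1 := by
      have : (N : ℝ) ≤ j := by exact_mod_cast not_lt.1 hj
      linarith
    rw [eigenvalue_succ L j]
    have h1 : ((N : ℝ) + 1) ^ 2 * (ν * eigenvalue L 1) ≤ ((j : ℝ) + 1) ^ 2 * (ν * eigenvalue L 1) := by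
      gcongr
    have h2 : 1 - 1 / ((N : ℝ) + 1) = N / (N + 1) := by field_simp; ring
    have h3 : ν * β * (N / ((N : ℝ) + 1)) ≤ N * ((N : ℝ) + 2) * (ν * eigenvalue L 1) := by
      rw [mul_div_assoc', div_le_iff₀ (by positivity)]
      have hp : 0 < ν * eigenvalue L 1 := by positivity
      have h4 : ν * β ≤ ((N : ℝ) + 2) * (ν * eigenvalue L 1) * (N + 1) := by
        nlinarith [mul_nonneg (mul_nonneg (Nat.cast_nonneg (α := ℝ) N) hp.le)
          (by positivity : (0 : ℝ) ≤ N + 1)]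
      nlinarith
    rw [h2]
    nlinarith

/-! ### The closed-loop problem -/

/-- Only the ratio μ/ν enters the kernel, which justifies working with viscosity 1 in everything
that concerns the transform. -/
theorem kernel_eq_kernel_one {ν : ℝ} (hν : ν ≠ 0) (μ : ℝ) : kernel ν μ = kernel 1 (μ / ν) := by
  ext x y
  have h1 : μ * y / (2 * ν) = μ / ν * y / (2 * 1) := by field_simp
  have h2 : μ / (4 * ν) = μ / ν / (4 * 1) := by field_simp
  rw [kernel, kernel, h1, h2]

/-- On the diagonal only the term m = 0 survives. The kernel thus determines β, which lets the decay
constant be a function of the kernel alone. -/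
theorem kernel_one_diag (β : ℝ) : kernel 1 β 1 1 = -(β / 2) := by
  rw [kernel, tsum_eq_single 0]
  · simp
  · intro m hm; simp [hm]

theorem isWeakSolution_solution {L ν α β : ℝ} (hL : 0 < L) (hν : 0 < ν) (hα : 0 < α) (hβ : 0 < β)
    {N : ℕ} (hadm : Admissible L (kernel 1 β) N) {a : ℕ → ℝ}
    (ha : Summable fun j => a j ^ 2 * sineWeight L 0 j) :
    IsWeakSolution L ν α (kernel 1 β) N (synth L β N a) (solution L ν α β N a) := by
  refine ⟨fun T _ => memLp_two_solution hL hν hα hβ N ha T, ?_⟩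
  rintro φ hφ ⟨R, hR⟩ hbd
  have hR' : ∀ t x, max R 0 ≤ t → φ t x = 0 := fun t x ht => hR t x ((le_max_left _ _).trans ht)
  have h := solution_weak hL hν hα hβ hadm ha hφ (le_max_right R 0) hR' hbd
  rw [← integral_Ioi_eq_intervalIntegral (le_max_right R 0), ← integral_Ioi_eq_intervalIntegral
    (le_max_right R 0)] at h
  · simp only [feedback_eq_feedbackCLM hL hβ hadm]
    exact h
  · intro t ht
    have : φ t = fun _ => 0 := funext fun x => hR' t x ht.le
    rw [this]; simp
  · intro t ht
    simp [adjointOp_eq_zero hR' ht]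

theorem closedLoop {L : ℝ} (hL : 0 < L) {N : ℕ} (hN : 0 < N) {ℓ : ℕ} (hℓ : ℓ = 0 ∨ ℓ = 1)
    {ν α μ : ℝ} (hν : 0 < ν) (hα : 0 < α) (hμ : 0 < μ) (hadm : Admissible L (kernel ν μ) N)
    (u₀ : Sobolev L ℓ)
    (hu : ℓ = 1 → HasBoundaryValues L u₀.toL2 0 (feedback L (kernel ν μ) N u₀.toL2)) :
    ∃ u : ℝ → L2 L,
      IsWeakSolution L ν α (kernel ν μ) N u₀.toL2 u ∧
      (∀ v : ℝ → L2 L, IsWeakSolution L ν α (kernel ν μ) N u₀.toL2 v →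
        ∀ᵐ t ∂volume.restrict (Ioi (0 : ℝ)), v t = u t) ∧
      (∀ᵐ t ∂volume.restrict (Ioi (0 : ℝ)),
        HasBoundaryValues L (u t) 0 (feedback L (kernel ν μ) N (u t))) ∧
      (∀ T : ℝ, 0 < T → MemX L ℓ T u) ∧
      (μ / (2 * ν * eigenvalue L 1) - 1 < N →
        ∀ᵐ t ∂volume.restrict (Ioi (0 : ℝ)), ∃ v : Sobolev L ℓ, v.toL2 = u t ∧
          ‖v‖ ≤ decayConst hL (μ / ν) N ℓ *
            Real.exp (-(ν * eigenvalue L 1 - α + μ * (1 - 1 / ((N : ℝ) + 1))) * t) * ‖u₀‖) := by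
  obtain ⟨β, hβμ⟩ : ∃ β, β = μ / ν := ⟨_, rfl⟩
  have hβ : 0 < β := by rw [hβμ]; positivity
  have hμβ : μ = ν * β := by rw [hβμ]; field_simp
  rw [kernel_eq_kernel_one hν.ne', ← hβμ] at hadm hu ⊢
  have hs := summable_modeCoef hL hβ hadm hℓ u₀ hu
  have hs0 := summable_weight_zero hs
  have hw := isWeakSolution_solution (ν := ν) hL hν hα hβ hadm hs0
  rw [synth_modeCoef hL hβ hadm] at hw
  refine ⟨_, hw, fun v hv => hv.ae_eq hL hβ hadm hw, ?_, fun T hT =>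
    memX_solution hL hν hα hβ N hs hT, fun h => ?_⟩
  · filter_upwards [ae_restrict_mem measurableSet_Ioi] with t ht
    rw [feedback_eq_feedbackCLM hL hβ hadm]
    exact hasBoundaryValues_synth hL hβ hadm (summable_evol hν hβ N hs0 (le_of_lt ht))
      (summable_abs_evol hL hν hβ N hs0 ht)
  · filter_upwards [ae_restrict_mem measurableSet_Ioi] with t ht
    refine ⟨_, toL2_synthSobolev hL β N (summable_evol hν hβ N hs (le_of_lt ht)), ?_⟩
    rw [hμβ] at h ⊢
    exact norm_synthSobolev_evol_le hL hβ hadm u₀ hs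
      (decayRate_le_modeRate hL hν hβ hN h) (le_of_lt ht)

end

end FiniteBackstepping

open FiniteBackstepping in
theorem mainTheorem1 (L : ℝ) (hL : 0 < L) (N : ℕ) (hN : 0 < N) (ℓ : ℕ) (hℓ : ℓ = 0 ∨ ℓ = 1) :
    ∃ c : (ℝ → ℝ → ℝ) → ℝ, (∀ k, 0 ≤ c k) ∧
      ∀ ν α μ : ℝ, 0 < ν → 0 < α →
        0 ≤ α - ν * eigenvalue L 1 → α - ν * eigenvalue L 1 < μ →
        Admissible L (kernel ν μ) N →
        ∀ u₀ : Sobolev L ℓ,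
          (ℓ = 1 → HasBoundaryValues L u₀.toL2 0 (feedback L (kernel ν μ) N u₀.toL2)) →
          ∃ u : ℝ → L2 L,
            IsWeakSolution L ν α (kernel ν μ) N u₀.toL2 u ∧
            (∀ v : ℝ → L2 L, IsWeakSolution L ν α (kernel ν μ) N u₀.toL2 v →
              ∀ᵐ t ∂volume.restrict (Ioi (0 : ℝ)), v t = u t) ∧
            (∀ᵐ t ∂volume.restrict (Ioi (0 : ℝ)),
              HasBoundaryValues L (u t) 0 (feedback L (kernel ν μ) N (u t))) ∧
            (∀ T : ℝ, 0 < T → MemX L ℓ T u) ∧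
            ((N : ℝ) > max (μ / (2 * ν * eigenvalue L 1) - 1)
                (μ / (μ + ν * eigenvalue L 1 - α) - 1) →
              ∀ᵐ t ∂volume.restrict (Ioi (0 : ℝ)), ∃ v : Sobolev L ℓ, v.toL2 = u t ∧
                ‖v‖ ≤ c (kernel ν μ) *
                  Real.exp (-(ν * eigenvalue L 1 - α + μ * (1 - 1 / ((N : ℝ) + 1))) * t) *
                  ‖u₀‖) := by
  -- The constant is fixed before ν, α and μ; its parameter β = μ/ν is read off from the kernel as
  -- -2k(1, 1).
  refine ⟨fun k => decayConst hL (-(2 * k 1 1)) N ℓ, fun k => decayConst_nonneg hL _ N ℓ, ?_⟩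
  intro ν α μ hν hα h0 hμ hadm u₀ hu
  have hβ : -(2 * kernel ν μ 1 1) = μ / ν := by
    rw [kernel_eq_kernel_one hν.ne', kernel_one_diag]; ring
  obtain ⟨u, h1, h2, h3, h4, h5⟩ := closedLoop hL hN hℓ hν hα (h0.trans_lt hμ) hadm u₀ hu
  refine ⟨u, h1, h2, h3, h4, fun h => ?_⟩
  simp only [hβ]
  exact h5 ((le_max_left _ _).trans_lt h)
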